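/- All groups are finite and $p$ is a prime. A subgroup $H$ of a group $G$ satisfies the partial $\Pi$-property in $G$ if there is a chief series $1=G_0<G_1<\cdots<G_n=G$ of $G$ such that for every $i$ with $1\le i\le n$, every prime divisor of the index $|G/G_{i-1}:N_{G/G_{i-1}}(HG_{i-1}/G_{i-1}\cap G_i/G_{i-1})|$ divides the order $|HG_{i-1}/G_{i-1}\cap G_i/G_{i-1}|$. A $2$-group is quaternion-free if it has no section isomorphic to the quaternion group of order $8$. A group is $p$-soluble if each of its chief factors is a $p$-group or a $p'$-group, and the $p$-length of a $p$-soluble group $G$ is the least $n\ge 0$ with $N_n=G$, where $1=P_0\le N_0\le P_1\le N_1\le\cdots$ is the series of normal subgroups of $G$ defined by $N_i/P_i=O_{p'}(G/P_i)$ and $P_{i+1}/N_i=O_p(G/N_i)$. Theorem. Let $G$ be a $p$-soluble group, let $P$ be a Sylow $p$-subgroup of $G$, and let $d$ be a power of $p$ such that $1<d<|P|$. Assume that every subgroup of $P$ of order $d$ satisfies the partial $\Pi$-property in $G$ and, if $d=2$ and $P$ is not quaternion-free, assume moreover that every cyclic subgroup of $P$ of order $4$ satisfies the partial $\Pi$-property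 in $G$. Then $G$ has $p$-length at most $1$. -/

import Mathlib

/-- `L/K` is a chief factor of `G`: `K < L` are normal in `G` and no normal subgroup of `G` lies
strictly between them. -/
structure IsChiefFactor {G : Type*} [Group G] (K L : Subgroup G) : Prop where
  normal_left : K.Normal
  normal_right : L.Normal
  lt : K < L
  eq_or_eq : ∀ M : Subgroup G, M.Normal → K ≤ M → M ≤ L → M = K ∨ M = L

/-- A chief series `1 = G₀ < G₁ < ⋯ < Gₙ = G` of `G`. The trivial group has the one with
`n = 0`. -/
structure ChiefSeries (G : Type*) [Group G] where
  length : ℕ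
  term : Fin (length + 1) → Subgroup G
  term_normal : ∀ i, (term i).Normal
  term_zero : term 0 = ⊥
  term_last : term (Fin.last length) = ⊤
  chief : ∀ i : Fin length, IsChiefFactor (term i.castSucc) (term i.succ)

attribute [instance] ChiefSeries.term_normal

/-- `n` is a `π`-number: all prime divisors of `n` belong to `π`. -/
def IsPiNumber (π : Set ℕ) (n : ℕ) : Prop :=
  ∀ q : ℕ, q.Prime → q ∣ n → q ∈ π

/-- `π(X)`: the set of primes dividing the order of `X`. -/
def primesOf (X : Type*) : Set ℕ :=
  {q : ℕ | q.Prime ∧ q ∣ Nat.card X}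

/-- The subgroup `HK/K ∩ L/K` of `G/K`. -/
def factorInter {G : Type*} [Group G] (H K L : Subgroup G) [K.Normal] : Subgroup (G ⧸ K) :=
  H.map (QuotientGroup.mk' K) ⊓ L.map (QuotientGroup.mk' K)

/-- The partial `Π`-property of a subgroup `H` of `G`: for some chief series of `G`, each index
`|G/Gᵢ : N_{G/Gᵢ}(HGᵢ/Gᵢ ∩ Gᵢ₊₁/Gᵢ)|` is a `π(HGᵢ/Gᵢ ∩ Gᵢ₊₁/Gᵢ)`-number. -/
def PartialPiProperty {G : Type*} [Group G] (H : Subgroup G) : Prop :=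
  ∃ Γ : ChiefSeries G, ∀ i : Fin Γ.length,
    IsPiNumber (primesOf (factorInter H (Γ.term i.castSucc) (Γ.term i.succ)))
      (Subgroup.normalizer
        (factorInter H (Γ.term i.castSucc) (Γ.term i.succ) :
          Set (G ⧸ Γ.term i.castSucc))).index

/-- No section `A/B` of `P` is isomorphic to the quaternion group of order `8`. -/
def IsQuaternionFree (P : Type*) [Group P] : Prop :=
  ∀ (A : Subgroup P) (B : Subgroup A) [B.Normal], IsEmpty ((A ⧸ B) ≃* QuaternionGroup 2)

/-- `p`-solubility of a finite group: every chief factor `L/K` is a `p`-group or a `p'`-group.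
The order of `L/K` is the index of `K` in `L`. -/
def IsPSoluble (p : ℕ) (G : Type*) [Group G] : Prop :=
  ∀ K L : Subgroup G, IsChiefFactor K L →
    (∃ k : ℕ, K.relIndex L = p ^ k) ∨ (K.relIndex L).Coprime p

/-- `O_p(G)`: the subgroup generated by all normal `p`-subgroups. -/
def pCore (p : ℕ) (G : Type*) [Group G] : Subgroup G :=
  sSup {N : Subgroup G | N.Normal ∧ ∃ k : ℕ, Nat.card N = p ^ k}

/-- `O_{p'}(G)`: the subgroup generated by all normal `p'`-subgroups. -/
def pPrimeCore (p : ℕ) (G : Type*) [Group G] : Subgroup G :=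
  sSup {N : Subgroup G | N.Normal ∧ (Nat.card N).Coprime p}

instance pCore_normal (p : ℕ) (G : Type*) [Group G] : (pCore p G).Normal :=
  Subgroup.sSup_normal _ fun _ h => h.1

instance pPrimeCore_normal (p : ℕ) (G : Type*) [Group G] : (pPrimeCore p G).Normal :=
  Subgroup.sSup_normal _ fun _ h => h.1

/-- The preimage in `G` of `O_p(G/K)`. -/
def pCoreOver (p : ℕ) {G : Type*} [Group G] (K : Subgroup G) [K.Normal] : Subgroup G :=
  (pCore p (G ⧸ K)).comap (QuotientGroup.mk' K)

/-- The preimage in `G` of `O_{p'}(G/K)`. -/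
def pPrimeCoreOver (p : ℕ) {G : Type*} [Group G] (K : Subgroup G) [K.Normal] : Subgroup G :=
  (pPrimeCore p (G ⧸ K)).comap (QuotientGroup.mk' K)

instance pCoreOver_normal (p : ℕ) {G : Type*} [Group G] (K : Subgroup G) [K.Normal] :
    (pCoreOver p K).Normal :=
  Subgroup.Normal.comap (pCore_normal p (G ⧸ K)) _

instance pPrimeCoreOver_normal (p : ℕ) {G : Type*} [Group G] (K : Subgroup G) [K.Normal] :
    (pPrimeCoreOver p K).Normal :=
  Subgroup.Normal.comap (pPrimeCore_normal p (G ⧸ K)) _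

/-- The terms `N₀ ≤ N₁ ≤ ⋯` of the upper `p'p`-series
`1 = P₀ ≤ N₀ ≤ P₁ ≤ N₁ ≤ ⋯`, where `Nᵢ/Pᵢ = O_{p'}(G/Pᵢ)` and `Pᵢ₊₁/Nᵢ = O_p(G/Nᵢ)`;
so `N₀ = O_{p'}(G)` and `N₁ = O_{p'pp'}(G)`. -/
def upperSeries (p : ℕ) (G : Type*) [Group G] : ℕ → {N : Subgroup G // N.Normal}
  | 0 => ⟨pPrimeCore p G, inferInstance⟩
  | n + 1 =>
    have := (upperSeries p G n).2
    ⟨pPrimeCoreOver p (pCoreOver p (upperSeries p G n).1), inferInstance⟩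

/-- The `p`-length of `G`: the least `n` with `Nₙ = G` in the upper `p'p`-series
(and `⊤` if there is none, which means that `G` is not `p`-soluble). -/
noncomputable def pLength (p : ℕ) (G : Type*) [Group G] : ℕ∞ :=
  ⨅ (n : ℕ) (_ : (upperSeries p G n).1 = ⊤), (n : ℕ∞)

/-!
The order of `H ⊓ L` for a `p`-subgroup `H` is a power of `p`, so the partial `Π`-property of `H`
says that for some chief series every normalizer of `(H ⊓ Gᵢ₊₁)Gᵢ` has `p`-power index. If a Sylow
`p`-subgroup `P` normalizes `H`, then these subgroups are normal in `G`, so `H` covers or avoids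
each factor of the series. The hypothesis is turned into this form at the outset (`PiHyp`), and is
used through subgroups `H` of `P` chosen so that `P` normalizes the relevant intersections.

The proof is by induction on `|G|`. Normal `p'`-subgroups are factored out, so let `O_{p'}(G) = 1`.

* Let `d = p` (`pLengthLeOne_of_eq_prime`), and suppose that `P` is not normal. Let `J` be the set
  of `p'`-elements that act trivially on all `G`-invariant sections of order `p` of `O_p(G)`. There
  is a smallest normal subgroup `L` of `G` inside `O_p(G)` that `J` does not centralize. Its
  subgroup `K` fixed by `J` contains every proper `G`-invariant subgroup, `|L : K| ≠ p`, and `L` has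
  exponent `p`; or exponent dividing `4` if `p = 2`, and `2` if moreover `P` is quaternion-free. So
  the hypothesis applies to `⟨x⟩` for `x ∈ L` outside `K`. If `P` normalizes `K⟨x⟩` and
  `|K⟨x⟩ : K| = p`, then the factor that covers `L/K` forces `K⟨x⟩ = L`, a contradiction. The same
  argument settles `d = 4` when all minimal normal subgroups have order `2`
  (`pLengthLeOne_of_eq_four`).
* In general a minimal normal subgroup `N` has order at most `d`. If `|N| = d > p` for one of them,
  then all of them have order `d` and the same centralizer (`card_and_centralizer_eq`), the socle is
  `O_p(G)` (`le_socle_of_card_eq`), and unless `P` is the socle, the socle has a complement, which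
  yields a subgroup that violates the hypothesis (`pLengthLeOne_of_card_eq`).
* Otherwise `|N| < d` for all `N`, and `G/N` satisfies the hypothesis with `d/|N|` in place of `d`,
  unless `|N| = d/2` and `PN/N` is not quaternion-free. In that exceptional case `|N| = 2` leads
  back to `d = 4`, and `|N| ≥ 4` is excluded by `false_of_two_large` and `sq_mem_of_unique`, unless
  there is a minimal normal subgroup of order `2`; that one is central and its quotient is not
  exceptional. If all quotients have `p`-length at most `1`, then two minimal normal subgroups embed
  `G` in a product, and a unique one would have a complement, which is impossible
  (`false_of_unique_of_complement`).
-/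

namespace PiLength

open Subgroup

variable {G : Type*} [Group G]

/-! ### Subgroups of finite groups -/

theorem card_mul_relIndex {K L : Subgroup G} (h : K ≤ L) :
    Nat.card K * K.relIndex L = Nat.card L := by
  rw [← relIndex_bot_left, relIndex_mul_relIndex ⊥ K L bot_le h, relIndex_bot_left]

theorem relIndex_pos [Finite G] (K L : Subgroup G) : 0 < K.relIndex L :=
  Nat.pos_of_ne_zero (Nat.card_pos (α := L ⧸ K.subgroupOf L)).ne'

theorem one_lt_relIndex [Finite G] {K L : Subgroup G} (h : K < L) : 1 < K.relIndex L := by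
  have h0 := relIndex_pos K L
  have h1 : K.relIndex L ≠ 1 := fun h1 => h.not_ge (relIndex_eq_one.1 h1)
  omega

theorem sup_inf_eq {A B C : Subgroup G} [B.Normal] (h : A ≤ C) :
    (A ⊔ B) ⊓ C = A ⊔ (B ⊓ C) := by
  apply le_antisymm
  · rintro x ⟨hx, hxC⟩
    obtain ⟨a, ha, b, hb, rfl⟩ := mem_sup_of_normal_right.1 hx
    exact mul_mem (mem_sup_left ha)
      (mem_sup_right ⟨hb, by simpa using mul_mem (inv_mem (h ha)) hxC⟩)
  · exact sup_le (le_inf le_sup_left h) (inf_le_inf le_sup_right le_rfl)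

theorem sup_inf_eq' {A B C : Subgroup G} [A.Normal] (h : A ≤ C) :
    (A ⊔ B) ⊓ C = A ⊔ (B ⊓ C) := by
  apply le_antisymm
  · rintro x ⟨hx, hxC⟩
    obtain ⟨a, ha, b, hb, rfl⟩ := mem_sup_of_normal_left.1 hx
    exact mul_mem (mem_sup_left ha)
      (mem_sup_right ⟨hb, by simpa using mul_mem (inv_mem (h ha)) hxC⟩)
  · exact sup_le (le_inf le_sup_left h) (inf_le_inf le_sup_right le_rfl)

theorem exists_isChiefFactor_le [Finite G] {K L : Subgroup G} [K.Normal] [L.Normal]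
    (h : K < L) : ∃ M, IsChiefFactor K M ∧ M ≤ L := by
  obtain ⟨M, hM, hmin⟩ := Set.Finite.exists_minimal
    (s := {M : Subgroup G | M.Normal ∧ K < M ∧ M ≤ L}) (Set.toFinite _) ⟨L, ‹_›, h, le_rfl⟩
  refine ⟨M, ⟨‹_›, hM.1, hM.2.1, fun X hX hKX hXM => ?_⟩, hM.2.2⟩
  rcases hKX.eq_or_lt with h1 | h1
  · exact Or.inl h1.symm
  · exact Or.inr (le_antisymm hXM (hmin ⟨hX, h1, hXM.trans hM.2.2⟩ hXM))

theorem normal_inf (A B : Subgroup G) (hA : A.Normal) (hB : B.Normal) : (A ⊓ B).Normal :=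
  inferInstance

theorem normal_sup (A B : Subgroup G) (hA : A.Normal) (hB : B.Normal) : (A ⊔ B).Normal :=
  inferInstance

theorem le_normalizer_inf {P A B : Subgroup G} (hA : P ≤ normalizer (A : Set G))
    (hB : P ≤ normalizer (B : Set G)) : P ≤ normalizer ((A ⊓ B : Subgroup G) : Set G) :=
  (le_inf hA hB).trans inf_normalizer_le_normalizer_inf

theorem le_normalizer_sup {P A B : Subgroup G} (hA : P ≤ normalizer (A : Set G))
    (hB : P ≤ normalizer (B : Set G)) : P ≤ normalizer ((A ⊔ B : Subgroup G) : Set G) :=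
  (le_inf hA hB).trans (normalizer_inf_normalizer_le_normalizer_sup A B)

/-- If a Sylow `p`-subgroup normalizes `V` and `V` has `p`-power many conjugates, then `V` is
normal. -/
theorem normal_of_index_pow [Finite G] {p : ℕ} [Fact p.Prime] (P : Sylow p G) {V : Subgroup G}
    (hP : (P : Subgroup G) ≤ normalizer (V : Set G))
    (hV : ∃ k, (normalizer (V : Set G)).index = p ^ k) : V.Normal := by
  obtain ⟨k, hk⟩ := hV
  rw [← normalizer_eq_top_iff, ← index_eq_one]
  have h1 : ¬ p ∣ (normalizer (V : Set G)).index := fun h =>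
    P.not_dvd_index (h.trans (index_dvd_of_le hP))
  rcases k.eq_zero_or_pos with rfl | hk0
  · simpa using hk
  · exact absurd (hk ▸ dvd_pow_self p hk0.ne') h1

theorem isPGroup_le {p : ℕ} {A B : Subgroup G} (hB : IsPGroup p B) (h : A ≤ B) : IsPGroup p A :=
  hB.to_le h

theorem relIndex_eq_pow [Finite G] {p : ℕ} [Fact p.Prime] {K L : Subgroup G}
    (hL : IsPGroup p L) : ∃ k, K.relIndex L = p ^ k := by
  obtain ⟨n, hn⟩ := IsPGroup.iff_card.1 hL
  obtain ⟨k, -, hk⟩ := (Nat.dvd_prime_pow (Fact.out : p.Prime)).1 (hn ▸ relIndex_dvd_card K L)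
  exact ⟨k, hk⟩

theorem isPGroup_of_relIndex [Finite G] {p : ℕ} [Fact p.Prime] {K L : Subgroup G} (h : K ≤ L)
    (hK : IsPGroup p K) {k : ℕ} (hk : K.relIndex L = p ^ k) : IsPGroup p L := by
  obtain ⟨n, hn⟩ := IsPGroup.iff_card.1 hK
  exact IsPGroup.of_card (n := n + k) (by rw [← card_mul_relIndex h, hn, hk, pow_add])

/-- A nontrivial normal subgroup of a finite `p`-group contains a central element of order `p`. -/
theorem exists_central_of_normal {Q : Type*} [Group Q] [Finite Q] {p : ℕ} [hp : Fact p.Prime]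
    (hQ : IsPGroup p Q) (N : Subgroup Q) [N.Normal] (hN : N ≠ ⊥) :
    ∃ z ∈ N, z ≠ 1 ∧ z ^ p = 1 ∧ ∀ q : Q, q * z = z * q := by
  have hN' : Nontrivial N := (nontrivial_iff_ne_bot N).2 hN
  have hQ' : IsPGroup p (ConjAct Q) := hQ
  have hdvd : p ∣ Nat.card N := by
    rcases (hQ.to_subgroup N).card_eq_or_dvd with h | h
    · exact absurd (card_eq_one.1 h) hN
    · exact h
  obtain ⟨b, hb, hb1⟩ := hQ'.exists_fixed_point_of_prime_dvd_card_of_fixed_point N hdvd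
    (a := 1) (fun g => smul_one g)
  have hbc : ∀ q : Q, q * b = b * q := fun q => by
    have := congrArg (Subtype.val) (hb (ConjAct.toConjAct q))
    rw [ConjAct.Subgroup.val_conj_smul, ConjAct.toConjAct_smul] at this
    exact mul_inv_eq_iff_eq_mul.1 this
  have hb1' : (b : Q) ≠ 1 := fun h => hb1 (Subtype.ext h.symm)
  obtain ⟨k, hk⟩ := (IsPGroup.iff_orderOf.1 hQ) (b : Q)
  have hk0 : k ≠ 0 := fun h => hb1' (by rw [← orderOf_eq_one_iff, hk, h, pow_zero])
  obtain ⟨m, rfl⟩ := Nat.exists_eq_succ_of_ne_zero hk0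
  refine ⟨(b : Q) ^ p ^ m, pow_mem b.2 _, fun h => ?_, ?_, fun q => ?_⟩
  · have := orderOf_dvd_of_pow_eq_one h
    rw [hk] at this
    exact absurd (Nat.le_of_dvd (pow_pos hp.out.pos _) this)
      (not_le.2 (Nat.pow_lt_pow_right hp.out.one_lt (Nat.lt_succ_self m)))
  · rw [← pow_mul, ← pow_succ, ← Nat.succ_eq_add_one, ← hk, pow_orderOf_eq_one]
  · exact (Commute.pow_right (hbc q) _)

/-- The centre of a `p`-group meets its normal subgroups nontrivially; here in the section `B/A`. -/
theorem exists_central_mod [Finite G] {p : ℕ} [Fact p.Prime] {R A B : Subgroup G}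
    (hR : IsPGroup p R) (hA : R ≤ normalizer (A : Set G)) (hB : R ≤ normalizer (B : Set G))
    (hAB : A < B) (hBR : B ≤ R) :
    ∃ b ∈ B, b ∉ A ∧ b ^ p ∈ A ∧ ∀ r ∈ R, r * b * r⁻¹ * b⁻¹ ∈ A := by
  have hAn : (A.subgroupOf R).Normal :=
    (normal_subgroupOf_iff_le_normalizer (hAB.le.trans hBR)).2 hA
  have hBn : (B.subgroupOf R).Normal := (normal_subgroupOf_iff_le_normalizer hBR).2 hB
  let f := QuotientGroup.mk' (A.subgroupOf R)
  have hne : (B.subgroupOf R).map f ≠ ⊥ := by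
    intro h
    rw [Subgroup.map_eq_bot_iff, QuotientGroup.ker_mk'] at h
    exact hAB.not_ge fun x hx => mem_subgroupOf.1 (h (mem_subgroupOf.2 hx : ⟨x, hBR hx⟩ ∈ _))
  have : ((B.subgroupOf R).map f).Normal := hBn.map f (QuotientGroup.mk'_surjective _)
  obtain ⟨z, hz, hz1, hzp, hzc⟩ := exists_central_of_normal (hR.to_quotient (A.subgroupOf R)) _ hne
  obtain ⟨b, hb, rfl⟩ := hz
  have key : ∀ r : R, f r = 1 ↔ (r : G) ∈ A := fun r => by
    rw [← mem_subgroupOf]; exact QuotientGroup.eq_one_iff r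
  refine ⟨b, hb, fun h => hz1 ((key b).2 h), ?_, fun r hr => ?_⟩
  · have := (key (b ^ p)).1 (by rw [map_pow]; exact hzp)
    simpa using this
  · have := (key (⟨r, hr⟩ * b * ⟨r, hr⟩⁻¹ * b⁻¹)).1 (by
      rw [map_mul, map_mul, map_mul, hzc, map_inv, map_inv]; group)
    simpa using this

/-- `⟨b⟩A` has index `p` over `A` when `b ∉ A` normalizes `A` and `bᵖ ∈ A`. -/
theorem relIndex_zpowers_sup [Finite G] {p : ℕ} [hp : Fact p.Prime] {A : Subgroup G} {b : G}
    (hb : b ∉ A) (hbp : b ^ p ∈ A) (hn : b ∈ normalizer (A : Set G)) :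
    A.relIndex (A ⊔ zpowers b) = p := by
  have hnb : zpowers b ≤ normalizer (A : Set G) := zpowers_le.2 hn
  have h1 : A.relIndex (A ⊔ zpowers b) = A.relIndex (zpowers b) := by
    let N := normalizer (A : Set G)
    have hAN : A ≤ N := le_normalizer
    have : (A.subgroupOf N).Normal := inferInstance
    have h2 := relIndex_sup_left ((zpowers b).subgroupOf N) (A.subgroupOf N)
    rwa [← subgroupOf_sup hAN hnb, relIndex_subgroupOf (sup_le hAN hnb),
      relIndex_subgroupOf hnb] at h2
  rw [h1]
  have hle : zpowers (b ^ p) ≤ A := zpowers_le.2 hbp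
  have hle2 : zpowers (b ^ p) ≤ zpowers b := zpowers_le.2 (pow_mem (mem_zpowers b) p)
  have hd : A.relIndex (zpowers b) ∣ p := by
    refine (relIndex_dvd_of_le_left (zpowers b) hle).trans ?_
    have h3 := card_mul_relIndex hle2
    rw [Nat.card_zpowers, Nat.card_zpowers, orderOf_pow] at h3
    have h4 : 0 < orderOf b := orderOf_pos b
    rcases (Nat.coprime_or_dvd_of_prime hp.out (orderOf b)) with h5 | h5
    · rw [Nat.Coprime.gcd_eq_one (Nat.Coprime.symm h5), Nat.div_one] at h3
      have : (zpowers (b ^ p)).relIndex (zpowers b) = 1 := by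
        exact Nat.eq_of_mul_eq_mul_left h4 (by rw [h3, mul_one])
      rw [this]; exact one_dvd _
    · rw [Nat.gcd_eq_right h5] at h3
      have : (zpowers (b ^ p)).relIndex (zpowers b) = p := by
        refine Nat.eq_of_mul_eq_mul_left (Nat.div_pos (Nat.le_of_dvd h4 h5) hp.out.pos) ?_
        rw [h3, Nat.div_mul_cancel h5]
      rw [this]
  rcases (Nat.dvd_prime hp.out).1 hd with h | h
  · exact absurd (zpowers_le.1 (relIndex_eq_one.1 h)) hb
  · exact h

theorem exists_relIndex_eq_prime [Finite G] {p : ℕ} [Fact p.Prime] {R A B : Subgroup G}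
    (hR : IsPGroup p R) (hA : R ≤ normalizer (A : Set G)) (hB : R ≤ normalizer (B : Set G))
    (hAB : A < B) (hBR : B ≤ R) :
    ∃ b ∈ B, b ∉ A ∧ b ^ p ∈ A ∧ R ≤ normalizer ((A ⊔ zpowers b : Subgroup G) : Set G) ∧
      A.relIndex (A ⊔ zpowers b) = p := by
  obtain ⟨b, hbB, hbA, hbp, hbc⟩ := exists_central_mod hR hA hB hAB hBR
  refine ⟨b, hbB, hbA, hbp, ?_, relIndex_zpowers_sup hbA hbp (hA (hBR hbB))⟩
  have hR' : ∀ r ∈ R, ∀ x ∈ A ⊔ zpowers b, r * x * r⁻¹ ∈ A ⊔ zpowers b := by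
    intro r hr
    have : A ⊔ zpowers b ≤ (A ⊔ zpowers b).comap (MulAut.conj r).toMonoidHom := by
      refine sup_le (fun a ha => ?_) (zpowers_le.2 ?_)
      · exact mem_sup_left ((mem_normalizer_iff.1 (hA hr) a).1 ha)
      · have h := mem_sup_left (T := zpowers b) (hbc r hr)
        have := mul_mem h (mem_sup_right (S := A) (mem_zpowers b))
        simpa using this
    exact fun x hx => this hx
  exact le_normalizer_iff.2 hR'

/-- Between two subgroups normalized by a finite `p`-group there are normalized subgroups of every
possible order. -/
theorem exists_between_normalized [Finite G] {p : ℕ} [hp : Fact p.Prime] {R A B : Subgroup G}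
    (hR : IsPGroup p R) (hA : R ≤ normalizer (A : Set G)) (hB : R ≤ normalizer (B : Set G))
    (hAB : A ≤ B) (hBR : B ≤ R) {k : ℕ} (h1 : Nat.card A ≤ p ^ k) (h2 : p ^ k ≤ Nat.card B) :
    ∃ X, A ≤ X ∧ X ≤ B ∧ R ≤ normalizer (X : Set G) ∧ Nat.card X = p ^ k := by
  obtain ⟨X, hX, hmax⟩ := Set.Finite.exists_maximal
    (s := {X : Subgroup G | A ≤ X ∧ X ≤ B ∧ R ≤ normalizer (X : Set G) ∧ Nat.card X ≤ p ^ k})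
    (Set.toFinite _) ⟨A, le_rfl, hAB, hA, h1⟩
  refine ⟨X, hX.1, hX.2.1, hX.2.2.1, le_antisymm hX.2.2.2 ?_⟩
  rcases hX.2.1.eq_or_lt with h | h
  · rw [h]; exact h2
  obtain ⟨b, hbB, hbX, -, hn, hi⟩ := exists_relIndex_eq_prime hR hX.2.2.1 hB h hBR
  obtain ⟨m, hm⟩ := IsPGroup.iff_card.1 (isPGroup_le hR (hX.2.1.trans hBR))
  have hc := card_mul_relIndex (le_sup_left : X ≤ X ⊔ zpowers b)
  rw [hi, hm, ← pow_succ] at hc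
  by_contra hlt
  rw [not_le, hm] at hlt
  have hmk : m + 1 ≤ k := (Nat.pow_lt_pow_iff_right hp.out.one_lt).1 hlt
  have h3 : X ⊔ zpowers b ≤ X := hmax ⟨hX.1.trans le_sup_left, sup_le hX.2.1 (zpowers_le.2 hbB), hn,
    hc ▸ Nat.pow_le_pow_right hp.out.pos hmk⟩ le_sup_left
  exact hbX (h3 (mem_sup_right (mem_zpowers b)))

/-- A normal `p`-subgroup centralizes the chief factors below it. -/
theorem commutator_mem_of_isChiefFactor [Finite G] {p : ℕ} [Fact p.Prime] {R K L : Subgroup G}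
    [R.Normal] (hR : IsPGroup p R) (hKL : IsChiefFactor K L) (hLR : L ≤ R) :
    ∀ l ∈ L, ∀ r ∈ R, r * l * r⁻¹ * l⁻¹ ∈ K := by
  have := hKL.normal_left
  have := hKL.normal_right
  let f := QuotientGroup.mk' K
  have key : ∀ x : G, f x = 1 ↔ x ∈ K := fun x => QuotientGroup.eq_one_iff x
  let M : Subgroup G := L ⊓ (centralizer (R.map f : Set (G ⧸ K))).comap f
  have hM : ∀ x, x ∈ M ↔ x ∈ L ∧ ∀ r ∈ R, r * x * r⁻¹ * x⁻¹ ∈ K := by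
    intro x
    simp only [M, mem_inf, mem_comap, mem_centralizer_iff, coe_map, Set.forall_mem_image,
      SetLike.mem_coe]
    refine and_congr_right fun _ => forall₂_congr fun r _ => ?_
    rw [← key, map_mul, map_mul, map_mul, map_inv, map_inv, mul_inv_eq_one, mul_inv_eq_iff_eq_mul]
  have hMn : M.Normal := by
    have h1 : (R.map f).Normal := ‹R.Normal›.map f (QuotientGroup.mk'_surjective K)
    have h2 : ((centralizer (R.map f : Set (G ⧸ K)))).Normal := inferInstance
    exact normal_inf _ _ inferInstance (h2.comap f)
  have hKM : K ≤ M := fun x hx => (hM x).2 ⟨hKL.lt.le hx, fun r _ =>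
    mul_mem (‹K.Normal›.conj_mem x hx r) (inv_mem hx)⟩
  obtain ⟨b, hb, hbK, -, hbc⟩ := exists_central_mod hR le_normalizer_of_normal
    le_normalizer_of_normal hKL.lt hLR
  rcases hKL.eq_or_eq M hMn hKM inf_le_left with h | h
  · exact absurd (h ▸ (hM b).2 ⟨hb, hbc⟩) hbK
  · exact fun l hl => ((hM l).1 (h ▸ hl)).2

theorem pow_mem_of_isChiefFactor [Finite G] {p : ℕ} [Fact p.Prime] {K L : Subgroup G}
    (hL : IsPGroup p L) (hKL : IsChiefFactor K L) : ∀ l ∈ L, l ^ p ∈ K := by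
  have := hKL.normal_left
  have := hKL.normal_right
  let f := QuotientGroup.mk' K
  have key : ∀ x : G, f x = 1 ↔ x ∈ K := fun x => QuotientGroup.eq_one_iff x
  have hcomm : ∀ x ∈ L, ∀ y ∈ L, f (x * y) = f (y * x) := fun x hx y hy => by
    have := (key _).2 (commutator_mem_of_isChiefFactor hL hKL le_rfl y hy x hx)
    rw [map_mul, map_mul, map_mul, map_inv, map_inv, mul_inv_eq_one, mul_inv_eq_iff_eq_mul] at this
    rw [map_mul, map_mul, this]
  let M : Subgroup G :=
    { carrier := {x | x ∈ L ∧ x ^ p ∈ K}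
      one_mem' := ⟨one_mem _, by simp⟩
      mul_mem' := fun {x y} hx hy => ⟨mul_mem hx.1 hy.1, by
        rw [← key, map_pow, map_mul, (show Commute (f x) (f y) by
          simpa [Commute, SemiconjBy] using hcomm x hx.1 y hy.1).mul_pow, ← map_pow, ← map_pow,
          (key _).2 hx.2, (key _).2 hy.2, one_mul]⟩
      inv_mem' := fun {x} hx => ⟨inv_mem hx.1, by rw [inv_pow]; exact inv_mem hx.2⟩ }
  have hMn : M.Normal := ⟨fun x hx g => ⟨hKL.normal_right.conj_mem x hx.1 g, by
    rw [conj_pow]; exact hKL.normal_left.conj_mem _ hx.2 g⟩⟩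
  have hKM : K ≤ M := fun x hx => ⟨hKL.lt.le hx, pow_mem hx p⟩
  obtain ⟨b, hb, hbK, hbp, -⟩ := exists_central_mod hL le_normalizer_of_normal
    le_normalizer_of_normal hKL.lt le_rfl
  rcases hKL.eq_or_eq M hMn hKM (fun x hx => hx.1) with h | h
  · exact absurd (h ▸ (show b ∈ M from ⟨hb, hbp⟩)) hbK
  · exact fun l hl => (h.symm ▸ hl : l ∈ M).2

/-! ### Chief chains adapted to a subgroup -/

/-- A chain of normal subgroups from `1` to `G`, each step trivial or a chief factor, such that
every `(H ∩ cᵢ₊₁)cᵢ` has `p`-power many conjugates. For a `p`-subgroup `H` this expresses the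
partial `Π`-property. Steps may be trivial so that the notion passes to quotients. -/
structure IsPiChain (p : ℕ) (H : Subgroup G) (c : ℕ → Subgroup G) (n : ℕ) : Prop where
  normal : ∀ i, (c i).Normal
  zero : c 0 = ⊥
  last : c n = ⊤
  le_succ : ∀ i, c i ≤ c (i + 1)
  chief : ∀ i (M : Subgroup G), M.Normal → c i ≤ M → M ≤ c (i + 1) → M = c i ∨ M = c (i + 1)
  index : ∀ i, ∃ k, (normalizer (((H ⊓ c (i + 1)) ⊔ c i : Subgroup G) : Set G)).index = p ^ k

/-- Some chief chain is adapted to `H`. -/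
def HasPiChain (p : ℕ) (H : Subgroup G) : Prop :=
  ∃ c n, IsPiChain p H c n

theorem comap_factorInter {H K L : Subgroup G} [K.Normal] (h : K ≤ L) :
    (factorInter H K L).comap (QuotientGroup.mk' K) = (H ⊓ L) ⊔ K := by
  rw [factorInter, comap_inf, comap_map_eq, comap_map_eq, QuotientGroup.ker_mk',
    sup_eq_left.2 h, sup_comm H K, sup_inf_eq' h, sup_comm]

theorem index_normalizer_eq_pow_of_isPiNumber [Finite G] {p : ℕ} [hp : Fact p.Prime]
    {H K L : Subgroup G} [K.Normal] (hH : IsPGroup p H) (hKL : K ≤ L)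
    (h : IsPiNumber (primesOf (factorInter H K L))
      (normalizer (factorInter H K L : Set (G ⧸ K))).index) :
    ∃ k, (normalizer (((H ⊓ L) ⊔ K : Subgroup G) : Set G)).index = p ^ k := by
  have hsurj := QuotientGroup.mk'_surjective K
  rw [← comap_factorInter hKL, ← comap_normalizer_eq_of_surjective _ hsurj,
    index_comap_of_surjective _ hsurj]
  have hF : IsPGroup p (factorInter H K L) := isPGroup_le (hH.map _) inf_le_left
  refine ⟨_, Nat.eq_prime_pow_of_unique_prime_dvd ?_ fun {q} hq hqd => ?_⟩
  · exact Nat.card_pos.ne'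
  · obtain ⟨m, hm⟩ := IsPGroup.iff_card.1 hF
    have h2 : q ∣ p ^ m := hm ▸ (h q hq hqd).2
    exact (Nat.prime_dvd_prime_iff_eq hq hp.out).1 (hq.dvd_of_dvd_pow h2)

theorem hasPiChain_of_partialPiProperty [Finite G] {p : ℕ} [hp : Fact p.Prime] {H : Subgroup G}
    (hH : IsPGroup p H) (h : PartialPiProperty H) : HasPiChain p H := by
  obtain ⟨Γ, hΓ⟩ := h
  have key : ∀ i (hi : i < Γ.length), ∃ k, (normalizer
      (((H ⊓ Γ.term ⟨i + 1, by omega⟩) ⊔ Γ.term ⟨i, by omega⟩ : Subgroup G) : Set G)).index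
        = p ^ k := fun i hi =>
    index_normalizer_eq_pow_of_isPiNumber hH (Γ.chief ⟨i, hi⟩).lt.le (hΓ ⟨i, hi⟩)
  refine ⟨fun i => if hi : i ≤ Γ.length then Γ.term ⟨i, by omega⟩ else ⊤, Γ.length,
    ⟨?_, ?_, ?_, ?_, ?_, ?_⟩⟩
  · intro i
    split_ifs <;> infer_instance
  · simpa using Γ.term_zero
  · simpa [Fin.last] using Γ.term_last
  · intro i
    by_cases hi : i + 1 ≤ Γ.length
    · rw [dif_pos hi, dif_pos (by omega)]
      exact (Γ.chief ⟨i, hi⟩).lt.le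
    · rw [dif_neg hi]; exact le_top
  · intro i M hM h1 h2
    by_cases hi : i + 1 ≤ Γ.length
    · rw [dif_pos hi] at h2 ⊢
      rw [dif_pos (by omega)] at h1 ⊢
      exact (Γ.chief ⟨i, hi⟩).eq_or_eq M hM h1 h2
    · rw [dif_neg hi] at h2 ⊢
      have h3 : (if hi : i ≤ Γ.length then Γ.term ⟨i, by omega⟩ else ⊤) = (⊤ : Subgroup G) := by
        split_ifs with h4
        · have : i = Γ.length := by omega
          subst this
          exact Γ.term_last
        · rfl
      rw [h3] at h1 ⊢
      exact Or.inl (top_le_iff.1 h1)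
  · intro i
    by_cases hi : i + 1 ≤ Γ.length
    · rw [dif_pos hi, dif_pos (by omega)]
      exact key i hi
    · have h3 : (if hi : i ≤ Γ.length then Γ.term ⟨i, by omega⟩ else ⊤) = (⊤ : Subgroup G) := by
        split_ifs with h4
        · have : i = Γ.length := by omega
          subst this
          exact Γ.term_last
        · rfl
      rw [h3, sup_top_eq]
      exact ⟨0, by rw [normalizer_eq_top (H := (⊤ : Subgroup G)), index_top, pow_zero]⟩

theorem index_normalizer_pow_of_le [Finite G] {p : ℕ} [hp : Fact p.Prime] {A B : Subgroup G}
    (h : normalizer (A : Set G) ≤ normalizer (B : Set G))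
    (hA : ∃ k, (normalizer (A : Set G)).index = p ^ k) :
    ∃ k, (normalizer (B : Set G)).index = p ^ k := by
  obtain ⟨k, hk⟩ := hA
  obtain ⟨m, -, hm⟩ := (Nat.dvd_prime_pow hp.out).1 (hk ▸ index_dvd_of_le h)
  exact ⟨m, hm⟩

/-- The condition `hN` says that intersecting `H` with normal subgroups commutes with passing to
`G/N`; it holds if `N ≤ H`, and if `N` has order prime to that of `H`. -/
theorem HasPiChain.map [Finite G] {p : ℕ} [Fact p.Prime] {H N : Subgroup G} [N.Normal]
    (hH : HasPiChain p H)
    (hN : ∀ C : Subgroup G, C.Normal → (H ⊔ N) ⊓ (C ⊔ N) = (H ⊓ C) ⊔ N) :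
    HasPiChain p (H.map (QuotientGroup.mk' N)) := by
  obtain ⟨c, n, hc⟩ := hH
  have hsurj := QuotientGroup.mk'_surjective N
  have hnorm := hc.normal
  refine ⟨fun i => (c i).map (QuotientGroup.mk' N), n, ⟨?_, ?_, ?_, ?_, ?_, ?_⟩⟩
  · exact fun i => (hc.normal i).map _ hsurj
  · simp [hc.zero]
  · rw [hc.last, map_top_of_surjective _ hsurj]
  · exact fun i => map_mono (hc.le_succ i)
  · intro i M hM h1 h2
    obtain ⟨M, rfl⟩ : ∃ M' : Subgroup G, M'.map (QuotientGroup.mk' N) = M :=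
      ⟨M.comap _, map_comap_eq_self_of_surjective hsurj M⟩
    wlog hNM : N ≤ M generalizing M
    · have := this (M ⊔ N) (by rwa [Subgroup.map_sup, QuotientGroup.map_mk'_self, sup_bot_eq])
        (by rwa [Subgroup.map_sup, QuotientGroup.map_mk'_self, sup_bot_eq])
        (by rwa [Subgroup.map_sup, QuotientGroup.map_mk'_self, sup_bot_eq]) le_sup_right
      rwa [Subgroup.map_sup, QuotientGroup.map_mk'_self, sup_bot_eq] at this
    have hMn : M.Normal := by
      have := hM.comap (QuotientGroup.mk' N)
      rwa [comap_map_eq, QuotientGroup.ker_mk', sup_eq_left.2 hNM] at this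
    rw [Subgroup.map_le_map_iff, QuotientGroup.ker_mk', sup_eq_left.2 hNM] at h1
    rw [Subgroup.map_le_map_iff, QuotientGroup.ker_mk'] at h2
    have hdec : M = (M ⊓ c (i + 1)) ⊔ N := by
      have := sup_inf_eq (A := N) (B := c (i + 1)) hNM
      rw [sup_comm N, inf_eq_right.2 h2] at this
      rw [inf_comm, sup_comm, ← this]
    rcases hc.chief i (M ⊓ c (i + 1)) (normal_inf _ _ hMn (hnorm _))
      (le_inf h1 (hc.le_succ i)) inf_le_right with h3 | h3
    · left
      rw [hdec, h3, Subgroup.map_sup, QuotientGroup.map_mk'_self, sup_bot_eq]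
    · right
      rw [hdec, h3, Subgroup.map_sup, QuotientGroup.map_mk'_self, sup_bot_eq]
  · intro i
    rw [← index_comap_of_surjective _ hsurj, comap_normalizer_eq_of_surjective _ hsurj]
    refine index_normalizer_pow_of_le ?_ (hc.index i)
    have : ((H.map (QuotientGroup.mk' N) ⊓ (c (i + 1)).map (QuotientGroup.mk' N)) ⊔
        (c i).map (QuotientGroup.mk' N)).comap (QuotientGroup.mk' N)
        = ((H ⊓ c (i + 1)) ⊔ c i) ⊔ N := by
      have h1 : H.map (QuotientGroup.mk' N) ⊓ (c (i + 1)).map (QuotientGroup.mk' N)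
          = (H ⊓ c (i + 1)).map (QuotientGroup.mk' N) := by
        have h2 := hN _ (hnorm (i + 1))
        apply comap_injective hsurj
        rw [comap_inf, comap_map_eq, comap_map_eq, comap_map_eq, QuotientGroup.ker_mk', h2]
      rw [h1, ← Subgroup.map_sup, comap_map_eq, QuotientGroup.ker_mk']
    rw [this]
    exact normalizer_le_normalizer_sup_normal

namespace IsPiChain

variable {p : ℕ} {H : Subgroup G} {c : ℕ → Subgroup G} {n : ℕ}

theorem mono (hc : IsPiChain p H c n) {i j : ℕ} (h : i ≤ j) : c i ≤ c j :=
  monotone_nat_of_le_succ hc.le_succ h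

/-- The step of the chain at which a subgroup `L` is reached. -/
theorem exists_step (hc : IsPiChain p H c n) {L : Subgroup G} (hL : L ≠ ⊥) :
    ∃ i, L ≤ c (i + 1) ∧ ¬ L ≤ c i := by
  classical
  have hex : ∃ j, L ≤ c j := ⟨n, hc.last ▸ le_top⟩
  have h0 : Nat.find hex ≠ 0 := fun h => hL (le_bot_iff.1 (by
    have := Nat.find_spec hex; rwa [h, hc.zero] at this))
  obtain ⟨i, hi⟩ := Nat.exists_eq_succ_of_ne_zero h0
  exact ⟨i, by have := Nat.find_spec hex; rwa [hi] at this,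
    Nat.find_min hex (by omega)⟩

theorem exists_step_isChiefFactor (hc : IsPiChain p H c n) {N : Subgroup G}
    (hN : IsChiefFactor ⊥ N) :
    ∃ i, N ≤ c (i + 1) ∧ N ⊓ c i = ⊥ ∧ N ⊔ c i = c (i + 1) := by
  obtain ⟨i, h1, h2⟩ := hc.exists_step hN.lt.ne'
  have := hN.normal_right
  have := hc.normal i
  have h3 : N ⊓ c i = ⊥ := by
    rcases hN.eq_or_eq (N ⊓ c i) inferInstance bot_le inf_le_left with h | h
    · exact h
    · exact absurd (inf_eq_left.1 h) h2
  refine ⟨i, h1, h3, ?_⟩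
  rcases hc.chief i (N ⊔ c i) inferInstance le_sup_right (sup_le h1 (hc.le_succ i)) with h | h
  · exact absurd (sup_eq_right.1 h) h2
  · exact h

/-- If a Sylow `p`-subgroup normalizes `H ∩ cᵢ₊₁`, then `H` covers or avoids the factor. -/
theorem eq_or_eq [Finite G] [Fact p.Prime] (hc : IsPiChain p H c n) (P : Sylow p G) (i : ℕ)
    (hP : (P : Subgroup G) ≤ normalizer ((H ⊓ c (i + 1) : Subgroup G) : Set G)) :
    (H ⊓ c (i + 1)) ⊔ c i = c i ∨ (H ⊓ c (i + 1)) ⊔ c i = c (i + 1) := by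
  have := hc.normal i
  refine hc.chief i _ (normal_of_index_pow P ?_ (hc.index i)) le_sup_right
    (sup_le inf_le_right (hc.le_succ i))
  exact le_normalizer_sup hP le_normalizer_of_normal

end IsPiChain

/-- Let `K` be the largest proper normal subgroup of `G` inside `L`. If `H ≤ L` is adapted to some
chain and `HK` is normalized by a Sylow `p`-subgroup, then `HK` is `K` or `L`. -/
theorem sup_eq_of_unique_maximal [Finite G] {p : ℕ} [Fact p.Prime] (P : Sylow p G)
    {H K L : Subgroup G} [K.Normal] [L.Normal]
    (hKL : K < L) (hmax : ∀ M : Subgroup G, M.Normal → M ≤ L → M = L ∨ M ≤ K)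
    (hHL : H ≤ L) (hHK : ¬ H ≤ K)
    (hP : (P : Subgroup G) ≤ normalizer ((H ⊔ K : Subgroup G) : Set G))
    (hH : HasPiChain p H) : H ⊔ K = L := by
  obtain ⟨c, n, hc⟩ := hH
  obtain ⟨i, h1, h2⟩ := hc.exists_step (L := L) (fun h => by simp [h] at hKL)
  have := hc.normal i
  have h3 : L ⊓ c i ≤ K := by
    rcases hmax (L ⊓ c i) inferInstance inf_le_left with h | h
    · exact absurd (inf_eq_left.1 h) h2
    · exact h
  have hi := hc.index i
  rw [inf_eq_left.2 (hHL.trans h1)] at hi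
  have h4 : H ⊔ K = ((H ⊔ c i) ⊓ L) ⊔ K := by
    rw [sup_inf_eq hHL, inf_comm, sup_assoc, sup_eq_right.2 h3]
  have h5 : (H ⊔ K).Normal := by
    refine normal_of_index_pow P hP (index_normalizer_pow_of_le ?_ hi)
    rw [h4]
    exact le_normalizer_sup (le_normalizer_inf le_rfl le_normalizer_of_normal)
      le_normalizer_of_normal
  rcases hmax _ h5 (sup_le hHL hKL.le) with h | h
  · exact h
  · exact absurd (le_sup_left.trans h) hHK

/-- All chief factors of `G` inside `K` have order `q`. -/
def ChiefOrder (q : ℕ) (K : Subgroup G) : Prop :=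
  ∀ Y Z : Subgroup G, IsChiefFactor Y Z → Z ≤ K → Y.relIndex Z = q

/-- If all chief factors in `K` have order `q` and `W ≤ K` covers or avoids each step of a chain,
then the order of the part of `W` in each member of the chain is a power of `q`. -/
theorem card_inf_eq_pow [Finite G] {p : ℕ} {q : ℕ} {H : Subgroup G} {c : ℕ → Subgroup G} {n : ℕ}
    (hc : IsPiChain p H c n) {W K : Subgroup G} [K.Normal] (hK : ChiefOrder q K) (hWK : W ≤ K)
    (m : ℕ) (h : ∀ j < m, (W ⊓ c (j + 1)) ⊔ c j = c j ∨ (W ⊓ c (j + 1)) ⊔ c j = c (j + 1)) :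
    ∃ k, Nat.card (W ⊓ c m : Subgroup G) = q ^ k := by
  induction m with
  | zero => exact ⟨0, by rw [hc.zero, inf_bot_eq, card_bot, pow_zero]⟩
  | succ m ih =>
    obtain ⟨k, hk⟩ := ih fun j hj => h j (by omega)
    have hn := hc.normal m
    have hn' := hc.normal (m + 1)
    have hle : W ⊓ c m ≤ W ⊓ c (m + 1) := inf_le_inf_left _ (hc.le_succ m)
    have hmul := card_mul_relIndex hle
    have hrel : (W ⊓ c m).relIndex (W ⊓ c (m + 1)) = (c m).relIndex (W ⊓ c (m + 1) ⊔ c m) := by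
      rw [relIndex_sup_right, ← inf_relIndex_right (c m), ← inf_assoc, inf_comm (c m) W, inf_assoc,
        inf_eq_left.2 (hc.le_succ m)]
    rw [hrel, hk] at hmul
    rcases h m (Nat.lt_succ_self m) with h1 | h1
    · exact ⟨k, by rw [← hmul, h1, relIndex_self, mul_one]⟩
    · by_cases heq : c m = c (m + 1)
      · exact ⟨k, by rw [← hmul, h1, ← heq, relIndex_self, mul_one]⟩
      have hcK : (K ⊓ c (m + 1)) ⊔ c m = c (m + 1) := by
        refine le_antisymm (sup_le inf_le_right (hc.le_succ m)) ?_
        exact h1.symm.le.trans (sup_le_sup_right (inf_le_inf_right _ hWK) _)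
      have hch : IsChiefFactor (K ⊓ c m) (K ⊓ c (m + 1)) := by
        refine ⟨inferInstance, inferInstance, lt_of_le_of_ne
          (inf_le_inf_left _ (hc.le_succ m)) fun h2 => heq ?_, fun M hM h2 h3 => ?_⟩
        · rw [← hcK, ← h2, sup_eq_right.2 inf_le_right]
        · have h4 : M = (M ⊔ c m) ⊓ K := by
            rw [sup_inf_eq (h3.trans inf_le_left), inf_comm, sup_eq_left.2 h2]
          rcases hc.chief m (M ⊔ c m) inferInstance le_sup_right
            (sup_le (h3.trans inf_le_right) (hc.le_succ m)) with h5 | h5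
          · left; rw [h4, h5, inf_comm]
          · right; rw [h4, h5, inf_comm]
      refine ⟨k + 1, ?_⟩
      rw [← hmul, h1, ← hcK, relIndex_sup_right, pow_succ, ← hK _ _ hch inf_le_left,
        ← inf_relIndex_right (c m), ← inf_assoc, inf_comm (c m) K, inf_assoc,
        inf_eq_left.2 (hc.le_succ m)]

theorem card_eq_pow_of_chiefOrder [Finite G] {p : ℕ} [Fact p.Prime] (P : Sylow p G) {q : ℕ}
    {H K : Subgroup G} [K.Normal] (hK : ChiefOrder q K) (hHK : H ≤ K) (hH : HasPiChain p H)
    (hP : (P : Subgroup G) ≤ normalizer (H : Set G)) : ∃ k, Nat.card H = q ^ k := by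
  obtain ⟨c, n, hc⟩ := hH
  obtain ⟨k, hk⟩ := card_inf_eq_pow hc hK hHK n fun j _ => hc.eq_or_eq P j (by
    have := hc.normal (j + 1)
    exact le_normalizer_inf hP le_normalizer_of_normal)
  exact ⟨k, by rwa [hc.last, inf_top_eq] at hk⟩

theorem chiefOrder_of_isChiefFactor {N : Subgroup G} (hN : IsChiefFactor ⊥ N) :
    ChiefOrder (Nat.card N) N := by
  intro Y Z hYZ hZ
  have h1 := hN.eq_or_eq Z hYZ.normal_right bot_le hZ
  have h2 := hN.eq_or_eq Y hYZ.normal_left bot_le (hYZ.lt.le.trans hZ)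
  have h3 := hYZ.lt
  rcases h1 with rfl | rfl
  · exact absurd h3 not_lt_bot
  · rcases h2 with rfl | rfl
    · rw [relIndex_bot_left]
    · exact absurd h3 (lt_irrefl _)

/-- A chief factor inside a subgroup generated by minimal normal subgroups is isomorphic to one of
them, as witnessed by a common quotient. -/
theorem exists_generator_of_isChiefFactor [Finite G] {𝒩 : Set (Subgroup G)}
    (h𝒩 : ∀ N ∈ 𝒩, IsChiefFactor ⊥ N) {Y Z : Subgroup G} (hYZ : IsChiefFactor Y Z)
    (hZ : Z ≤ sSup 𝒩) : ∃ N ∈ 𝒩, Y.relIndex Z = Nat.card N := by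
  have hYn := hYZ.normal_left
  have hZn := hYZ.normal_right
  obtain ⟨X, hX, hmax⟩ := Set.Finite.exists_maximal
    (s := {X : Subgroup G | X.Normal ∧ X ⊓ Z = Y}) (Set.toFinite _)
    ⟨Y, hYn, inf_eq_left.2 hYZ.lt.le⟩
  have hXn := hX.1
  have : ∃ N ∈ 𝒩, ¬ N ≤ X := by
    by_contra! hcon
    have h1 : Z ≤ X := hZ.trans (sSup_le hcon)
    have h2 : X ⊓ Z = Y := hX.2
    rw [inf_eq_right.2 h1] at h2
    exact hYZ.lt.ne h2.symm
  obtain ⟨N, hN, hNX⟩ := this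
  have hNc := h𝒩 N hN
  have hNn := hNc.normal_right
  refine ⟨N, hN, ?_⟩
  have hXN : X ⊓ N = ⊥ := by
    rcases hNc.eq_or_eq (X ⊓ N) inferInstance bot_le inf_le_right with h | h
    · exact h
    · exact absurd (inf_eq_right.1 h) hNX
  have hZle : Z ≤ X ⊔ N := by
    have hYle : Y ≤ (X ⊔ N) ⊓ Z := by
      rw [← hX.2]; exact inf_le_inf_right _ le_sup_left
    rcases hYZ.eq_or_eq _ (normal_inf (X ⊔ N) Z inferInstance hZn) hYle inf_le_right with h | h
    · exact absurd (le_sup_right.trans (hmax ⟨inferInstance, h⟩ le_sup_left)) hNX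
    · exact inf_eq_right.1 h
  -- `ZX` lies strictly above `X` and inside `NX`, and `NX/X` is a chief factor.
  have hZX : Z ⊔ X = N ⊔ X := by
    have h1 : X ⊔ ((Z ⊔ X) ⊓ N) = Z ⊔ X := by
      have h0 := sup_inf_eq (A := X) (B := N) (C := Z ⊔ X) le_sup_right
      rw [inf_comm N, inf_eq_right.2 (sup_le hZle le_sup_left)] at h0
      exact h0.symm
    rcases hNc.eq_or_eq _ (normal_inf (Z ⊔ X) N inferInstance hNn) bot_le inf_le_right with h | h
    · rw [h, sup_bot_eq] at h1
      have h2 : X ⊓ Z = Y := hX.2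
      rw [inf_eq_right.2 (h1 ▸ le_sup_left)] at h2
      exact absurd h2.symm hYZ.lt.ne
    · rw [h] at h1; rw [← h1, sup_comm]
  calc Y.relIndex Z = X.relIndex (Z ⊔ X) := by
        rw [relIndex_sup_right, ← inf_relIndex_right X, hX.2]
    _ = X.relIndex (N ⊔ X) := by rw [hZX]
    _ = Nat.card N := by
        rw [relIndex_sup_right, ← inf_relIndex_right X, hXN, relIndex_bot_left]

/-! ### Complements of abelian normal subgroups of coprime index -/

open scoped Pointwise in
theorem isComplement'_eq_stabilizer [Finite G] {S : Subgroup G} [S.Normal] [IsMulCommutative S]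
    (hS : Nat.Coprime (Nat.card S) S.index) {T : Subgroup G} (hT : IsComplement' S T) :
    ∃ α : S.QuotientDiff, T = MulAction.stabilizer G α := by
  let β : S.LeftTransversal := ⟨(T : Set G), isComplement'_def.1 hT.symm⟩
  let α : S.QuotientDiff := Quotient.mk'' β
  refine ⟨α, eq_of_le_of_card_ge (fun t ht => ?_) ?_⟩
  · have h1 : MulOpposite.op t⁻¹ • β = β := by
      apply Subtype.ext
      change MulOpposite.op t⁻¹ • (T : Set G) = (T : Set G)
      ext x
      rw [Set.mem_smul_set_iff_inv_smul_mem]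
      simp only [← MulOpposite.op_inv, inv_inv, MulOpposite.smul_eq_mul_unop, MulOpposite.unop_op,
        SetLike.mem_coe]
      exact ⟨fun h => by simpa using mul_mem h (inv_mem ht), fun h => mul_mem h ht⟩
    have h2 : t • α = α := congrArg Quotient.mk'' h1
    exact h2
  · have h2 := (isComplement'_stabilizer_of_coprime (α := α) hS).card_mul_card
    have h3 := hT.card_mul_card
    exact (Nat.eq_of_mul_eq_mul_left Nat.card_pos (h2.trans h3.symm)).le

/-- Complements of an abelian normal subgroup of coprime index are conjugate. -/
theorem isComplement'_conj [Finite G] {S : Subgroup G} [S.Normal] [IsMulCommutative S]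
    (hS : Nat.Coprime (Nat.card S) S.index) {T T' : Subgroup G} (hT : IsComplement' S T)
    (hT' : IsComplement' S T') : ∃ s ∈ S, T' = T.map (MulAut.conj s).toMonoidHom := by
  obtain ⟨α, hα⟩ := isComplement'_eq_stabilizer hS hT
  obtain ⟨β, hβ⟩ := isComplement'_eq_stabilizer hS hT'
  obtain ⟨s, rfl⟩ := exists_smul_eq hS α β
  exact ⟨s, s.2, by rw [hα, hβ]; exact MulAction.stabilizer_smul_eq_stabilizer_map_conj (s : G) α⟩

theorem exists_complement_conj [Finite G] {S K : Subgroup G} [S.Normal] [K.Normal]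
    (hS : ∀ a ∈ S, ∀ b ∈ S, a * b = b * a) (hSK : S ≤ K)
    (hcop : (Nat.card S).Coprime (S.relIndex K)) :
    ∃ T ≤ K, S ⊓ T = ⊥ ∧ S ⊔ T = K ∧
      ∀ g : G, ∃ s ∈ S, T.map (MulAut.conj g).toMonoidHom = T.map (MulAut.conj s).toMonoidHom := by
  have hcomm : IsMulCommutative (S.subgroupOf K) :=
    ⟨⟨fun a b => Subtype.ext (Subtype.ext (hS _ a.2 _ b.2))⟩⟩
  have hcard : Nat.card (S.subgroupOf K) = Nat.card S :=
    Nat.card_congr (subgroupOfEquivOfLe hSK).toEquiv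
  have hcop' : (Nat.card (S.subgroupOf K)).Coprime (S.subgroupOf K).index := by
    rw [hcard]; exact hcop
  obtain ⟨T, hT⟩ := exists_right_complement'_of_coprime hcop'
  have hdisj : ∀ x : K, (x : G) ∈ S → x ∈ T → x = 1 := fun x hx hxT => by
    have := hT.disjoint.le_bot (show x ∈ S.subgroupOf K ⊓ T from ⟨hx, hxT⟩)
    exact this
  refine ⟨T.map K.subtype, map_subtype_le T, ?_, ?_, fun g => ?_⟩
  · rw [eq_bot_iff]
    rintro x ⟨hx, t, ht, rfl⟩
    rw [hdisj t hx ht]; exact one_mem _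
  · have := congrArg (map K.subtype) hT.sup_eq_top
    rwa [Subgroup.map_sup, subgroupOf_map_subtype, inf_eq_left.2 hSK, ← MonoidHom.range_eq_map,
      range_subtype] at this
  · -- conjugation by `g` is an automorphism of `K` and moves `T` to another complement
    let φ : K ≃* K := MulAut.conjNormal g
    have hφ : ∀ x : K, ((φ x : K) : G) = g * x * g⁻¹ := fun x => MulAut.conjNormal_apply g x
    have hT2 : IsComplement' (S.subgroupOf K) (T.map φ.toMonoidHom) := by
      apply isComplement'_of_card_mul_and_disjoint
      · rw [card_map_of_injective (f := φ.toMonoidHom) φ.injective, hT.card_mul_card]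
      · rw [disjoint_iff, eq_bot_iff]
        rintro x ⟨hx, t, ht, rfl⟩
        have h1 : g * (t : G) * g⁻¹ ∈ S := by
          have := mem_subgroupOf.1 hx
          rwa [MulEquiv.coe_toMonoidHom, hφ] at this
        have h2 : (t : G) ∈ S := by
          have := ‹S.Normal›.conj_mem _ h1 g⁻¹
          have e : g⁻¹ * (g * (t : G) * g⁻¹) * g⁻¹⁻¹ = t := by group
          rwa [e] at this
        rw [hdisj t h2 ht]; simp
    obtain ⟨s, hs, hTs⟩ := isComplement'_conj hcop' hT hT2
    refine ⟨s, hs, ?_⟩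
    have := congrArg (map K.subtype) hTs
    rw [Subgroup.map_map, Subgroup.map_map] at this
    rw [Subgroup.map_map, Subgroup.map_map]
    have e1 : (MulAut.conj g).toMonoidHom.comp K.subtype = K.subtype.comp φ.toMonoidHom := by
      ext x; exact (hφ x).symm
    have e2 : (MulAut.conj (s : G)).toMonoidHom.comp K.subtype
        = K.subtype.comp (MulAut.conj s).toMonoidHom := by
      ext x; simp
    rw [e1, e2, this]

/-- If moreover `K` centralizes `S`, the complement is normal in `G`. -/
theorem exists_normal_complement [Finite G] {S K : Subgroup G} [S.Normal] [K.Normal]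
    (hSK : S ≤ K) (hcop : (Nat.card S).Coprime (S.relIndex K))
    (hc : ∀ s ∈ S, ∀ k ∈ K, k * s = s * k) :
    ∃ T : Subgroup G, T.Normal ∧ S ⊓ T = ⊥ ∧ S ⊔ T = K := by
  obtain ⟨T, hTK, h1, h2, h3⟩ := exists_complement_conj
    (fun a ha b hb => hc b hb a (hSK ha)) hSK hcop
  refine ⟨T, ⟨fun t ht g => ?_⟩, h1, h2⟩
  obtain ⟨s, hs, h⟩ := h3 g
  have : g * t * g⁻¹ ∈ T.map (MulAut.conj g).toMonoidHom := ⟨t, ht, rfl⟩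
  rw [h] at this
  obtain ⟨t', ht', h'⟩ := this
  have h4 : s * t' * s⁻¹ = g * t * g⁻¹ := h'
  rw [← h4, ← hc s hs t' (hTK ht'), mul_inv_cancel_right]
  exact ht'

/-- If `K` fixes no nontrivial element of `S`, then `S` is complemented in the whole group, by the
Frattini argument. -/
theorem exists_complement_top [Finite G] {S K : Subgroup G} [S.Normal] [K.Normal]
    (hS : ∀ a ∈ S, ∀ b ∈ S, a * b = b * a) (hSK : S ≤ K)
    (hcop : (Nat.card S).Coprime (S.relIndex K))
    (hc : ∀ s ∈ S, (∀ k ∈ K, k * s = s * k) → s = 1) :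
    ∃ M : Subgroup G, S ⊓ M = ⊥ ∧ S ⊔ M = ⊤ := by
  obtain ⟨T, hTK, h1, h2, h3⟩ := exists_complement_conj hS hSK hcop
  refine ⟨normalizer (T : Set G), ?_, ?_⟩
  · rw [eq_bot_iff]
    rintro s ⟨hs, hsT⟩
    have hsT' : ∀ t ∈ T, t * s = s * t := fun t ht => by
      have h4 : s * t * s⁻¹ * t⁻¹ ∈ S ⊓ T := by
        refine ⟨?_, T.mul_mem ((mem_normalizer_iff.1 hsT t).1 ht) (T.inv_mem ht)⟩
        have := mul_mem hs (‹S.Normal›.conj_mem _ (inv_mem hs) t)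
        simpa [mul_assoc] using this
      rw [h1, mem_bot, mul_inv_eq_one, mul_inv_eq_iff_eq_mul] at h4
      exact h4.symm
    refine mem_bot.2 (hc s hs fun k hk => ?_)
    rw [← h2] at hk
    obtain ⟨a, ha, t, ht, rfl⟩ := mem_sup_of_normal_left.1 hk
    rw [mul_assoc, hsT' t ht, ← mul_assoc, hS a ha s hs, mul_assoc]
  · rw [eq_top_iff]
    intro g _
    obtain ⟨s, hs, h⟩ := h3 g
    have hn : s⁻¹ * g ∈ normalizer (T : Set G) := by
      rw [mem_normalizer_iff_map_conj_eq]
      have h5 := congrArg (map (MulAut.conj s⁻¹).toMonoidHom) h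
      rw [Subgroup.map_map, Subgroup.map_map] at h5
      have e1 : (MulAut.conj s⁻¹).toMonoidHom.comp (MulAut.conj g).toMonoidHom
          = (MulAut.conj (s⁻¹ * g)).toMonoidHom := by
        ext x; simp
      have e2 : (MulAut.conj s⁻¹).toMonoidHom.comp (MulAut.conj s).toMonoidHom
          = MonoidHom.id G := by
        ext x; simp [mul_assoc]
      rw [e1, e2, map_id] at h5
      exact h5
    have := mul_mem (mem_sup_left (T := normalizer (T : Set G)) hs) (mem_sup_right (S := S) hn)
    simpa using this

/-! ### `p`-soluble groups without normal `p'`-subgroups -/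

/-- `G` has no nontrivial normal `p'`-subgroup. -/
def NoPrimeCore (p : ℕ) (G : Type*) [Group G] : Prop :=
  ∀ N : Subgroup G, N.Normal → (Nat.card N).Coprime p → N = ⊥

theorem isPSoluble_quotient {p : ℕ} (h : IsPSoluble p G) (N : Subgroup G) [N.Normal] :
    IsPSoluble p (G ⧸ N) := by
  intro K L hKL
  have hsurj := QuotientGroup.mk'_surjective N
  have hKn := hKL.normal_left
  have hLn := hKL.normal_right
  have hc : IsChiefFactor (K.comap (QuotientGroup.mk' N)) (L.comap (QuotientGroup.mk' N)) := by
    refine ⟨inferInstance, inferInstance, (comap_lt_comap_of_surjective hsurj).2 hKL.lt,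
      fun M hM h1 h2 => ?_⟩
    have hNM : N ≤ M := by
      refine le_trans ?_ h1
      conv_lhs => rw [← QuotientGroup.ker_mk' N]
      exact MonoidHom.ker_le_comap _ _
    have hMeq : (M.map (QuotientGroup.mk' N)).comap (QuotientGroup.mk' N) = M := by
      rw [comap_map_eq, QuotientGroup.ker_mk', sup_eq_left.2 hNM]
    rcases hKL.eq_or_eq (M.map (QuotientGroup.mk' N)) (hM.map _ hsurj)
      ((map_comap_eq_self_of_surjective hsurj K).symm.le.trans (map_mono h1))
      (map_le_iff_le_comap.2 h2) with h3 | h3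
    · left; rw [← h3, hMeq]
    · right; rw [← h3, hMeq]
  have := h _ _ hc
  rwa [relIndex_comap, map_comap_eq_self_of_surjective hsurj] at this

theorem isPGroup_or_coprime_of_isChiefFactor [Finite G] {p : ℕ} [hp : Fact p.Prime]
    (h : IsPSoluble p G) {K L : Subgroup G} (hKL : IsChiefFactor K L) (hK : IsPGroup p K) :
    IsPGroup p L ∨ (K.relIndex L).Coprime p := by
  rcases h K L hKL with ⟨k, hk⟩ | h
  · exact Or.inl (isPGroup_of_relIndex hKL.lt.le hK hk)
  · exact Or.inr h

theorem coprime_of_isPGroup [Finite G] {p : ℕ} [hp : Fact p.Prime] {S : Subgroup G}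
    (hS : IsPGroup p S) {m : ℕ} (hm : m.Coprime p) : (Nat.card S).Coprime m := by
  obtain ⟨k, hk⟩ := IsPGroup.iff_card.1 hS
  rw [hk]
  exact Nat.Coprime.pow_left k hm.symm

theorem isPGroup_of_isChiefFactor_bot [Finite G] {p : ℕ} [hp : Fact p.Prime]
    (h : IsPSoluble p G) (h0 : NoPrimeCore p G) {N : Subgroup G} (hN : IsChiefFactor ⊥ N) :
    IsPGroup p N := by
  rcases isPGroup_or_coprime_of_isChiefFactor h hN IsPGroup.of_bot with h1 | h1
  · exact h1
  · rw [relIndex_bot_left] at h1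
    exact absurd (h0 N hN.normal_right h1) hN.lt.ne'

/-- The Hall–Higman lemma: if `O_{p'}(G) = 1` and `R` contains every normal `p`-subgroup, then
`R` contains its own centralizer. -/
theorem centralizer_le_of_noPrimeCore [Finite G] {p : ℕ} [hp : Fact p.Prime]
    (h : IsPSoluble p G) (h0 : NoPrimeCore p G) {R : Subgroup G} [R.Normal] (hR : IsPGroup p R)
    (hmax : ∀ N : Subgroup G, N.Normal → IsPGroup p N → N ≤ R) :
    centralizer (R : Set G) ≤ R := by
  by_contra hcon
  have hlt : centralizer (R : Set G) ⊓ R < centralizer (R : Set G) :=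
    lt_of_le_of_ne inf_le_left fun h1 => hcon (inf_eq_left.1 h1)
  obtain ⟨L, hL, hLC⟩ := exists_isChiefFactor_le hlt
  have hLn := hL.normal_right
  have hZ : IsPGroup p (centralizer (R : Set G) ⊓ R : Subgroup G) := isPGroup_le hR inf_le_right
  rcases isPGroup_or_coprime_of_isChiefFactor h hL hZ with h1 | h1
  · exact hL.lt.not_ge (le_inf hLC (hmax L hLn h1))
  · obtain ⟨T, hTn, hT1, hT2⟩ := exists_normal_complement hL.lt.le (coprime_of_isPGroup hZ h1)
      (fun s hs k hk => (mem_centralizer_iff.1 (hLC hk) s hs.2).symm)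
    have hT3 : T = ⊥ := by
      refine h0 T hTn ?_
      rwa [← hT2, sup_comm, relIndex_sup_right, ← inf_relIndex_right, hT1,
        relIndex_bot_left] at h1
    rw [hT3, sup_bot_eq] at hT2
    exact hL.lt.ne hT2

/-! ### Groups of `p`-length at most one -/

/-- `G` has normal subgroups `K ≤ A` with `K` and `G/A` of order prime to `p` and `A/K` a
`p`-group: this is `p`-length at most `1`. -/
def PLengthLeOne (p : ℕ) (G : Type*) [Group G] : Prop :=
  ∃ K A : Subgroup G, K.Normal ∧ A.Normal ∧ K ≤ A ∧ (Nat.card K).Coprime p ∧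
    (∃ k, K.relIndex A = p ^ k) ∧ A.index.Coprime p

theorem PLengthLeOne.pLength_le_one [Finite G] {p : ℕ} [hp : Fact p.Prime]
    (h : PLengthLeOne p G) : pLength p G ≤ 1 := by
  obtain ⟨K, A, hK, hA, hKA, hK1, ⟨k, hk⟩, hA1⟩ := h
  have hs : (upperSeries p G 1).1 = ⊤ := by
    have hsurj := QuotientGroup.mk'_surjective (pPrimeCore p G)
    have hKle : K ≤ pPrimeCore p G := le_sSup ⟨hK, hK1⟩
    have hAle : A ≤ pCoreOver p (pPrimeCore p G) := by
      rw [pCoreOver, ← map_le_iff_le_comap]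
      refine le_sSup ⟨hA.map _ hsurj, ?_⟩
      have h1 := relIndex_ker A (QuotientGroup.mk' (pPrimeCore p G))
      rw [QuotientGroup.ker_mk'] at h1
      rw [← h1]
      obtain ⟨m, -, hm⟩ := (Nat.dvd_prime_pow hp.out).1 (hk ▸ relIndex_dvd_of_le_left A hKle)
      exact ⟨m, hm⟩
    change pPrimeCoreOver p (pCoreOver p (pPrimeCore p G)) = ⊤
    have h2 : pPrimeCore p (G ⧸ pCoreOver p (pPrimeCore p G)) = ⊤ := by
      refine top_le_iff.1 (le_sSup ⟨inferInstance, ?_⟩)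
      rw [card_top, ← index_eq_card]
      exact Nat.Coprime.coprime_dvd_left (index_dvd_of_le hAle) hA1
    rw [pPrimeCoreOver, h2, comap_top]
  refine (iInf₂_le (1 : ℕ) hs).trans ?_
  simp

theorem pLengthLeOne_of_normal_sylow [Finite G] {p : ℕ} [hp : Fact p.Prime] (P : Sylow p G)
    (h : (P : Subgroup G).Normal) : PLengthLeOne p G := by
  refine ⟨⊥, P, inferInstance, h, bot_le, by simp, ?_, ?_⟩
  · rw [relIndex_bot_left]; exact IsPGroup.iff_card.1 P.isPGroup'
  · exact Nat.Coprime.symm ((Nat.Prime.coprime_iff_not_dvd hp.out).2 P.not_dvd_index)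

theorem normal_sylow_of_isPGroup_normal [Finite G] {p : ℕ} [Fact p.Prime] (P : Sylow p G)
    {A : Subgroup G} (hA : A.Normal) (hAp : IsPGroup p A) (hPA : (P : Subgroup G) ≤ A) :
    (P : Subgroup G).Normal := by
  rw [← P.is_maximal' hAp hPA]; exact hA

theorem sylow_le_of_index_coprime [Finite G] {p : ℕ} [hp : Fact p.Prime] (P : Sylow p G)
    {A : Subgroup G} [A.Normal] (hA : A.index.Coprime p) : (P : Subgroup G) ≤ A := by
  have h1 : A.relIndex P ∣ A.index := relIndex_dvd_index_of_normal _ _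
  obtain ⟨k, hk⟩ := relIndex_eq_pow (K := A) P.isPGroup'
  have h2 : (p ^ k).Coprime p := Nat.Coprime.coprime_dvd_left (hk ▸ h1) hA
  have h3 : k = 0 := by
    by_contra h4
    exact hp.out.one_lt.ne' ((Nat.coprime_self p).1
      (Nat.Coprime.coprime_dvd_left (dvd_pow_self p h4) h2))
  rw [h3, pow_zero] at hk
  exact relIndex_eq_one.1 hk

/-- Subgroups witnessing `PLengthLeOne p (G ⧸ N)`, pulled back to `G`. -/
theorem PLengthLeOne.exists_of_quotient [Finite G] {p : ℕ} {N : Subgroup G} [N.Normal]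
    (h : PLengthLeOne p (G ⧸ N)) : ∃ K A : Subgroup G, K.Normal ∧ A.Normal ∧ N ≤ K ∧ K ≤ A ∧
      (N.relIndex K).Coprime p ∧ (∃ k, K.relIndex A = p ^ k) ∧ A.index.Coprime p := by
  obtain ⟨K, A, hK, hA, hKA, hK1, hk, hA1⟩ := h
  have hsurj := QuotientGroup.mk'_surjective N
  refine ⟨K.comap (QuotientGroup.mk' N), A.comap (QuotientGroup.mk' N), inferInstance,
    inferInstance, ?_, comap_mono hKA, ?_, ?_, ?_⟩
  · conv_lhs => rw [← QuotientGroup.ker_mk' N]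
    exact MonoidHom.ker_le_comap _ _
  · have h1 := relIndex_ker (K.comap (QuotientGroup.mk' N)) (QuotientGroup.mk' N)
    rw [QuotientGroup.ker_mk', map_comap_eq_self_of_surjective hsurj] at h1
    rwa [h1]
  · rwa [relIndex_comap, map_comap_eq_self_of_surjective hsurj]
  · rwa [index_comap_of_surjective _ hsurj]

theorem PLengthLeOne.of_quotient_coprime [Finite G] {p : ℕ} {N : Subgroup G} [N.Normal]
    (hN : (Nat.card N).Coprime p) (h : PLengthLeOne p (G ⧸ N)) : PLengthLeOne p G := by
  obtain ⟨K, A, hK, hA, hNK, hKA, hK1, hk, hA1⟩ := h.exists_of_quotient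
  exact ⟨K, A, hK, hA, hKA, by rw [← card_mul_relIndex hNK]; exact Nat.Coprime.mul_left hN hK1,
    hk, hA1⟩

/-- Suppose `O_{p'}(G) = 1` and `G/N` has `p`-length at most `1` for two normal `p`-subgroups
with trivial intersection. Then the Sylow `p`-subgroup is normal. -/
theorem pLengthLeOne_of_two_quotients [Finite G] {p : ℕ} [hp : Fact p.Prime] (P : Sylow p G)
    (h0 : NoPrimeCore p G) {N N' : Subgroup G} [N.Normal] [N'.Normal]
    (hNN' : N ⊓ N' = ⊥) (h : PLengthLeOne p (G ⧸ N))
    (h' : PLengthLeOne p (G ⧸ N')) : PLengthLeOne p G := by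
  obtain ⟨K, A, hK, hA, hNK, hKA, hK1, ⟨k, hk⟩, hA1⟩ := h.exists_of_quotient
  obtain ⟨K', A', hK', hA', hNK', hKA', hK1', ⟨k', hk'⟩, hA1'⟩ := h'.exists_of_quotient
  -- a `p`-subgroup of `K` lies in `N`
  have key : ∀ (N K : Subgroup G), N.Normal → (N.relIndex K).Coprime p →
      ∀ X : Subgroup G, X ≤ K → IsPGroup p X → X ≤ N := by
    intro N K hNn hK1 X hXK hX
    have h1 : N.relIndex X ∣ N.relIndex K := by
      have h2 := relIndex_dvd_index_of_normal (N.subgroupOf K) (X.subgroupOf K)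
      rwa [relIndex_subgroupOf hXK] at h2
    obtain ⟨k, hk⟩ := relIndex_eq_pow (K := N) hX
    have h2 : (p ^ k).Coprime p := Nat.Coprime.coprime_dvd_left (hk ▸ h1) hK1
    have h3 : k = 0 := by
      by_contra h4
      exact hp.out.one_lt.ne' ((Nat.coprime_self p).1
        (Nat.Coprime.coprime_dvd_left (dvd_pow_self p h4) h2))
    rw [h3, pow_zero] at hk
    exact relIndex_eq_one.1 hk
  have hKK' : K ⊓ K' = ⊥ := by
    refine h0 _ inferInstance ?_
    by_contra hcon
    have hdvd : p ∣ Nat.card (K ⊓ K' : Subgroup G) := by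
      by_contra h1
      exact hcon (Nat.Coprime.symm ((Nat.Prime.coprime_iff_not_dvd hp.out).2 h1))
    obtain ⟨x, hx⟩ := exists_prime_orderOf_dvd_card' p hdvd
    have hX : IsPGroup p (zpowers (x : G)) := by
      refine IsPGroup.of_card (n := 1) ?_
      rw [Nat.card_zpowers, orderOf_coe, hx, pow_one]
    have h1 := key N K ‹_› hK1 _ (zpowers_le.2 x.2.1) hX
    have h2 := key N' K' ‹_› hK1' _ (zpowers_le.2 x.2.2) hX
    have h3 : (x : G) ∈ N ⊓ N' := ⟨h1 (mem_zpowers _), h2 (mem_zpowers _)⟩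
    rw [hNN', mem_bot] at h3
    have : orderOf x = 1 := orderOf_eq_one_iff.2 (Subtype.ext h3)
    exact hp.out.one_lt.ne' (hx ▸ this)
  refine pLengthLeOne_of_normal_sylow P (normal_sylow_of_isPGroup_normal P
    (A := A ⊓ A') inferInstance ?_
    (le_inf (sylow_le_of_index_coprime P hA1) (sylow_le_of_index_coprime P hA1')))
  -- `A ∩ A'` embeds in the product of the `p`-groups `A/K` and `A'/K'`
  intro x
  have hx : ∀ (K A : Subgroup G), K.Normal → ∀ k, K.relIndex A = p ^ k → ∀ x ∈ A,
      x ^ p ^ k ∈ K := by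
    intro K A hK k hk x hx
    have := pow_index_mem (H := K.subgroupOf A) ⟨x, hx⟩
    have h2 : (K.subgroupOf A).index = p ^ k := hk
    rw [h2] at this
    simpa [mem_subgroupOf] using this
  refine ⟨k + k', ?_⟩
  have h1 := hx K A hK k hk x x.2.1
  have h2 := hx K' A' hK' k' hk' x x.2.2
  have h3 : (x : G) ^ p ^ (k + k') ∈ K ⊓ K' := by
    refine ⟨?_, ?_⟩
    · rw [pow_add, pow_mul]; exact pow_mem h1 _
    · rw [add_comm, pow_add, pow_mul]; exact pow_mem h2 _
  rw [hKK', mem_bot] at h3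
  exact Subtype.ext (by simpa using h3)

/-- If `G/N` has `p`-length at most `1` for an abelian minimal normal `p`-subgroup `N`, then so
has `G`, or `N` is complemented and not central. -/
theorem PLengthLeOne.complement_of_quotient [Finite G] {p : ℕ} [hp : Fact p.Prime]
    (h0 : NoPrimeCore p G) {N : Subgroup G} (hN : IsChiefFactor ⊥ N) (hNp : IsPGroup p N)
    [N.Normal] (hNc : ∀ a ∈ N, ∀ b ∈ N, a * b = b * a)
    (h : PLengthLeOne p (G ⧸ N)) :
    PLengthLeOne p G ∨ ((∃ M : Subgroup G, N ⊓ M = ⊥ ∧ N ⊔ M = ⊤) ∧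
      ¬ ∀ n ∈ N, ∀ g : G, g * n = n * g) := by
  obtain ⟨K, A, hK, hA, hNK, hKA, hK1, ⟨k, hk⟩, hA1⟩ := h.exists_of_quotient
  have hcop := coprime_of_isPGroup hNp hK1
  by_cases hc : N ⊓ centralizer (K : Set G) = ⊥
  · right
    refine ⟨exists_complement_top hNc hNK hcop fun s hs hs' => ?_, fun hcen => ?_⟩
    · have : s ∈ N ⊓ centralizer (K : Set G) := ⟨hs, mem_centralizer_iff.2 hs'⟩
      rwa [hc, mem_bot] at this
    · have h1 : N ≤ N ⊓ centralizer (K : Set G) :=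
        le_inf le_rfl fun n hn => mem_centralizer_iff.2 fun g _ => hcen n hn g
      rw [hc, le_bot_iff] at h1
      exact hN.lt.ne' h1
  · left
    have h1 : N ⊓ centralizer (K : Set G) = N :=
      (hN.eq_or_eq _ inferInstance bot_le inf_le_left).resolve_left hc
    obtain ⟨T, hTn, hT1, hT2⟩ := exists_normal_complement hNK hcop fun s hs k hk => by
      have : s ∈ N ⊓ centralizer (K : Set G) := h1.symm ▸ hs
      exact mem_centralizer_iff.1 this.2 k hk
    have hT3 : T = ⊥ := by
      refine h0 T hTn ?_
      rwa [← hT2, sup_comm, relIndex_sup_right, ← inf_relIndex_right, hT1,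
        relIndex_bot_left] at hK1
    rw [hT3, sup_bot_eq] at hT2
    subst hT2
    exact ⟨⊥, A, inferInstance, hA, bot_le, by simp, by
      rw [relIndex_bot_left]
      exact IsPGroup.iff_card.1 (isPGroup_of_relIndex hKA hNp hk), hA1⟩

/-! ### Quaternion-free groups -/

theorem isQuaternionFree_iff {P : Type*} [Group P] : IsQuaternionFree P ↔
    ∀ (A : Subgroup P) (f : A →* QuaternionGroup 2), ¬ Function.Surjective f := by
  constructor
  · intro h A f hf
    exact (h A f.ker).false (QuotientGroup.quotientKerEquivOfSurjective f hf)
  · intro h A B _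
    refine ⟨fun e => h A (e.toMonoidHom.comp (QuotientGroup.mk' B)) ?_⟩
    exact e.surjective.comp (QuotientGroup.mk'_surjective B)

theorem isQuaternionFree_of_surjective {P Q : Type*} [Group P] [Group Q]
    (h : IsQuaternionFree P) (φ : P →* Q) (hφ : Function.Surjective φ) : IsQuaternionFree Q := by
  rw [isQuaternionFree_iff] at h ⊢
  intro A f hf
  refine h (A.comap φ) (f.comp (φ.subgroupComap A)) ?_
  rw [MonoidHom.coe_comp]
  exact hf.comp (MonoidHom.subgroupComap_surjective_of_surjective φ A hφ)

/-- A section isomorphic to `Q₈` contains an element with nontrivial square. -/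
theorem isQuaternionFree_of_sq {P : Type*} [Group P] (h : ∀ x : P, x ^ 2 = 1) :
    IsQuaternionFree P := by
  rw [isQuaternionFree_iff]
  intro A f hf
  obtain ⟨x, hx⟩ := hf (QuaternionGroup.a 1)
  have h1 : x ^ 2 = 1 := Subtype.ext (h x)
  have h2 := congrArg f h1
  rw [map_pow, map_one, hx, QuaternionGroup.a_one_pow, QuaternionGroup.one_def,
    QuaternionGroup.a.injEq] at h2
  revert h2; decide

/-! ### The hypothesis and its passage to quotients -/

/-- The hypothesis of the theorem, with the partial `Π`-property replaced by the existence of an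
adapted chain. -/
structure PiHyp (p d : ℕ) (G : Type*) [Group G] [Fact p.Prime] (P : Sylow p G) : Prop where
  psoluble : IsPSoluble p G
  pow : ∃ k, d = p ^ k
  one_lt : 1 < d
  lt_card : d < Nat.card P
  chain : ∀ H : Subgroup G, H ≤ P → Nat.card H = d → HasPiChain p H
  cyclic : d = 2 → ¬ IsQuaternionFree P → ∀ H : Subgroup G, H ≤ P → IsCyclic H →
    Nat.card H = 4 → HasPiChain p H

theorem sylow_map_surjective [Finite G] {p : ℕ} [Fact p.Prime] (P : Sylow p G) (N : Subgroup G)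
    [N.Normal] : ∃ φ : P →* (P.mapSurjective (QuotientGroup.mk'_surjective N)),
      Function.Surjective φ ∧ ∀ x : P, ((φ x : _) : G ⧸ N) = QuotientGroup.mk' N x :=
  ⟨(QuotientGroup.mk' N).subgroupMap (P : Subgroup G),
    (QuotientGroup.mk' N).subgroupMap_surjective _, fun _ => rfl⟩

theorem inf_map_condition_of_le {H N : Subgroup G} [N.Normal] (h : N ≤ H) (C : Subgroup G)
    (hC : C.Normal) : (H ⊔ N) ⊓ (C ⊔ N) = (H ⊓ C) ⊔ N := by
  rw [sup_eq_left.2 h, inf_comm, sup_comm C, sup_inf_eq h, sup_comm, inf_comm]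

theorem inf_map_condition_of_coprime [Finite G] {p : ℕ} [hp : Fact p.Prime] {H N : Subgroup G}
    [N.Normal] (hH : IsPGroup p H) (hN : (Nat.card N).Coprime p) (C : Subgroup G)
    (hC : C.Normal) : (H ⊔ N) ⊓ (C ⊔ N) = (H ⊓ C) ⊔ N := by
  refine le_antisymm ?_ (sup_le (le_inf (inf_le_left.trans le_sup_left)
    (inf_le_right.trans le_sup_left)) (le_inf le_sup_right le_sup_right))
  rintro x ⟨hx, hx'⟩
  obtain ⟨h, hh, n, hn, rfl⟩ := mem_sup_of_normal_right.1 hx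
  obtain ⟨c, hc, m, hm, hcm⟩ := mem_sup_of_normal_right.1 hx'
  -- modulo `C` the `p`-element `h` is also a `p'`-element
  have h1 : (h : G ⧸ C) = ((m * n⁻¹ : G) : G ⧸ C) := by
    have h2 : h = c * (m * n⁻¹) := by rw [← mul_assoc, hcm, mul_inv_cancel_right]
    rw [h2, QuotientGroup.mk_mul, (QuotientGroup.eq_one_iff c).2 hc, one_mul]
  have h3 : orderOf (h : G ⧸ C) ∣ Nat.card H :=
    (orderOf_map_dvd (QuotientGroup.mk' C) h).trans
      (by rw [← orderOf_mk h hh]; exact orderOf_dvd_natCard _)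
  have h4 : orderOf (h : G ⧸ C) ∣ Nat.card N := by
    rw [h1]
    have hmn : m * n⁻¹ ∈ N := mul_mem hm (inv_mem hn)
    exact (orderOf_map_dvd (QuotientGroup.mk' C) (m * n⁻¹)).trans
      (by rw [← orderOf_mk _ hmn]; exact orderOf_dvd_natCard _)
  have h5 : orderOf (h : G ⧸ C) = 1 :=
    Nat.eq_one_of_dvd_coprimes (coprime_of_isPGroup hH hN) h3 h4
  exact mul_mem (mem_sup_left ⟨hh, (QuotientGroup.eq_one_iff h).1 (orderOf_eq_one_iff.1 h5)⟩)
    (mem_sup_right hn)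

theorem PiHyp.quotient_coprime [Finite G] {p d : ℕ} [hp : Fact p.Prime] {P : Sylow p G}
    (h : PiHyp p d G P) (N : Subgroup G) [N.Normal] (hN : (Nat.card N).Coprime p) :
    PiHyp p d (G ⧸ N) (P.mapSurjective (QuotientGroup.mk'_surjective N)) := by
  have hsurj := QuotientGroup.mk'_surjective N
  have hPN : ∀ x ∈ (P : Subgroup G), x ∈ N → x = 1 := by
    have h1 : (P : Subgroup G) ⊓ N = ⊥ :=
      disjoint_iff.1 (disjoint_of_coprime_natCard (coprime_of_isPGroup P.isPGroup' hN))
    intro x hx hx'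
    have : x ∈ (P : Subgroup G) ⊓ N := ⟨hx, hx'⟩
    rwa [h1, mem_bot] at this
  -- `P` maps isomorphically to the quotient, so that subgroups lift
  have lift : ∀ H : Subgroup (G ⧸ N), H ≤ P.mapSurjective hsurj →
      ∃ H' : Subgroup G, H' ≤ P ∧ H'.map (QuotientGroup.mk' N) = H ∧ Nonempty (H' ≃* H) := by
    intro H hH
    have hmap : ((P : Subgroup G) ⊓ H.comap (QuotientGroup.mk' N)).map (QuotientGroup.mk' N)
        = H := by
      apply le_antisymm
      · exact (map_mono inf_le_right).trans (map_comap_le _ _)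
      · intro y hy
        obtain ⟨x, hx, rfl⟩ := hH hy
        exact ⟨x, ⟨hx, hy⟩, rfl⟩
    refine ⟨_, inf_le_left, hmap, ⟨?_⟩⟩
    let φ := (QuotientGroup.mk' N).subgroupMap ((P : Subgroup G) ⊓ H.comap (QuotientGroup.mk' N))
    have hφ : Function.Bijective φ := by
      refine ⟨(injective_iff_map_eq_one _).2 fun x hx => ?_,
        (QuotientGroup.mk' N).subgroupMap_surjective _⟩
      have : QuotientGroup.mk' N (x : G) = 1 := congrArg Subtype.val hx
      exact Subtype.ext (hPN x x.2.1 ((QuotientGroup.eq_one_iff _).1 this))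
    exact (MulEquiv.ofBijective φ hφ).trans (MulEquiv.subgroupCongr hmap)
  have hchain : ∀ H' : Subgroup G, H' ≤ P → HasPiChain p H' →
      HasPiChain p (H'.map (QuotientGroup.mk' N)) := fun H' hH' hc =>
    hc.map (inf_map_condition_of_coprime (isPGroup_le P.isPGroup' hH') hN)
  refine ⟨isPSoluble_quotient h.psoluble N, h.pow, h.one_lt, ?_, ?_, ?_⟩
  · obtain ⟨H', hH', hm, ⟨e⟩⟩ := lift _ le_rfl
    have hPm : (P : Subgroup G) ≤ H' := by
      intro x hx
      have h1 : QuotientGroup.mk' N x ∈ H'.map (QuotientGroup.mk' N) := by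
        rw [hm]; exact ⟨x, hx, rfl⟩
      obtain ⟨y, hy, hyx⟩ := h1
      have h2 : y⁻¹ * x ∈ N := QuotientGroup.eq.1 hyx
      have h3 := hPN _ (mul_mem (inv_mem (hH' hy)) hx) h2
      rw [inv_mul_eq_one] at h3
      exact h3 ▸ hy
    have h4 : H' = P := le_antisymm hH' hPm
    subst h4
    rw [← Nat.card_congr e.toEquiv]
    exact h.lt_card
  · intro H hH hd
    obtain ⟨H', hH', rfl, ⟨e⟩⟩ := lift H hH
    exact hchain H' hH' (h.chain H' hH' (by rw [Nat.card_congr e.toEquiv, hd]))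
  · intro hd hq H hH hcyc h4
    obtain ⟨H', hH', rfl, ⟨e⟩⟩ := lift H hH
    obtain ⟨φ, hφ, -⟩ := sylow_map_surjective P N
    refine hchain H' hH' (h.cyclic hd (fun hP => hq (isQuaternionFree_of_surjective hP φ hφ)) H' hH'
      (isCyclic_of_injective e.toMonoidHom e.injective) (by rw [Nat.card_congr e.toEquiv, h4]))

/-- The hypothesis passes to the quotient by a normal `p`-subgroup `N` with `|N| < d`, unless
`d = 2|N|` and the quotient of `P` is not quaternion-free. -/
theorem PiHyp.quotient_pGroup [Finite G] {p d : ℕ} [hp : Fact p.Prime] {P : Sylow p G}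
    (h : PiHyp p d G P) (N : Subgroup G) [N.Normal] (hN : IsPGroup p N) (hNd : Nat.card N < d)
    (hQ : d = 2 * Nat.card N →
      IsQuaternionFree (P.mapSurjective (QuotientGroup.mk'_surjective N))) :
    PiHyp p (d / Nat.card N) (G ⧸ N) (P.mapSurjective (QuotientGroup.mk'_surjective N)) := by
  have hsurj := QuotientGroup.mk'_surjective N
  obtain ⟨k, hk⟩ := h.pow
  obtain ⟨m, hm⟩ := IsPGroup.iff_card.1 hN
  have hmk : m < k := (Nat.pow_lt_pow_iff_right hp.out.one_lt).1 (by rw [← hm, ← hk]; exact hNd)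
  have hdiv : d / Nat.card N = p ^ (k - m) := by
    rw [hm, hk, Nat.pow_div hmk.le hp.out.pos]
  have hmul : Nat.card N * (d / Nat.card N) = d := by
    rw [hdiv, hm, hk, ← pow_add, Nat.add_sub_cancel' hmk.le]
  have hNP : N ≤ P := hN.le_sylow_of_normal P
  have hcard : ∀ H : Subgroup (G ⧸ N),
      Nat.card N * Nat.card H = Nat.card (H.comap (QuotientGroup.mk' N)) := by
    intro H
    have hle : N ≤ H.comap (QuotientGroup.mk' N) := by
      conv_lhs => rw [← QuotientGroup.ker_mk' N]
      exact MonoidHom.ker_le_comap _ _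
    have h1 := relIndex_ker (H.comap (QuotientGroup.mk' N)) (QuotientGroup.mk' N)
    rw [QuotientGroup.ker_mk', map_comap_eq_self_of_surjective hsurj] at h1
    rw [← h1, card_mul_relIndex hle]
  have hPcomap : ((P.mapSurjective hsurj : Subgroup (G ⧸ N))).comap (QuotientGroup.mk' N) = P := by
    rw [Sylow.coe_mapSurjective, comap_map_eq, QuotientGroup.ker_mk', sup_eq_left.2 hNP]
  refine ⟨isPSoluble_quotient h.psoluble N, ⟨_, hdiv⟩, ?_, ?_, ?_, ?_⟩
  · rw [hdiv]; exact Nat.one_lt_pow (by omega) hp.out.one_lt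
  · have h1 := hcard (P.mapSurjective hsurj)
    rw [hPcomap] at h1
    refine lt_of_mul_lt_mul_left (a := Nat.card N) ?_ (Nat.zero_le _)
    rw [hmul]
    exact h.lt_card.trans_eq h1.symm
  · intro H hH hd
    have hle : N ≤ H.comap (QuotientGroup.mk' N) := by
      conv_lhs => rw [← QuotientGroup.ker_mk' N]
      exact MonoidHom.ker_le_comap _ _
    have h1 := h.chain (H.comap (QuotientGroup.mk' N)) (hPcomap ▸ comap_mono hH)
      (by rw [← hcard, hd, hmul])
    have h2 := h1.map (inf_map_condition_of_le hle)
    rwa [map_comap_eq_self_of_surjective hsurj] at h2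
  · intro h2 hq
    refine absurd (hQ ?_) hq
    rw [← hmul, h2, mul_comm]

/-! ### Embedding the quaternion group -/

/-- Two noncommuting elements `x`, `y` of order `4` with `x² = y²` and `yxy⁻¹ = x⁻¹` generate a
quaternion group. -/
theorem exists_quaternionGroup_hom {Q : Type*} [Group Q] {x y : Q} (h4 : x ^ 4 = 1)
    (hxy : y ^ 2 = x ^ 2) (hc : x * y = y * x ^ 3) (hne : x * y ≠ y * x) :
    ∃ f : QuaternionGroup 2 →* Q, Function.Injective f := by
  have hval : ∀ n : ℕ, x ^ ((n : ZMod (2 * 2)).val) = x ^ n := fun n => by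
    rw [ZMod.val_natCast]; exact (pow_eq_pow_mod n h4).symm
  have hcast : ∀ i : ZMod (2 * 2), ((i.val : ℕ) : ZMod (2 * 2)) = i := fun i =>
    ZMod.natCast_zmod_val i
  have hneg : ∀ i : ZMod (2 * 2), -i = 3 * i := by decide
  have hsc : ∀ i : ℕ, x ^ i * y = y * x ^ (3 * i) := fun i => by
    have : SemiconjBy y (x ^ 3) x := hc.symm
    rw [pow_mul]; exact (this.pow_right i).symm
  let g : QuaternionGroup 2 → Q
    | QuaternionGroup.a i => x ^ i.val
    | QuaternionGroup.xa i => y * x ^ i.val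
  have hadd : ∀ i j : ZMod (2 * 2), x ^ (i + j).val = x ^ i.val * x ^ j.val := fun i j => by
    rw [← pow_add, ← hval (i.val + j.val), Nat.cast_add, hcast, hcast]
  have hsub : ∀ i j : ZMod (2 * 2), x ^ (j - i).val = x ^ (3 * i.val) * x ^ j.val := fun i j => by
    rw [← pow_add, ← hval (3 * i.val + j.val), Nat.cast_add, Nat.cast_mul, hcast, hcast,
      sub_eq_add_neg, hneg, add_comm]
    rfl
  refine ⟨MonoidHom.mk' g ?_, ?_⟩
  · rintro (i | i) (j | j)
    · rw [QuaternionGroup.a_mul_a]; exact hadd i j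
    · rw [QuaternionGroup.a_mul_xa]
      change y * x ^ (j - i).val = x ^ i.val * (y * x ^ j.val)
      rw [hsub, ← mul_assoc (x ^ i.val), hsc, mul_assoc]
    · rw [QuaternionGroup.xa_mul_a]
      change y * x ^ (i + j).val = y * x ^ i.val * x ^ j.val
      rw [hadd, mul_assoc]
    · rw [QuaternionGroup.xa_mul_xa]
      change x ^ (((2 : ℕ) : ZMod (2 * 2)) + j - i).val = y * x ^ i.val * (y * x ^ j.val)
      rw [hsub, hadd, hval, mul_assoc, ← mul_assoc (x ^ i.val), hsc, mul_assoc, ← mul_assoc y y,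
        ← pow_two y, hxy, ← mul_assoc, ← pow_add, ← pow_add, ← pow_add, ← pow_add]
      congr 1
      omega
  · refine (injective_iff_map_eq_one _).2 ?_
    rintro (i | i) hi
    · have hi' : x ^ i.val = 1 := hi
      have hx2 : x ^ 2 ≠ 1 := fun h => hne (by
        rw [hc, pow_succ, h, one_mul])
      have hi4 : i.val < 4 := ZMod.val_lt i
      have hi0 : i.val = 0 := by
        have h1 : x ≠ 1 := fun h => hx2 (by rw [h, one_pow])
        generalize i.val = n at hi' hi4
        interval_cases n
        · rfl
        · exact absurd (by simpa using hi') h1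
        · exact absurd hi' hx2
        · exact absurd (by rw [pow_succ, hi', one_mul] at h4; exact h4) h1
      rw [QuaternionGroup.one_def, (ZMod.val_eq_zero i).1 hi0]
    · have hi' : y * x ^ i.val = 1 := hi
      refine absurd ?_ hne
      rw [eq_inv_of_mul_eq_one_left hi']
      exact ((Commute.refl x).pow_right _).inv_right

/-- Suppose every square in `Q` is `1` or the central involution `z`. If `Q` contains no quaternion
subgroup, then the elements with square `z` generate an abelian subgroup `A`, and the product
of two elements outside `A` lies in `A`. -/
theorem abelian_of_no_quaternion {Q : Type*} [Group Q] {z : Q} (hz : z ^ 2 = 1)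
    (hzc : ∀ q : Q, z * q = q * z) (hsq : ∀ q : Q, q ^ 2 = 1 ∨ q ^ 2 = z)
    (hQ : ∀ f : QuaternionGroup 2 →* Q, ¬ Function.Injective f) (hex : ∃ q : Q, q ^ 2 = z) :
    (∀ a ∈ closure {q : Q | q ^ 2 = z}, ∀ b ∈ closure {q : Q | q ^ 2 = z}, a * b = b * a) ∧
      ∀ u v : Q, u ∉ closure {q : Q | q ^ 2 = z} → v ∉ closure {q : Q | q ^ 2 = z} →
        u * v ∈ closure {q : Q | q ^ 2 = z} := by
  have hinv : ∀ q : Q, q ^ 2 = z → q⁻¹ = q * z := fun q hq => by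
    rw [inv_eq_iff_mul_eq_one, ← mul_assoc, ← pow_two, hq, ← pow_two, hz]
  have hcomm : ∀ x ∈ {q : Q | q ^ 2 = z}, ∀ y ∈ {q : Q | q ^ 2 = z}, x * y = y * x := by
    intro x hx y hy
    by_contra hne
    have hx' : x ^ 2 = z := hx
    have hy' : y ^ 2 = z := hy
    rcases hsq (x * y) with h | h
    · -- `xy` is an involution, so `xy = y⁻¹x⁻¹ = yx`
      apply hne
      have h1 : x * y = (x * y)⁻¹ := by rw [eq_inv_iff_mul_eq_one, ← pow_two, h]
      rw [h1, mul_inv_rev, hinv x hx, hinv y hy, mul_assoc, ← mul_assoc z, hzc, mul_assoc x,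
        ← pow_two, hz, mul_one]
    · have h4 : x ^ 4 = 1 := by rw [show 4 = 2 * 2 from rfl, pow_mul, hx', hz]
      obtain ⟨f, hf⟩ := exists_quaternionGroup_hom h4 (hy'.trans hx'.symm) (y := y) (x := x) (by
        have h1 : y * x * y = x := by
          have h2 : x * (y * x * y) = x * x := by
            rw [← pow_two x, hx', ← h, pow_two]; simp only [mul_assoc]
          exact mul_left_cancel h2
        have h3 : y * x = x * y * z := by
          have h5 : y * x * y * y⁻¹ = x * (y * z) := by rw [h1, hinv y hy]
          rw [mul_inv_cancel_right] at h5
          rw [h5, mul_assoc]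
        rw [pow_succ, hx', ← mul_assoc, ← hzc, mul_assoc, h3, hzc, mul_assoc, ← pow_two, hz,
          mul_one]) hne
      exact hQ f hf
  obtain ⟨x, hx⟩ := hex
  have hxA : x ∈ closure {q : Q | q ^ 2 = z} := subset_closure hx
  refine ⟨fun a ha b hb => ?_, ?_⟩
  · have h1 : closure {q : Q | q ^ 2 = z} ≤ centralizer {q : Q | q ^ 2 = z} :=
      (closure_le _).2 fun a ha => mem_centralizer_iff.2 fun b hb => hcomm b hb a ha
    have h2 : closure {q : Q | q ^ 2 = z} ≤ centralizer (closure {q : Q | q ^ 2 = z} : Set Q) :=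
      (closure_le _).2 fun b hb => mem_centralizer_iff.2 fun a ha =>
        (mem_centralizer_iff.1 (h1 ha) b hb).symm
    exact mem_centralizer_iff.1 (h2 hb) a ha
  · have hout : ∀ u : Q, u ∉ closure {q : Q | q ^ 2 = z} → u * x = z * x * u := by
      intro u hu
      have hu2 : u ^ 2 = 1 := (hsq u).resolve_right fun h => hu (subset_closure h)
      have hux : (u * x) ^ 2 = 1 := (hsq (u * x)).resolve_right fun h => hu (by
        have h1 : u * x ∈ closure {q : Q | q ^ 2 = z} := subset_closure h
        have := mul_mem h1 (inv_mem hxA)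
        rwa [mul_inv_cancel_right] at this)
      have h1 : u * x = (u * x)⁻¹ := by rw [eq_inv_iff_mul_eq_one, ← pow_two, hux]
      have h2 : u⁻¹ = u := by rw [inv_eq_iff_mul_eq_one, ← pow_two, hu2]
      rw [h1, mul_inv_rev, hinv x hx, h2, hzc]
    intro u v hu hv
    by_contra huv
    have h1 := hout _ huv
    have h2 : u * v * x = x * (u * v) := by
      rw [mul_assoc, hout v hv, ← mul_assoc, ← mul_assoc, ← hzc, mul_assoc z, hout u hu,
        ← mul_assoc,
        ← mul_assoc, ← pow_two, hz, one_mul, mul_assoc]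
    rw [h2, mul_assoc, hzc, left_eq_mul] at h1
    have h3 : z = 1 := by simpa using h1
    have h4 : u ^ 2 = z := by
      rw [h3]; exact (hsq u).elim id fun h => h.trans h3
    exact hu (subset_closure h4)

/-- The power formula in class two. -/
theorem mul_pow_of_commutator {Q : Type*} [Group Q] {a b c : Q} (h : b * a = a * b * c)
    (ha : a * c = c * a) (hb : b * c = c * b) (n : ℕ) :
    (a * b) ^ n = a ^ n * b ^ n * c ^ n.choose 2 := by
  have h1 : ∀ n : ℕ, b ^ n * a = a * b ^ n * c ^ n := by
    intro n
    induction n with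
    | zero => simp
    | succ n ih =>
      have hb' : b * c ^ n = c ^ n * b := Commute.pow_right hb n
      rw [pow_succ', mul_assoc, ih, ← mul_assoc, ← mul_assoc, h, pow_succ' c]
      have : c * b ^ n = b ^ n * c := (Commute.pow_left hb n).symm
      rw [mul_assoc (a * b) c, this]
      simp only [mul_assoc]
  induction n with
  | zero => simp
  | succ n ih =>
    have hca : c ^ n.choose 2 * (a * b) = a * b * c ^ n.choose 2 :=
      ((Commute.pow_left (show Commute c (a * b) from
        (Commute.mul_right ha.symm hb.symm)) _))
    have hcb : c ^ n * b = b * c ^ n := (Commute.pow_right hb n).symm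
    rw [pow_succ, ih, mul_assoc, hca, Nat.choose_succ_succ' n 1, Nat.choose_one_right, pow_add c,
      ← mul_assoc, mul_assoc (a ^ n), ← mul_assoc (b ^ n), h1, pow_succ a n, pow_succ b n]
    simp only [mul_assoc]
    rw [← mul_assoc (c ^ n) b, hcb, mul_assoc]

/-! ### The obstruction to a normal Sylow subgroup -/

theorem exists_largest_normal_pGroup [Finite G] (p : ℕ) :
    ∃ R : Subgroup G, R.Normal ∧ IsPGroup p R ∧
      ∀ N : Subgroup G, N.Normal → IsPGroup p N → N ≤ R := by
  refine ⟨sSup {N : Subgroup G | N.Normal ∧ IsPGroup p N}, sSup_normal _ fun _ h => h.1,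
    Sylow.sSup_of_normal _ ?_ ?_, fun N h1 h2 => le_sSup ⟨h1, h2⟩⟩
  · exact fun _ h => h.2
  · exact fun _ h => h.1

/-- The centralizer of `X` modulo the normal subgroup `A`. -/
def centralizerMod (A : Subgroup G) [A.Normal] (X : Subgroup G) : Subgroup G :=
  (centralizer (X.map (QuotientGroup.mk' A) : Set (G ⧸ A))).comap (QuotientGroup.mk' A)

theorem mem_centralizerMod {A X : Subgroup G} [A.Normal] {g : G} :
    g ∈ centralizerMod A X ↔ ∀ x ∈ X, x * g * x⁻¹ * g⁻¹ ∈ A := by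
  simp only [centralizerMod, mem_comap, mem_centralizer_iff, coe_map, Set.forall_mem_image,
    SetLike.mem_coe]
  refine forall₂_congr fun r _ => ?_
  rw [← QuotientGroup.eq_one_iff (N := A)]
  simp only [QuotientGroup.mk'_apply, QuotientGroup.mk_mul, QuotientGroup.mk_inv]
  rw [mul_inv_eq_one, mul_inv_eq_iff_eq_mul]

instance centralizerMod_normal (A X : Subgroup G) [A.Normal] [hX : X.Normal] :
    (centralizerMod A X).Normal := by
  have h1 : (X.map (QuotientGroup.mk' A)).Normal := hX.map _ (QuotientGroup.mk'_surjective A)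
  have h2 : (centralizer (X.map (QuotientGroup.mk' A) : Set (G ⧸ A))).Normal := inferInstance
  exact h2.comap _

theorem le_centralizerMod (A X : Subgroup G) [A.Normal] : A ≤ centralizerMod A X :=
  fun a ha => mem_centralizerMod.2 fun x _ =>
    mul_mem (‹A.Normal›.conj_mem a ha x) (inv_mem ha)

/-- A Sylow `p`-subgroup centralizes the normal sections of order `p` below it. -/
theorem sylow_le_centralizerMod [Finite G] {p : ℕ} [hp : Fact p.Prime] (P : Sylow p G)
    {A B : Subgroup G} [A.Normal] [B.Normal] (hAB : A ≤ B) (hBP : B ≤ P)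
    (hi : A.relIndex B = p) : (P : Subgroup G) ≤ centralizerMod A B := by
  have hlt : A < B := lt_of_le_of_ne hAB fun h => by
    rw [h, relIndex_self] at hi
    exact hp.out.one_lt.ne hi
  obtain ⟨b, hbB, hbA, -, hbc⟩ := exists_central_mod P.isPGroup' le_normalizer_of_normal
    le_normalizer_of_normal hlt hBP
  have h1 : A < B ⊓ centralizerMod A P := by
    refine lt_of_le_of_ne (le_inf hAB (le_centralizerMod A P)) fun h => hbA ?_
    rw [h]
    exact ⟨hbB, mem_centralizerMod.2 hbc⟩
  have h2 := relIndex_mul_relIndex A _ B h1.le inf_le_left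
  rw [hi] at h2
  have h3 : (B ⊓ centralizerMod A P).relIndex B = 1 := by
    rcases (Nat.dvd_prime hp.out).1 ⟨_, h2.symm⟩ with h | h
    · exact absurd h (one_lt_relIndex h1).ne'
    · rw [h] at h2
      exact Nat.eq_of_mul_eq_mul_left hp.out.pos (h2.trans (mul_one p).symm)
  have h4 : B ≤ centralizerMod A P := (relIndex_eq_one.1 h3).trans inf_le_right
  intro r hr
  refine mem_centralizerMod.2 fun x hx => ?_
  have h5 := inv_mem (mem_centralizerMod.1 (h4 hx) r hr)
  simpa [mul_assoc] using h5

/-- The data obtained when the Sylow `p`-subgroup is not normal: a normal `p`-subgroup `L` with a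
largest proper `G`-invariant subgroup `K`, where the chief factor `L/K` does not have order `p`,
`K` is central in `L`, and a set `J` (of `p'`-elements, in the application) centralizes `K` while
`L` is generated by the commutators `[l, y]` with `y ∈ J`. -/
structure Obstruction (p : ℕ) (K L : Subgroup G) (J : Set G) : Prop where
  normal_left : K.Normal
  normal_right : L.Normal
  isPGroup : IsPGroup p L
  lt : K < L
  max : ∀ M : Subgroup G, M.Normal → M ≤ L → M = L ∨ M ≤ K
  relIndex_ne : K.relIndex L ≠ p
  central : ∀ k ∈ K, ∀ l ∈ L, l * k = k * l
  fixed : ∀ y ∈ J, ∀ k ∈ K, y * k = k * y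
  gen : L ≤ closure {m | ∃ l ∈ L, ∃ y ∈ J, m = l⁻¹ * (y * l * y⁻¹)}

theorem Obstruction.isChiefFactor {p : ℕ} {K L : Subgroup G} {J : Set G}
    (h : Obstruction p K L J) : IsChiefFactor K L :=
  ⟨h.normal_left, h.normal_right, h.lt, fun M hM hKM hML =>
    (h.max M hM hML).elim Or.inr fun h1 => Or.inl (le_antisymm h1 hKM)⟩

/-- A `p'`-element acting on a `p`-group so that it fixes its commutator with `l` fixes `l`. -/
theorem commute_of_coprime [Finite G] {p : ℕ} [Fact p.Prime] {R : Subgroup G} (hR : IsPGroup p R)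
    {y l : G} (hy : (orderOf y).Coprime p) (hm : l⁻¹ * (y * l * y⁻¹) ∈ R)
    (hc : y * (l⁻¹ * (y * l * y⁻¹)) = l⁻¹ * (y * l * y⁻¹) * y) : y * l = l * y := by
  set m := l⁻¹ * (y * l * y⁻¹) with hmdef
  have h0 : y * l * y⁻¹ = l * m := by rw [hmdef, mul_inv_cancel_left]
  have h1 : ∀ n : ℕ, y ^ n * l * (y ^ n)⁻¹ = l * m ^ n := by
    intro n
    induction n with
    | zero => simp
    | succ n ih =>
      have h2 : y * m ^ n * y⁻¹ = m ^ n := by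
        rw [mul_inv_eq_iff_eq_mul]; exact Commute.pow_right hc n
      calc y ^ (n + 1) * l * (y ^ (n + 1))⁻¹ = y * (y ^ n * l * (y ^ n)⁻¹) * y⁻¹ := by
            rw [pow_succ']; group
        _ = (y * l * y⁻¹) * (y * m ^ n * y⁻¹) := by rw [ih]; group
        _ = l * m ^ (n + 1) := by rw [h0, h2, pow_succ', mul_assoc]
  have h2 := h1 (orderOf y)
  rw [pow_orderOf_eq_one, one_mul, inv_one, mul_one, left_eq_mul] at h2
  have h3 : orderOf m ∣ orderOf y := orderOf_dvd_of_pow_eq_one h2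
  have h4 : orderOf m ∣ Nat.card R := by
    rw [← orderOf_mk m hm]; exact orderOf_dvd_natCard _
  have h5 : orderOf m = 1 := Nat.eq_one_of_dvd_coprimes (coprime_of_isPGroup hR hy) h4 h3
  rw [orderOf_eq_one_iff.1 h5, mul_one] at h0
  exact mul_inv_eq_iff_eq_mul.1 h0

/-- Take for `J` the `p'`-elements that centralize every normal section of order `p` of `O_p(G)`.
Not all of them centralize `O_p(G)`: by the Hall–Higman lemma `P` would be normal otherwise. Then
`L` is a minimal normal subgroup of `G` inside `O_p(G)` among those not centralized by `J`, and
`K = C_L(J)`. -/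
theorem exists_obstruction [Finite G] {p : ℕ} [hp : Fact p.Prime] (P : Sylow p G)
    (hG : IsPSoluble p G) (h0 : NoPrimeCore p G) (hP : ¬ (P : Subgroup G).Normal) :
    ∃ K L J, Obstruction (G := G) p K L J := by
  obtain ⟨R, hRn, hR, hRmax⟩ := exists_largest_normal_pGroup (G := G) p
  have hRP : R ≤ P := hR.le_sylow_of_normal P
  -- the common centralizer of the normal sections of order `p` inside `R`
  let 𝒞 : Set (Subgroup G) := {C | ∃ (A B : Subgroup G) (_ : A.Normal), B.Normal ∧ A ≤ B ∧ B ≤ R ∧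
    A.relIndex B = p ∧ C = centralizerMod A B}
  have hYn : (sInf 𝒞).Normal := ⟨fun y hy g => mem_sInf.2 (by
    rintro C ⟨A, B, hA, hB, hAB, hBR, hi, rfl⟩
    exact (centralizerMod_normal A B).conj_mem y
      (mem_sInf.1 hy _ ⟨A, B, hA, hB, hAB, hBR, hi, rfl⟩) g)⟩
  have hPY : (P : Subgroup G) ≤ sInf 𝒞 := le_sInf (by
    rintro C ⟨A, B, hA, hB, hAB, hBR, hi, rfl⟩
    exact sylow_le_centralizerMod P hAB (hBR.trans hRP) hi)
  let J : Set G := {y | y ∈ sInf 𝒞 ∧ (orderOf y).Coprime p}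
  have hJ : ∀ y ∈ J, ∀ g : G, g * y * g⁻¹ ∈ J := fun y hy g =>
    ⟨hYn.conj_mem y hy.1 g, by
      have : orderOf (g * y * g⁻¹) = orderOf y :=
        orderOf_injective (MulAut.conj g).toMonoidHom (MulAut.conj g).injective y
      rw [this]; exact hy.2⟩
  have hex : ∃ y ∈ J, ∃ r ∈ R, y * r ≠ r * y := by
    by_contra! hcon
    refine hP (normal_sylow_of_isPGroup_normal P hYn (fun g => ?_) hPY)
    obtain ⟨a, m, hm, hgm⟩ := Nat.exists_eq_pow_mul_and_not_dvd (orderOf_pos (g : G)).ne' p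
      hp.out.ne_one
    have hord : orderOf ((g : G) ^ p ^ a) = m := by
      rw [orderOf_pow_of_dvd (pow_pos hp.out.pos a).ne' ⟨m, hgm⟩, hgm,
        Nat.mul_div_cancel_left _ (pow_pos hp.out.pos a)]
    have hyJ : (g : G) ^ p ^ a ∈ J := ⟨pow_mem g.2 _, by
      rw [hord]; exact ((Nat.Prime.coprime_iff_not_dvd hp.out).2 hm).symm⟩
    have hyR : (g : G) ^ p ^ a ∈ R := centralizer_le_of_noPrimeCore hG h0 hR hRmax
      (mem_centralizer_iff.2 fun r hr => (hcon _ hyJ r hr).symm)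
    have h1 : orderOf ((g : G) ^ p ^ a) ∣ Nat.card R := by
      rw [← orderOf_mk _ hyR]; exact orderOf_dvd_natCard _
    have h2 : orderOf ((g : G) ^ p ^ a) = 1 :=
      Nat.eq_one_of_dvd_coprimes (coprime_of_isPGroup hR hyJ.2) h1 dvd_rfl
    exact ⟨a, Subtype.ext (by simpa using orderOf_eq_one_iff.1 h2)⟩
  obtain ⟨L, hL, hLmin⟩ := Set.Finite.exists_minimal
    (s := {L : Subgroup G | L.Normal ∧ L ≤ R ∧ ∃ y ∈ J, ∃ l ∈ L, y * l ≠ l * y})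
    (Set.toFinite _) ⟨R, hRn, le_rfl, hex⟩
  obtain ⟨hLn, hLR, hLJ⟩ := hL
  have hLp : IsPGroup p L := isPGroup_le hR hLR
  have hCn : (centralizer J).Normal := ⟨fun x hx g => mem_centralizer_iff.2 fun y hy => by
    have h1 := mem_centralizer_iff.1 hx _ (hJ y hy g⁻¹)
    rw [inv_inv] at h1
    calc y * (g * x * g⁻¹) = g * (g⁻¹ * y * g * x) * g⁻¹ := by group
      _ = g * (x * (g⁻¹ * y * g)) * g⁻¹ := by rw [h1]
      _ = g * x * g⁻¹ * y := by group⟩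
  have hmax : ∀ M : Subgroup G, M.Normal → M ≤ L → M = L ∨ M ≤ L ⊓ centralizer J := by
    intro M hM hML
    by_cases h1 : ∃ y ∈ J, ∃ l ∈ M, y * l ≠ l * y
    · exact Or.inl (le_antisymm hML (hLmin ⟨hM, hML.trans hLR, h1⟩ hML))
    · push Not at h1
      exact Or.inr (le_inf hML fun x hx => mem_centralizer_iff.2 fun y hy => h1 y hy x hx)
  have hfix : ∀ y ∈ J, ∀ k ∈ L ⊓ centralizer J, y * k = k * y := fun y hy k hk =>
    mem_centralizer_iff.1 hk.2 y hy
  have hKn : (L ⊓ centralizer J).Normal := inferInstance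
  have hlt : L ⊓ centralizer J < L := by
    refine lt_of_le_of_ne inf_le_left fun h => ?_
    obtain ⟨y, hy, l, hl, hne⟩ := hLJ
    exact hne (hfix y hy l (h.symm ▸ hl))
  let s : Set G := {m | ∃ l ∈ L, ∃ y ∈ J, m = l⁻¹ * (y * l * y⁻¹)}
  have hs : ∀ m ∈ s, m ∈ L := by
    rintro m ⟨l, hl, y, -, rfl⟩
    exact mul_mem (inv_mem hl) (hLn.conj_mem l hl y)
  have hsn : (closure s).Normal := by
    have h1 : Group.conjugatesOfSet s ⊆ s := by
      intro x hx
      obtain ⟨m, ⟨l, hl, y, hy, rfl⟩, hc⟩ := Group.mem_conjugatesOfSet_iff.1 hx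
      obtain ⟨g, rfl⟩ := isConj_iff.1 hc
      exact ⟨g * l * g⁻¹, hLn.conj_mem l hl g, g * y * g⁻¹, hJ y hy g, by group⟩
    have h2 : closure s = normalClosure s :=
      le_antisymm (closure_mono Group.subset_conjugatesOfSet) (closure_mono h1)
    rw [h2]; infer_instance
  have hgen_not : ¬ s ⊆ (L ⊓ centralizer J : Subgroup G) := by
    intro hsub
    obtain ⟨y, hy, l, hl, hne⟩ := hLJ
    have hm : l⁻¹ * (y * l * y⁻¹) ∈ s := ⟨l, hl, y, hy, rfl⟩
    exact hne (commute_of_coprime hLp hy.2 (hs _ hm) (hfix y hy _ (hsub hm)))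
  have hgen : closure s = L := by
    rcases hmax _ hsn ((closure_le _).2 hs) with h | h
    · exact h
    · exact absurd ((closure_le _).1 h) hgen_not
  refine ⟨L ⊓ centralizer J, L, J, hKn, hLn, hLp, hlt, hmax, fun hi => ?_, ?_, hfix, hgen.ge⟩
  · apply hgen_not
    rintro m ⟨l, hl, y, hy, rfl⟩
    have h1 : y ∈ centralizerMod (L ⊓ centralizer J) L :=
      mem_sInf.1 hy.1 _ ⟨_, L, hKn, hLn, hlt.le, hLR, hi, rfl⟩
    have h2 := mem_centralizerMod.1 h1 l⁻¹ (inv_mem hl)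
    simpa [mul_assoc] using h2
  · intro k hk
    -- by the three-subgroup argument the generators of `L` centralize `k`
    have h1 : L ≤ centralizer {k} := by
      rw [← hgen, closure_le]
      rintro m ⟨l, hl, y, hy, rfl⟩
      refine mem_centralizer_iff.2 fun k' hk' => ?_
      rw [Set.mem_singleton_iff] at hk'
      subst hk'
      have hyk : y⁻¹ * k' * y = k' := by
        rw [mul_assoc, ← hfix y hy k' hk, inv_mul_cancel_left]
      have hylk := hfix y hy _ (hKn.conj_mem k' hk l)
      have h2 : y * l * y⁻¹ * k' * (y * l * y⁻¹)⁻¹ = l * k' * l⁻¹ := by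
        calc y * l * y⁻¹ * k' * (y * l * y⁻¹)⁻¹ = y * (l * (y⁻¹ * k' * y) * l⁻¹) * y⁻¹ := by group
          _ = y * (l * k' * l⁻¹) * y⁻¹ := by rw [hyk]
          _ = l * k' * l⁻¹ := by rw [hylk, mul_inv_cancel_right]
      have h3 := mul_inv_eq_iff_eq_mul.1 h2
      calc k' * (l⁻¹ * (y * l * y⁻¹)) = l⁻¹ * (l * k' * l⁻¹ * (y * l * y⁻¹)) := by group
        _ = l⁻¹ * (y * l * y⁻¹ * k') := by rw [h3]
        _ = l⁻¹ * (y * l * y⁻¹) * k' := by group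
    intro l hl
    exact (mem_centralizer_iff.1 (h1 hl) k rfl).symm

namespace Obstruction

variable {p : ℕ} {K L : Subgroup G} {J : Set G}

/-- `L` has exponent dividing `e` when `p` divides `e` and `e(e-1)/2`. -/
theorem pow_eq_one [Finite G] [hp : Fact p.Prime] (h : Obstruction p K L J) {e : ℕ} (he : p ∣ e)
    (he2 : p ∣ e.choose 2) : ∀ l ∈ L, l ^ e = 1 := by
  have hch := h.isChiefFactor
  have hpow := pow_mem_of_isChiefFactor h.isPGroup hch
  have hpowe : ∀ l ∈ L, l ^ e ∈ K := fun l hl => by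
    obtain ⟨t, rfl⟩ := he
    rw [pow_mul]; exact pow_mem (hpow l hl) t
  have hmul : ∀ a ∈ L, ∀ b ∈ L, (a * b) ^ e = a ^ e * b ^ e := by
    intro a ha b hb
    set c := b⁻¹ * a⁻¹ * b * a with hc
    have hba : b * a = a * b * c := by rw [hc]; group
    have hcK : c ∈ K := by
      have := h.normal_left
      have := h.normal_right
      have h1 := commutator_mem_of_isChiefFactor h.isPGroup hch le_rfl
        a⁻¹ (inv_mem ha) b⁻¹ (inv_mem hb)
      simpa [hc] using h1
    have hac := h.central c hcK a ha
    have hbc := h.central c hcK b hb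
    have hcp : c ^ p = 1 := by
      have h1 : a⁻¹ * b * a = b * c := by rw [hc]; group
      have h2 : (a⁻¹ * b * a) ^ p = a⁻¹ * b ^ p * a := by
        have := conj_pow (i := p) (a := a⁻¹) (b := b)
        rwa [inv_inv] at this
      have h3 : (b * c) ^ p = b ^ p * c ^ p := Commute.mul_pow hbc p
      rw [← h1, h2, mul_assoc, ← h.central _ (hpow b hb) a ha, inv_mul_cancel_left, left_eq_mul]
        at h3
      exact h3
    rw [mul_pow_of_commutator hba hac hbc]
    obtain ⟨t, ht⟩ := he2
    rw [ht, pow_mul, hcp, one_pow, mul_one]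
  let E : Subgroup G :=
    { carrier := {x | x ∈ L ∧ x ^ e = 1}
      one_mem' := ⟨one_mem _, one_pow _⟩
      mul_mem' := fun {a b} ha hb => ⟨mul_mem ha.1 hb.1, by
        rw [hmul a ha.1 b hb.1, ha.2, hb.2, one_mul]⟩
      inv_mem' := fun {a} ha => ⟨inv_mem ha.1, by rw [inv_pow, ha.2, inv_one]⟩ }
  have hE : closure {m | ∃ l ∈ L, ∃ y ∈ J, m = l⁻¹ * (y * l * y⁻¹)} ≤ E := by
    rw [closure_le]
    rintro m ⟨l, hl, y, hy, rfl⟩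
    have hy' := h.normal_right.conj_mem l hl y
    refine ⟨mul_mem (inv_mem hl) hy', ?_⟩
    rw [hmul _ (inv_mem hl) _ hy', conj_pow, h.fixed y hy _ (hpowe l hl), mul_inv_cancel_right,
      inv_pow, inv_mul_cancel]
  exact fun l hl => (hE (h.gen hl)).2

open scoped Pointwise in
/-- For `p = 2`, if no subgroup of `L` maps onto the quaternion group, then `L` is elementary
abelian. -/
theorem sq_eq_one_of_no_quaternion [Finite G] (h : Obstruction 2 K L J)
    (hQ : ∀ A : Subgroup G, A ≤ L → ∀ f : A →* QuaternionGroup 2, ¬ Function.Surjective f) :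
    ∀ l ∈ L, l ^ 2 = 1 := by
  by_contra! hcon
  obtain ⟨x, hxL, hx⟩ := hcon
  have hLn := h.normal_right
  have hpow := pow_mem_of_isChiefFactor h.isPGroup h.isChiefFactor
  have h4 : ∀ l ∈ L, l ^ 4 = 1 := h.pow_eq_one (by decide) (by decide)
  have h22 : ∀ l ∈ L, (l ^ 2) ^ 2 = 1 := fun l hl => by rw [← pow_mul]; exact h4 l hl
  -- a maximal subgroup of `K` avoiding the square `x²`
  obtain ⟨M, hM, hMmax⟩ := Set.Finite.exists_maximal
    (s := {M : Subgroup G | M ≤ K ∧ x ^ 2 ∉ M}) (Set.toFinite _)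
    ⟨⊥, bot_le, fun h1 => hx (mem_bot.1 h1)⟩
  obtain ⟨hMK, hxM⟩ := hM
  have hMsq : ∀ l ∈ L, l ^ 2 ∈ M ∨ l ^ 2 * x ^ 2 ∈ M := by
    intro l hl
    by_cases hlM : l ^ 2 ∈ M
    · exact Or.inl hlM
    right
    let Z := zpowers (l ^ 2)
    have hMn : Z ≤ normalizer (M : Set G) := by
      rw [zpowers_le, mem_normalizer_iff]
      intro m
      have hc : ∀ m ∈ K, l ^ 2 * m * (l ^ 2)⁻¹ = m := fun m hm => by
        rw [h.central m hm _ (pow_mem hl 2), mul_inv_cancel_right]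
      constructor
      · intro hm; rwa [hc m (hMK hm)]
      · intro hm
        have h1 := hc _ (hMK hm)
        have h2 : l ^ 2 * m * (l ^ 2)⁻¹ = m := by
          have h3 : l ^ 2 * (l ^ 2 * m * (l ^ 2)⁻¹) * (l ^ 2)⁻¹
            = l ^ 2 * (m) * (l ^ 2)⁻¹ := h1
          exact mul_left_cancel (mul_right_cancel h3)
        rwa [h2] at hm
    have hin : x ^ 2 ∈ M ⊔ Z := by
      by_contra hnot
      have h1 : M ⊔ Z ≤ M := hMmax
        ⟨sup_le hMK (zpowers_le.2 (hpow l hl)), hnot⟩ le_sup_left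
      exact hlM (h1 (mem_sup_right (mem_zpowers _)))
    have hin' : x ^ 2 ∈ (M : Set G) * Z := by
      rw [← coe_mul_of_right_le_normalizer_left M Z hMn]; exact hin
    obtain ⟨m, hm, w, hw, hmw⟩ := Set.mem_mul.1 hin'
    have hw2 : w = 1 ∨ w = l ^ 2 := by
      obtain ⟨n, rfl⟩ := mem_zpowers_iff.1 hw
      rcases Int.even_or_odd' n with ⟨t, rfl | rfl⟩
      · left; rw [zpow_mul]; norm_cast; rw [h22 l hl, one_zpow]
      · right; rw [zpow_add, zpow_mul]; norm_cast; rw [h22 l hl, one_zpow, one_mul, pow_one]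
    rcases hw2 with rfl | rfl
    · rw [mul_one] at hmw; exact absurd (hmw ▸ hm) hxM
    · rw [← hmw, h.central m (hMK hm) _ (pow_mem hl 2) |>.symm, ← mul_assoc, ← pow_two, h22 l hl,
        one_mul]
      exact hm
  -- pass to the quotient of `L` by the central subgroup `M`
  have hMn : (M.subgroupOf L).Normal := ⟨fun m hm l => by
    rw [mem_subgroupOf] at hm ⊢
    have : (l : G) * m * (l : G)⁻¹ = m := by
      rw [h.central _ (hMK hm) l l.2, mul_inv_cancel_right]
    simpa [this] using hm⟩
  let f := QuotientGroup.mk' (M.subgroupOf L)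
  have hf : Function.Surjective f := QuotientGroup.mk'_surjective _
  have hker : ∀ l : L, f l = 1 ↔ (l : G) ∈ M := fun l => by
    rw [← mem_subgroupOf]; exact QuotientGroup.eq_one_iff l
  let x' : L := ⟨x, hxL⟩
  have hz2 : ((f x') ^ 2) ^ 2 = 1 := by
    rw [← map_pow, ← map_pow, hker]
    have : (((x' ^ 2) ^ 2 : L) : G) = 1 := by simpa [x'] using h22 x hxL
    rw [this]; exact one_mem _
  have hz1 : (f x') ^ 2 ≠ 1 := by
    rw [← map_pow, Ne, hker]; simpa [x'] using hxM
  have hzc : ∀ q, (f x') ^ 2 * q = q * (f x') ^ 2 := by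
    intro q
    obtain ⟨l, rfl⟩ := hf q
    rw [← map_pow, ← map_mul, ← map_mul]
    congr 1
    exact Subtype.ext (by simpa [x'] using (h.central _ (hpow x hxL) l l.2).symm)
  have hsq : ∀ q, q ^ 2 = 1 ∨ q ^ 2 = (f x') ^ 2 := by
    intro q
    obtain ⟨l, rfl⟩ := hf q
    rcases hMsq l l.2 with h1 | h1
    · left; rw [← map_pow, hker]; simpa using h1
    · right
      have h2 : f l ^ 2 * (f x') ^ 2 = 1 := by
        rw [← map_pow, ← map_pow, ← map_mul, hker]; simpa [x'] using h1
      rw [eq_inv_of_mul_eq_one_left h2, inv_eq_iff_mul_eq_one, ← pow_two, hz2]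
  have hQ' : ∀ φ : QuaternionGroup 2 →* L ⧸ M.subgroupOf L, ¬ Function.Injective φ := by
    intro φ hφ
    let B : Subgroup L := φ.range.comap f
    let e := MonoidHom.ofInjective hφ
    let g : B →* QuaternionGroup 2 := e.symm.toMonoidHom.comp (f.subgroupComap φ.range)
    have hg : Function.Surjective g := by
      rw [MonoidHom.coe_comp]
      exact e.symm.surjective.comp (f.subgroupComap_surjective_of_surjective _ hf)
    let i := B.equivMapOfInjective L.subtype L.subtype_injective
    exact hQ (B.map L.subtype) (map_subtype_le B) (g.comp i.symm.toMonoidHom)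
      (hg.comp i.symm.surjective)
  obtain ⟨hA, hout⟩ := abelian_of_no_quaternion hz2 hzc hsq hQ' ⟨f x', rfl⟩
  set A := closure {q | q ^ 2 = (f x') ^ 2} with hAdef
  -- each `y ∈ J` acts on `L` and preserves the elements with nontrivial square
  have hgenA : ∀ l : L, f l ∈ A := by
    have hact : ∀ y ∈ J, ∀ l : L, f l ∈ A →
        f ⟨y * l * y⁻¹, hLn.conj_mem l l.2 y⟩ ∈ A := by
      intro y hy l hl
      let α : L →* L := (MulAut.conjNormal (H := L) y).toMonoidHom
      have hα : ∀ l : L, ((α l : L) : G) = y * l * y⁻¹ := fun l => MulAut.conjNormal_apply y l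
      have h1 : A.comap f ≤ (A.comap f).comap α := by
        have h2 : A.comap f = closure (f ⁻¹' {q | q ^ 2 = (f x') ^ 2}) ⊔ f.ker := by
          apply le_antisymm
          · intro a ha
            have h3 : (closure (f ⁻¹' {q | q ^ 2 = (f x') ^ 2})).map f = A := by
              rw [MonoidHom.map_closure, Set.image_preimage_eq _ hf]
            rw [← comap_map_eq, h3]; exact ha
          · refine sup_le ((closure_le _).2 fun a ha => subset_closure ha) ?_
            exact MonoidHom.ker_le_comap _ _
        have h5 : ∀ a : L, (a : G) ∈ K → α a = a := fun a ha => Subtype.ext (by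
          rw [hα, h.fixed y hy _ ha, mul_inv_cancel_right])
        conv_lhs => rw [h2]
        refine sup_le ((closure_le _).2 fun a ha => ?_) fun a ha => ?_
        · refine subset_closure ?_
          have h6 : f a ^ 2 = (f x') ^ 2 := ha
          change f (α a) ^ 2 = (f x') ^ 2
          rw [← map_pow, ← map_pow, h5 (a ^ 2) (by simpa using hpow a a.2), map_pow, h6]
        · have h6 : (a : G) ∈ M := (hker a).1 ha
          change f (α a) ∈ A
          rw [h5 a (hMK h6), (hker a).2 h6]; exact one_mem _
      exact h1 hl
    have hact' : ∀ y ∈ J, ∀ l : L, f ⟨y * l * y⁻¹, hLn.conj_mem l l.2 y⟩ ∈ A → f l ∈ A := by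
      intro y hy l hl
      -- iterate the action up to the order of `y`
      have h1 : ∀ n : ℕ, ∀ l : L, f l ∈ A →
          f ⟨y ^ n * l * (y ^ n)⁻¹, hLn.conj_mem l l.2 _⟩ ∈ A := by
        intro n
        induction n with
        | zero => intro l hl; simpa using hl
        | succ n ih =>
          intro l hl
          have h2 := hact y hy _ (ih l hl)
          have e : (⟨y * (y ^ n * l * (y ^ n)⁻¹) * y⁻¹, hLn.conj_mem _ (hLn.conj_mem l l.2 _) y⟩
            : L) = ⟨y ^ (n + 1) * l * (y ^ (n + 1))⁻¹, hLn.conj_mem l l.2 _⟩ :=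
            Subtype.ext (by simp only [pow_succ']; group)
          rw [← e]; exact h2
      have h2 := h1 (orderOf y - 1) _ hl
      have h3 : y ^ (orderOf y - 1) * y = 1 := by
        rw [← pow_succ, Nat.sub_add_cancel (orderOf_pos y), pow_orderOf_eq_one]
      have e : (⟨y ^ (orderOf y - 1) * (y * l * y⁻¹) * (y ^ (orderOf y - 1))⁻¹,
          hLn.conj_mem _ (hLn.conj_mem l l.2 y) _⟩ : L) = l := by
        apply Subtype.ext
        calc y ^ (orderOf y - 1) * (y * l * y⁻¹) * (y ^ (orderOf y - 1))⁻¹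
            = (y ^ (orderOf y - 1) * y) * l * (y ^ (orderOf y - 1) * y)⁻¹ := by group
          _ = l := by rw [h3]; simp
      rwa [e] at h2
    have h1 : L ≤ (A.comap f).map L.subtype := by
      refine h.gen.trans ((closure_le _).2 ?_)
      rintro m ⟨l, hl, y, hy, rfl⟩
      let l' : L := ⟨l, hl⟩
      let yl : L := ⟨y * l * y⁻¹, hLn.conj_mem l hl y⟩
      refine ⟨l'⁻¹ * yl, ?_, rfl⟩
      change f (l'⁻¹ * yl) ∈ A
      rw [map_mul, map_inv]
      by_cases hlA : f l' ∈ A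
      · exact mul_mem (inv_mem hlA) (hact y hy l' hlA)
      · exact hout _ _ (fun h2 => hlA (by simpa using inv_mem h2)) fun h2 => hlA (hact' y hy l' h2)
    intro l
    obtain ⟨l', hl', hll⟩ := h1 l.2
    rwa [← Subtype.ext (a1 := l') (a2 := l) hll]
  have hcomm : ∀ a b : L, f a * f b = f b * f a := fun a b => hA _ (hgenA a) _ (hgenA b)
  -- now squaring is a homomorphism modulo `M`, and it kills the generators of `L`
  let E : Subgroup L :=
    { carrier := {l | f l ^ 2 = 1}
      one_mem' := by simp
      mul_mem' := fun {a b} ha hb => by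
        have ha' : f a ^ 2 = 1 := ha
        have hb' : f b ^ 2 = 1 := hb
        change f (a * b) ^ 2 = 1
        rw [map_mul, Commute.mul_pow (hcomm a b), ha', hb', one_mul]
      inv_mem' := fun {a} ha => by
        have ha' : f a ^ 2 = 1 := ha
        change f a⁻¹ ^ 2 = 1
        rw [map_inv, inv_pow, ha', inv_one] }
  have hE : L ≤ E.map L.subtype := by
    refine h.gen.trans ((closure_le _).2 ?_)
    rintro m ⟨l, hl, y, hy, rfl⟩
    let l' : L := ⟨l, hl⟩
    let yl : L := ⟨y * l * y⁻¹, hLn.conj_mem l hl y⟩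
    refine ⟨l'⁻¹ * yl, ?_, rfl⟩
    have h1 : yl ^ 2 = l' ^ 2 := Subtype.ext (by
      change (y * l * y⁻¹) ^ 2 = l ^ 2
      rw [conj_pow, h.fixed y hy _ (hpow l hl), mul_inv_cancel_right])
    change f (l'⁻¹ * yl) ^ 2 = 1
    rw [map_mul, Commute.mul_pow (hcomm _ _), ← map_pow, ← map_pow, h1, ← map_mul, inv_pow,
      inv_mul_cancel, map_one]
  obtain ⟨l', hl', hll⟩ := hE hxL
  exact hz1 (by
    have : l' = x' := Subtype.ext hll
    rw [← this]; exact hl')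

/-- An obstruction contradicts the existence of enough adapted chains. -/
theorem false_of_hasPiChain [Finite G] [hp : Fact p.Prime] (h : Obstruction p K L J)
    (P : Sylow p G)
    (hch : ∀ x ∈ L, x ∉ K → ∃ H ≤ L, x ∈ H ∧ H ≤ K ⊔ zpowers x ∧ HasPiChain p H) : False := by
  have := h.normal_left
  have := h.normal_right
  obtain ⟨b, hbL, hbK, -, hbP, hbi⟩ := exists_relIndex_eq_prime P.isPGroup'
    (le_normalizer_of_normal (H := K)) le_normalizer_of_normal h.lt
    (h.isPGroup.le_sylow_of_normal P)
  obtain ⟨H, hHL, hbH, hHb, hc⟩ := hch b hbL hbK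
  have h1 : H ⊔ K = K ⊔ zpowers b :=
    le_antisymm (sup_le hHb le_sup_left) (sup_le le_sup_right
      ((zpowers_le.2 hbH).trans le_sup_left))
  have h2 := sup_eq_of_unique_maximal P h.lt h.max hHL (fun h3 => hbK (h3 hbH))
    (by rw [h1]; exact hbP) hc
  exact h.relIndex_ne (by rw [← h2, h1, hbi])

end Obstruction

/-! ### The cases `d = p` and `d = 4` -/

theorem not_normal_sylow_of_not [Finite G] {p : ℕ} [Fact p.Prime] {P : Sylow p G}
    (h : ¬ PLengthLeOne p G) : ¬ (P : Subgroup G).Normal :=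
  fun hP => h (pLengthLeOne_of_normal_sylow P hP)

theorem no_quaternion_of_isQuaternionFree [Finite G] {p : ℕ} {P : Sylow p G}
    (h : IsQuaternionFree P) {L : Subgroup G} (hL : L ≤ P) (A : Subgroup G) (hA : A ≤ L)
    (f : A →* QuaternionGroup 2) : ¬ Function.Surjective f := by
  intro hf
  let e := subgroupOfEquivOfLe (hA.trans hL)
  exact isQuaternionFree_iff.1 h (A.subgroupOf P) (f.comp e.toMonoidHom)
    (hf.comp e.surjective)

theorem hasPiChain_zpowers [Finite G] {p d : ℕ} [Fact p.Prime] {P : Sylow p G}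
    (h : PiHyp p d G P) {x : G} (hx : x ∈ (P : Subgroup G)) (hd : orderOf x = d) :
    HasPiChain p (zpowers x) :=
  h.chain _ (zpowers_le.2 hx) (by rw [Nat.card_zpowers, hd])

theorem orderOf_eq_two_or_four {x : G} (h1 : x ≠ 1) (h4 : x ^ 4 = 1) :
    orderOf x = 2 ∨ orderOf x = 4 := by
  obtain ⟨k, hk, hxk⟩ := (Nat.dvd_prime_pow Nat.prime_two).1
    (show orderOf x ∣ 2 ^ 2 from orderOf_dvd_of_pow_eq_one h4)
  interval_cases k
  · exact absurd (orderOf_eq_one_iff.1 hxk) h1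
  · exact Or.inl hxk
  · exact Or.inr hxk

/-- The hypothesis covers the cyclic subgroups generated by elements of `L` outside `K`, for an
obstruction `L/K`, because the exponent of `L` is known. -/
theorem pLengthLeOne_of_eq_prime [Finite G] {p : ℕ} [hp : Fact p.Prime] {P : Sylow p G}
    (h : PiHyp p p G P) (h0 : NoPrimeCore p G) : PLengthLeOne p G := by
  by_contra hcon
  obtain ⟨K, L, J, hO⟩ := exists_obstruction P h.psoluble h0 (not_normal_sylow_of_not hcon)
  have := hO.normal_right
  have hLP : L ≤ P := hO.isPGroup.le_sylow_of_normal P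
  have hne : ∀ x, x ∉ K → x ≠ 1 := fun x hx h1 => hx (h1 ▸ one_mem K)
  -- it suffices that the cyclic subgroups outside `K` have order `p`, or order `4` when allowed
  have key : (∀ x ∈ L, x ∉ K → HasPiChain p (zpowers x)) → False := fun hc =>
    hO.false_of_hasPiChain P fun x hx hxK =>
      ⟨zpowers x, zpowers_le.2 hx, mem_zpowers x, le_sup_right, hc x hx hxK⟩
  by_cases hp2 : p = 2
  · subst hp2
    by_cases hQ : IsQuaternionFree P
    · have h2 := hO.sq_eq_one_of_no_quaternion (no_quaternion_of_isQuaternionFree hQ hLP)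
      exact key fun x hx hxK => hasPiChain_zpowers h (hLP hx)
        (orderOf_eq_prime (h2 x hx) (hne x hxK))
    · have h4 := hO.pow_eq_one (e := 4) (by decide) (by decide)
      refine key fun x hx hxK => ?_
      rcases orderOf_eq_two_or_four (hne x hxK) (h4 x hx) with ho | ho
      · exact hasPiChain_zpowers h (hLP hx) ho
      · exact h.cyclic rfl hQ _ (zpowers_le.2 (hLP hx)) inferInstance
          (by rw [Nat.card_zpowers, ho])
  · have hpp := hO.pow_eq_one (e := p) dvd_rfl
      (hp.out.dvd_choose_self two_ne_zero (lt_of_le_of_ne hp.out.two_le (Ne.symm hp2)))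
    exact key fun x hx hxK => hasPiChain_zpowers h (hLP hx)
      (orderOf_eq_prime (hpp x hx) (hne x hxK))

theorem pLengthLeOne_of_eq_four [Finite G] [Fact (Nat.Prime 2)] {P : Sylow 2 G}
    (h : PiHyp 2 4 G P) (h0 : NoPrimeCore 2 G)
    (hmin : ∀ N : Subgroup G, IsChiefFactor ⊥ N → Nat.card N = 2) : PLengthLeOne 2 G := by
  by_contra hcon
  obtain ⟨K, L, J, hO⟩ := exists_obstruction P h.psoluble h0 (not_normal_sylow_of_not hcon)
  have := hO.normal_left
  have := hO.normal_right
  have hLP : L ≤ P := hO.isPGroup.le_sylow_of_normal P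
  have h4 := hO.pow_eq_one (e := 4) (by decide) (by decide)
  refine hO.false_of_hasPiChain P fun x hx hxK => ?_
  have hne : x ≠ 1 := fun h1 => hxK (h1 ▸ one_mem K)
  rcases orderOf_eq_two_or_four hne (h4 x hx) with ho | ho
  · -- enlarge `⟨x⟩` by a minimal normal subgroup of order `2` inside `K`
    obtain ⟨N, hN, hNL⟩ := exists_isChiefFactor_le (K := ⊥) (L := L)
      (bot_lt_iff_ne_bot.2 fun h1 => hne (mem_bot.1 (h1 ▸ hx)))
    have hNn := hN.normal_right
    have hNK : N ≤ K := by
      rcases hO.max N hNn hNL with h1 | h1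
      · rcases hN.eq_or_eq K hO.normal_left bot_le (h1 ▸ hO.lt.le) with h2 | h2
        · exact absurd (by rw [h2, relIndex_bot_left, ← h1, hmin N hN]) hO.relIndex_ne
        · exact absurd (h2.trans h1) hO.lt.ne
      · exact h1
    refine ⟨N ⊔ zpowers x, sup_le hNL (zpowers_le.2 hx), mem_sup_right (mem_zpowers x),
      sup_le_sup_right hNK _, h.chain _ (sup_le (hNL.trans hLP) (zpowers_le.2 (hLP hx))) ?_⟩
    have h1 := relIndex_zpowers_sup (p := 2) (A := N) (b := x) (fun h1 => hxK (hNK h1))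
      (by rw [← ho, pow_orderOf_eq_one]; exact one_mem _)
      (subset_normalizer_of_normal (S := Set.univ) (Set.mem_univ x))
    rw [← card_mul_relIndex (le_sup_left : N ≤ N ⊔ zpowers x), h1, hmin N hN]
  · exact ⟨zpowers x, zpowers_le.2 hx, mem_zpowers x, le_sup_right,
      hasPiChain_zpowers h (hLP hx) ho⟩

/-! ### Index-two subgroups of minimal normal `2`-subgroups -/

/-- A normal section `Q/C(N)` that is a `p`-group is trivial when `N` is a minimal normal
`p`-subgroup. -/
theorem le_centralizer_of_isPGroup_section [Finite G] {p : ℕ} [hp : Fact p.Prime] {N Q : Subgroup G}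
    (hN : IsChiefFactor ⊥ N) (hNp : IsPGroup p N) [Q.Normal]
    {k : ℕ} (hQ : (centralizer (N : Set G)).relIndex Q = p ^ k) : Q ≤ centralizer (N : Set G) := by
  have hNn := hN.normal_right
  have P : Sylow p G := Classical.arbitrary _
  have hNP : N ≤ P := hNp.le_sylow_of_normal P
  have hsurj := QuotientGroup.mk'_surjective (centralizer (N : Set G))
  have hQP : Q ≤ (P : Subgroup G) ⊔ centralizer (N : Set G) := by
    have h1 : IsPGroup p (Q.map (QuotientGroup.mk' (centralizer (N : Set G)))) := by
      refine IsPGroup.of_card (n := k) ?_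
      rw [← relIndex_ker, QuotientGroup.ker_mk', hQ]
    have : (Q.map (QuotientGroup.mk' (centralizer (N : Set G)))).Normal :=
      ‹Q.Normal›.map _ hsurj
    have h2 := h1.le_sylow_of_normal (P.mapSurjective hsurj)
    rw [Sylow.coe_mapSurjective, map_le_iff_le_comap, comap_map_eq, QuotientGroup.ker_mk'] at h2
    exact h2
  obtain ⟨z, hzN, hz1, -, hzc⟩ := exists_central_mod P.isPGroup'
    (le_normalizer_of_normal (H := (⊥ : Subgroup G))) le_normalizer_of_normal hN.lt hNP
  have hz : z ∈ N ⊓ centralizer (Q : Set G) := by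
    refine ⟨hzN, mem_centralizer_iff.2 fun q hq => ?_⟩
    obtain ⟨r, hr, c, hc, rfl⟩ := mem_sup_of_normal_right.1 (hQP hq)
    have h1 := hzc r hr
    rw [mem_bot, mul_inv_eq_one, mul_inv_eq_iff_eq_mul] at h1
    rw [mul_assoc, ← mem_centralizer_iff.1 hc z hzN, ← mul_assoc, h1, mul_assoc]
  rcases hN.eq_or_eq (N ⊓ centralizer (Q : Set G)) inferInstance bot_le inf_le_left with h | h
  · rw [h] at hz; exact absurd hz hz1
  · intro q hq
    refine mem_centralizer_iff.2 fun n hn => ?_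
    have hn' : n ∈ N ⊓ centralizer (Q : Set G) := h.symm ▸ hn
    exact (mem_centralizer_iff.1 hn'.2 q hq).symm

/-- `|Q : B ⊓ Q| = |BQ : B|` divides `|G : B|`. -/
theorem relIndex_dvd_index_of_normal_right [Finite G] (B Q : Subgroup G) [Q.Normal] :
    B.relIndex Q ∣ B.index := by
  have h1 := relIndex_sup_right B Q
  have h2 := card_mul_relIndex (le_sup_right : Q ≤ B ⊔ Q)
  have h3 := card_mul_relIndex (le_sup_left : B ≤ B ⊔ Q)
  have h4 := card_mul_relIndex (inf_le_left : Q ⊓ B ≤ Q)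
  have h5 := card_mul_relIndex (inf_le_right : Q ⊓ B ≤ B)
  rw [inf_relIndex_right] at h5
  rw [inf_comm, inf_relIndex_right] at h4
  have h6 : B.relIndex Q = B.relIndex (B ⊔ Q) := by
    refine Nat.eq_of_mul_eq_mul_left (Nat.card_pos (α := B)) ?_
    rw [h3, ← h2, h1, ← h4, ← h5, inf_comm B Q]
    ring
  rw [h6]
  exact ⟨_, (relIndex_mul_index le_sup_left).symm⟩

/-- If a subgroup of index `2` in a minimal normal `2`-subgroup `N` of a `2`-soluble group has
`2`-power many conjugates, then `|N| = 2`: a normal `2'`-section would normalize it and hence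
centralize `N`. -/
theorem card_eq_two_of_index_two [Finite G] [Fact (Nat.Prime 2)] (hG : IsPSoluble 2 G)
    {N W : Subgroup G} (hN : IsChiefFactor ⊥ N) (hNp : IsPGroup 2 N) (hWN : W ≤ N)
    (hW : W.relIndex N = 2) (hi : ∃ k, (normalizer (W : Set G)).index = 2 ^ k) :
    Nat.card N = 2 := by
  have hNn := hN.normal_right
  by_cases hC : centralizer (N : Set G) = ⊤
  · have hWn : W.Normal := ⟨fun w hw g => by
      have h1 : g ∈ centralizer (N : Set G) := hC ▸ mem_top g
      rw [← mem_centralizer_iff.1 h1 w (hWN hw), mul_inv_cancel_right]; exact hw⟩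
    rcases hN.eq_or_eq W hWn bot_le hWN with h | h
    · rw [h, relIndex_bot_left] at hW; exact hW
    · rw [h, relIndex_self] at hW; omega
  · exfalso
    obtain ⟨Q, hQ, -⟩ := exists_isChiefFactor_le (lt_top_iff_ne_top.2 hC)
    have hQn := hQ.normal_right
    rcases hG _ _ hQ with ⟨k, hk⟩ | hcop
    · exact hQ.lt.not_ge (le_centralizer_of_isPGroup_section hN hNp hk)
    · have hCB : centralizer (N : Set G) ≤ normalizer (W : Set G) := by
        refine le_normalizer_iff.2 fun g hg w hw => ?_
        rw [← mem_centralizer_iff.1 hg w (hWN hw), mul_inv_cancel_right]; exact hw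
      have hQB : Q ≤ normalizer (W : Set G) := by
        obtain ⟨k, hk⟩ := hi
        have h1 := relIndex_dvd_index_of_normal_right (normalizer (W : Set G)) Q
        rw [hk] at h1
        have h2 := relIndex_dvd_of_le_left Q hCB
        exact relIndex_eq_one.1
          (Nat.eq_one_of_dvd_coprimes (Nat.Coprime.pow_right k hcop) h2 h1)
      have hcomm : ∀ q ∈ Q, ∀ n ∈ N, q * n * q⁻¹ * n⁻¹ ∈ W := by
        intro q hq n hn
        have hqn : q * n * q⁻¹ ∈ N := hNn.conj_mem n hn q
        have h1 : n ∈ W ↔ q * n * q⁻¹ ∈ W := mem_normalizer_iff.1 (hQB hq) n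
        have h2 := (mul_mem_iff_of_index_two (H := W.subgroupOf N) hW
          (a := ⟨q * n * q⁻¹, hqn⟩) (b := ⟨n, hn⟩⁻¹)).2 (by
            simp only [inv_mem_iff, mem_subgroupOf]; exact h1.symm)
        simpa [mem_subgroupOf] using h2
      have hcore : W.normalCore = ⊥ := by
        rcases hN.eq_or_eq W.normalCore inferInstance bot_le (W.normalCore_le.trans hWN) with h | h
        · exact h
        · have h1 : N ≤ W := h ▸ W.normalCore_le
          rw [relIndex_eq_one.2 h1] at hW; omega
      refine hQ.lt.not_ge fun q hq => mem_centralizer_iff.2 fun n hn => ?_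
      have h1 : q * n * q⁻¹ * n⁻¹ ∈ W.normalCore := fun g => by
        have := hcomm (g * q * g⁻¹) (hQn.conj_mem q hq g) (g * n * g⁻¹) (hNn.conj_mem n hn g)
        have e : g * (q * n * q⁻¹ * n⁻¹) * g⁻¹
          = g * q * g⁻¹ * (g * n * g⁻¹) * (g * q * g⁻¹)⁻¹ * (g * n * g⁻¹)⁻¹ := by group
        rw [e]; exact this
      rw [hcore, mem_bot, mul_inv_eq_one, mul_inv_eq_iff_eq_mul] at h1
      exact h1.symm

/-! ### Minimal normal subgroups of order `d` -/

theorem le_or_inf_eq_bot {N : Subgroup G} (hN : IsChiefFactor ⊥ N) (D : Subgroup G)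
    (hD : D.Normal) : N ≤ D ∨ N ⊓ D = ⊥ := by
  rcases hN.eq_or_eq (N ⊓ D) (normal_inf _ _ hN.normal_right hD) bot_le inf_le_left with h | h
  · exact Or.inr h
  · exact Or.inl (inf_eq_left.1 h)

theorem inf_eq_bot_of_ne {N N' : Subgroup G} (hN : IsChiefFactor ⊥ N) (hN' : IsChiefFactor ⊥ N')
    (h : N ≠ N') : N ⊓ N' = ⊥ := by
  rcases le_or_inf_eq_bot hN N' hN'.normal_right with h1 | h1
  · rcases hN'.eq_or_eq N hN.normal_right bot_le h1 with h2 | h2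
    · exact absurd h2 hN.lt.ne'
    · exact absurd h2 h
  · exact h1

theorem relIndex_sup_of_inf_eq_bot {A C : Subgroup G} [C.Normal] (h : A ⊓ C = ⊥) :
    C.relIndex (A ⊔ C) = Nat.card A := by
  rw [relIndex_sup_right, ← inf_relIndex_left, h, relIndex_bot_left]

theorem sup_zpowers_inf_eq [Finite G] {p : ℕ} [hp : Fact p.Prime] {W K : Subgroup G} {b : G}
    (hWK : W ≤ K) (hb : b ∉ K) (h : W.relIndex (W ⊔ zpowers b) = p) :
    (W ⊔ zpowers b) ⊓ K = W := by
  have h1 : W ≤ (W ⊔ zpowers b) ⊓ K := le_inf le_sup_left hWK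
  have h2 := relIndex_mul_relIndex W _ _ h1 (inf_le_left : (W ⊔ zpowers b) ⊓ K ≤ _)
  rw [h] at h2
  rcases (Nat.dvd_prime hp.out).1 (Dvd.intro _ h2) with h3 | h3
  · exact le_antisymm (relIndex_eq_one.1 h3) h1
  · rw [h3] at h2
    have h4 := relIndex_eq_one.1 (Nat.eq_of_mul_eq_mul_left hp.out.pos (h2.trans (mul_one p).symm))
    exact absurd (h4 (mem_sup_right (mem_zpowers b))).2 hb

/-- Normal subgroups with the same image modulo `C`, both meeting `C` trivially, are isomorphic
as `G`-groups; in particular they have the same centralizer. -/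
theorem centralizer_le_of_sup_eq {A B C : Subgroup G} [B.Normal] [C.Normal]
    (hB : B ⊓ C = ⊥) (h : B ≤ A ⊔ C) :
    centralizer (A : Set G) ≤ centralizer (B : Set G) := by
  intro g hg
  refine mem_centralizer_iff.2 fun b hb => ?_
  obtain ⟨a, ha, c, hc, rfl⟩ := mem_sup_of_normal_right.1 (h hb)
  have h1 : g * (a * c) * g⁻¹ * (a * c)⁻¹ ∈ B ⊓ C := by
    refine ⟨B.mul_mem (‹B.Normal›.conj_mem _ hb g) (B.inv_mem hb), ?_⟩
    have e : g * (a * c) * g⁻¹ * (a * c)⁻¹ = a * (g * c * g⁻¹ * c⁻¹) * a⁻¹ := by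
      rw [← mul_assoc g, ← mem_centralizer_iff.1 hg a ha]; group
    rw [e]
    exact ‹C.Normal›.conj_mem _ (mul_mem (‹C.Normal›.conj_mem _ hc g) (inv_mem hc)) a
  rw [hB, mem_bot, mul_inv_eq_one, mul_inv_eq_iff_eq_mul] at h1
  exact h1.symm

theorem PiHyp.exists_eq_pow_succ {p d : ℕ} [Fact p.Prime] {P : Sylow p G}
    (h : PiHyp p d G P) : ∃ l, d = p ^ (l + 1) := by
  obtain ⟨_ | l, hk⟩ := h.pow
  · exact absurd h.one_lt (by rw [hk, pow_zero]; exact lt_irrefl 1)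
  · exact ⟨l, hk⟩

/-- If `P` normalizes `H` and `H` meets the minimal normal subgroup `N` nontrivially, then `H`
covers the chief factor `D/C` of an adapted chain that is covered by `N`. -/
theorem HasPiChain.exists_cover [Finite G] {p : ℕ} [Fact p.Prime] {H N : Subgroup G}
    (hH : HasPiChain p H) (P : Sylow p G) (hP : (P : Subgroup G) ≤ normalizer (H : Set G))
    (hN : IsChiefFactor ⊥ N) (hHN : H ⊓ N ≠ ⊥) :
    ∃ C D : Subgroup G, C.Normal ∧ D.Normal ∧ N ⊓ C = ⊥ ∧ N ⊔ C = D ∧ (H ⊓ D) ⊔ C = D ∧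
      ∀ M : Subgroup G, M.Normal → C ≤ M → M ≤ D → M = C ∨ M = D := by
  obtain ⟨c, n, hc⟩ := hH
  obtain ⟨i, hi1, hi2, hi3⟩ := hc.exists_step_isChiefFactor hN
  have := hc.normal (i + 1)
  refine ⟨c i, c (i + 1), hc.normal i, this, hi2, hi3, ?_, hc.chief i⟩
  refine (hc.eq_or_eq P i (le_normalizer_inf hP le_normalizer_of_normal)).resolve_left
    fun h1 => hHN ?_
  rw [← le_bot_iff, ← hi2]
  exact le_inf inf_le_right ((inf_le_inf_left H hi1).trans (sup_eq_right.1 h1))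

/-- A minimal normal subgroup `N` of order `d` determines the others: for `N'` a second one, apply
the hypothesis to `N₁⟨t⟩`, with `N₁` of index `p` in `N` and `t ∈ N'` of order `p`. The chief factor
covering `N` must be covered by `N₁⟨t⟩`, hence by `N'`. -/
theorem card_and_centralizer_eq [Finite G] {p d : ℕ} [hp : Fact p.Prime] {P : Sylow p G}
    (h : PiHyp p d G P) (h0 : NoPrimeCore p G) (hpd : p < d) {N N' : Subgroup G}
    (hN : IsChiefFactor ⊥ N) (hNd : Nat.card N = d) (hN' : IsChiefFactor ⊥ N') :
    Nat.card N' = d ∧ centralizer (N' : Set G) = centralizer (N : Set G) := by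
  rcases eq_or_ne N' N with rfl | hne
  · exact ⟨hNd, rfl⟩
  have hNn := hN.normal_right
  have hNn' := hN'.normal_right
  have hNP := (isPGroup_of_isChiefFactor_bot h.psoluble h0 hN).le_sylow_of_normal P
  have hNP' := (isPGroup_of_isChiefFactor_bot h.psoluble h0 hN').le_sylow_of_normal P
  obtain ⟨l, hk⟩ := h.exists_eq_pow_succ
  have hpb : (P : Subgroup G) ≤ normalizer ((⊥ : Subgroup G) : Set G) := le_normalizer_of_normal
  obtain ⟨N₁, -, hN₁N, hPN₁, hN₁⟩ := exists_between_normalized P.isPGroup' hpb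
    le_normalizer_of_normal (bot_le (a := N)) hNP (k := l)
    (by rw [card_bot]; exact Nat.one_le_pow _ _ hp.out.pos)
    (by rw [hNd, hk]; exact Nat.pow_le_pow_right hp.out.pos l.le_succ)
  obtain ⟨t, htN', ht1, htp, hPt, -⟩ := exists_relIndex_eq_prime P.isPGroup' hpb
    le_normalizer_of_normal hN'.lt hNP'
  rw [mem_bot] at ht1 htp
  rw [bot_sup_eq] at hPt
  have hNN' := inf_eq_bot_of_ne hN hN' hne.symm
  have htN : t ∉ N := fun h1 => ht1 (by
    have : t ∈ N ⊓ N' := ⟨h1, htN'⟩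
    rwa [hNN', mem_bot] at this)
  have hrel := relIndex_zpowers_sup (p := p) (fun h1 => htN (hN₁N h1))
    (by rw [htp]; exact one_mem _) (hPN₁ (hNP' htN'))
  set H := N₁ ⊔ zpowers t with hH
  have hHd : Nat.card H = d := by
    rw [← card_mul_relIndex (le_sup_left : N₁ ≤ H), hrel, hN₁, hk, pow_succ]
  have hHN : H ⊓ N ≠ ⊥ := fun h1 => by
    have h2 : N₁ ≤ H ⊓ N := le_inf le_sup_left hN₁N
    rw [h1, le_bot_iff] at h2
    rw [h2, card_bot] at hN₁
    rw [hk, pow_succ, ← hN₁, one_mul] at hpd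
    exact hpd.false
  obtain ⟨C, D, hC, hD, hNC, hNCD, hcov, hchief⟩ :=
    (h.chain H (sup_le (hN₁N.trans hNP) (zpowers_le.2 (hNP' htN'))) hHd).exists_cover P
      (le_normalizer_sup hPN₁ hPt) hN hHN
  have hd : C.relIndex D = d := by rw [← hNCD, relIndex_sup_of_inf_eq_bot hNC, hNd]
  have h3 : C.relIndex (H ⊓ D) = d := by rw [← hd, ← relIndex_sup_right, hcov]
  -- so `|H| = |D : C|`, which forces `H ≤ D` and `H ⊓ C = ⊥`
  have h4 := card_mul_relIndex (inf_le_left : (H ⊓ D) ⊓ C ≤ _)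
  rw [inf_relIndex_left, h3] at h4
  have h5 := card_mul_relIndex (inf_le_left : H ⊓ D ≤ H)
  have h6 : Nat.card ((H ⊓ D) ⊓ C : Subgroup G) * (H ⊓ D).relIndex H = 1 := by
    refine Nat.eq_of_mul_eq_mul_left (zero_lt_one.trans h.one_lt) ?_
    rw [mul_one, ← mul_assoc, mul_comm d, h4, h5, hHd]
  have h7 : H ≤ D :=
    (relIndex_eq_one.1 (Nat.eq_one_of_mul_eq_one_left h6)).trans inf_le_right
  have h8 : (H ⊓ D) ⊓ C = ⊥ := card_eq_one.1 (Nat.eq_one_of_mul_eq_one_right h6)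
  have htH : t ∈ H := mem_sup_right (mem_zpowers t)
  have htC : t ∉ C := fun h1 => ht1 (by
    have : t ∈ (H ⊓ D) ⊓ C := ⟨⟨htH, h7 htH⟩, h1⟩
    rwa [h8, mem_bot] at this)
  have h9 : N' ≤ D := by
    refine (le_or_inf_eq_bot hN' _ hD).resolve_right fun h1 => ht1 ?_
    rw [← mem_bot, ← h1]
    exact ⟨htN', h7 htH⟩
  have h10 : N' ⊓ C = ⊥ :=
    (le_or_inf_eq_bot hN' _ hC).resolve_left fun h1 => htC (h1 htN')
  have h11 : N' ⊔ C = D :=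
    (hchief _ (normal_sup _ _ hNn' hC) le_sup_right
      (sup_le h9 (hNCD ▸ le_sup_right))).resolve_left fun h1 => htC (sup_eq_right.1 h1 htN')
  refine ⟨by rw [← hd, ← h11, relIndex_sup_of_inf_eq_bot h10], le_antisymm ?_ ?_⟩
  · exact centralizer_le_of_sup_eq hNC (h11 ▸ hNCD ▸ le_sup_left)
  · exact centralizer_le_of_sup_eq h10 (hNCD ▸ h9)

/-- The socle of a group: the subgroup generated by the minimal normal subgroups. -/
def socle (G : Type*) [Group G] : Subgroup G :=
  sSup {N : Subgroup G | IsChiefFactor ⊥ N}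

instance socle_normal : (socle G).Normal :=
  sSup_normal _ fun _ h => h.normal_right

theorem le_socle {N : Subgroup G} (hN : IsChiefFactor ⊥ N) : N ≤ socle G :=
  le_sSup hN

theorem socle_le_centralizer [Finite G] {p : ℕ} [Fact p.Prime] {R : Subgroup G} [R.Normal]
    (hR : IsPGroup p R) (hS : socle G ≤ R) : socle G ≤ centralizer (R : Set G) := by
  refine sSup_le fun N hN n hn => mem_centralizer_iff.2 fun r hr => ?_
  have := commutator_mem_of_isChiefFactor hR hN ((le_socle hN).trans hS) n hn r hr
  rwa [mem_bot, mul_inv_eq_one, mul_inv_eq_iff_eq_mul] at this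

theorem pow_eq_one_of_mem_socle [Finite G] {p : ℕ} [Fact p.Prime] {R : Subgroup G} [R.Normal]
    (hR : IsPGroup p R) (hS : socle G ≤ R) {x : G} (hx : x ∈ socle G) : x ^ p = 1 := by
  have hc := socle_le_centralizer hR hS
  have hcomm : ∀ a ∈ socle G, ∀ b ∈ socle G, Commute a b := fun a ha b hb =>
    mem_centralizer_iff.1 (hc hb) a (hS ha)
  let T : Subgroup G :=
    { carrier := {x | x ∈ socle G ∧ x ^ p = 1}
      one_mem' := ⟨one_mem _, one_pow p⟩
      mul_mem' := fun {a b} ha hb => ⟨mul_mem ha.1 hb.1, by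
        rw [(hcomm a ha.1 b hb.1).mul_pow, ha.2, hb.2, one_mul]⟩
      inv_mem' := fun {a} ha => ⟨inv_mem ha.1, by rw [inv_pow, ha.2, inv_one]⟩ }
  have hT : socle G ≤ T := sSup_le fun N hN n hn =>
    ⟨le_socle hN hn, mem_bot.1 (pow_mem_of_isChiefFactor
      (isPGroup_le hR ((le_socle hN).trans hS)) hN n hn)⟩
  exact (hT hx).2

/-- `L` is minimal among the normal subgroups inside `R` but not inside `S`. -/
theorem exists_minimal_normal_not_le [Finite G] {R S : Subgroup G} [R.Normal] [S.Normal]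
    (h : ¬ R ≤ S) : ∃ L : Subgroup G, L.Normal ∧ L ≤ R ∧ L ⊓ S < L ∧
      ∀ M : Subgroup G, M.Normal → M ≤ L → M = L ∨ M ≤ L ⊓ S := by
  obtain ⟨L, ⟨hLn, hLR, hLS⟩, hmin⟩ := (Set.toFinite
    {L : Subgroup G | L.Normal ∧ L ≤ R ∧ ¬ L ≤ S}).exists_minimal ⟨R, ‹_›, le_rfl, h⟩
  refine ⟨L, hLn, hLR, lt_of_le_of_ne inf_le_left fun h1 => hLS (inf_eq_left.1 h1),
    fun M hM hML => ?_⟩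
  by_cases hMS : M ≤ S
  · exact Or.inr (le_inf hML hMS)
  · exact Or.inl (le_antisymm hML (hmin ⟨hM, hML.trans hLR, hMS⟩ hML))

/-- If some minimal normal subgroup has order `d > p`, then `O_p(G)` is the socle. -/
theorem le_socle_of_card_eq [Finite G] {p d : ℕ} [hp : Fact p.Prime] {P : Sylow p G}
    (h : PiHyp p d G P) (h0 : NoPrimeCore p G) (hpd : p < d) {N : Subgroup G}
    (hN : IsChiefFactor ⊥ N) (hNd : Nat.card N = d) {R : Subgroup G} [R.Normal]
    (hR : IsPGroup p R) (hS : socle G ≤ R) : R ≤ socle G := by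
  by_contra hRS
  have hall := fun N' hN' => (card_and_centralizer_eq h h0 hpd hN hNd (N' := N') hN').1
  obtain ⟨l, hk⟩ : ∃ l, d = p ^ (l + 2) := by
    obtain ⟨_ | l, hk⟩ := h.exists_eq_pow_succ
    · rw [hk, zero_add, pow_one] at hpd; exact absurd hpd (lt_irrefl p)
    · exact ⟨l, hk⟩
  have hRP := hR.le_sylow_of_normal P
  have hRC := socle_le_centralizer hR hS
  obtain ⟨L, hLn, hLR, hKL, hmax⟩ := exists_minimal_normal_not_le hRS
  set K := L ⊓ socle G with hK
  have hKn : K.Normal := normal_inf _ _ hLn socle_normal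
  have hKS : K ≤ socle G := inf_le_right
  have hmin : ∀ D : Subgroup G, D.Normal → D ≠ ⊥ → d ≤ Nat.card D := fun D hD hD1 => by
    obtain ⟨N', hN', hND⟩ := exists_isChiefFactor_le (bot_lt_iff_ne_bot.2 hD1)
    rw [← hall N' hN']
    exact card_le_of_le hND
  have hKd : d ≤ Nat.card K := by
    obtain ⟨N', hN', hNL⟩ := exists_isChiefFactor_le (bot_le.trans_lt hKL)
    rw [← hall N' hN']
    exact card_le_of_le (le_inf hNL (le_socle hN'))
  obtain ⟨b, hbL, hbK, hbp, hPX, hrel⟩ := exists_relIndex_eq_prime P.isPGroup'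
    le_normalizer_of_normal le_normalizer_of_normal hKL (hLR.trans hRP)
  have hXL : K ⊔ zpowers b ≤ L := sup_le hKL.le (zpowers_le.2 hbL)
  have hXp : IsPGroup p (K ⊔ zpowers b : Subgroup G) := isPGroup_le hR (hXL.trans hLR)
  have hXb : K ⊔ zpowers b ≤ centralizer {b} := by
    refine sup_le (fun x hx => mem_centralizer_singleton_iff.2 ?_)
      (zpowers_le.2 (mem_centralizer_singleton_iff.2 rfl))
    exact (mem_centralizer_iff.1 (hRC (hKS hx)) b (hLR hbL)).symm
  have hLeq : K ⊔ zpowers b = L := by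
    have hcard : Nat.card (zpowers b) ≤ p ^ (l + 2) := by
      rw [Nat.card_zpowers]
      have h1 : b ^ (p ^ 2) = 1 := by
        rw [sq, pow_mul]; exact pow_eq_one_of_mem_socle hR hS (hKS hbp)
      exact (orderOf_le_of_pow_eq_one (pow_pos hp.out.pos 2) h1).trans
        (Nat.pow_le_pow_right hp.out.pos (Nat.le_add_left 2 l))
    obtain ⟨H, hbH, hHX, -, hHd⟩ := exists_between_normalized hXp
      (le_normalizer_iff.2 fun x hx y hy => by
        obtain ⟨j, rfl⟩ := mem_zpowers_iff.1 hy
        have h1 : Commute x b := mem_centralizer_singleton_iff.1 (hXb hx)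
        rw [(h1.zpow_right j).eq, mul_inv_cancel_right]; exact hy)
      le_normalizer (le_sup_right : zpowers b ≤ K ⊔ zpowers b) le_rfl hcard
      (by rw [← hk]; exact hKd.trans (card_le_of_le le_sup_left))
    have hHK : H ⊔ K = K ⊔ zpowers b :=
      le_antisymm (sup_le hHX le_sup_left) (sup_le le_sup_right (hbH.trans le_sup_left))
    rw [← hHK]
    exact sup_eq_of_unique_maximal P hKL hmax (hHX.trans hXL)
      (fun h1 => hbK (h1 (hbH (mem_zpowers b)))) (hHK ▸ hPX)
      (h.chain H (hHX.trans (hXL.trans (hLR.trans hRP))) (hHd.trans hk.symm))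
  -- `⟨b ^ p⟩` consists of the `p`-th powers of elements of `L`, so it is normal; its order is at
  -- most `p`
  have hb1 : b ^ p = 1 := by
    have hn : (zpowers (b ^ p)).Normal := ⟨fun y hy g => by
      obtain ⟨j, rfl⟩ := mem_zpowers_iff.1 hy
      rw [← conj_zpow]
      refine zpow_mem ?_ j
      rw [← conj_pow]
      have h1 := hLn.conj_mem b hbL g
      rw [← hLeq] at h1
      obtain ⟨x, hx, z, hz, hxz⟩ := mem_sup_of_normal_left.1 h1
      obtain ⟨i, rfl⟩ := mem_zpowers_iff.1 hz
      have h2 : Commute x b := mem_centralizer_singleton_iff.1 (hXb (mem_sup_left hx))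
      rw [← hxz, (h2.zpow_right i).mul_pow, pow_eq_one_of_mem_socle hR hS (hKS hx), one_mul,
        ← zpow_natCast (b ^ i), zpow_comm, zpow_natCast]
      exact zpow_mem (mem_zpowers _) i⟩
    by_contra hne
    have h1 := hmin _ hn (by rwa [Ne, zpowers_eq_bot])
    rw [Nat.card_zpowers] at h1
    have h2 := orderOf_le_of_pow_eq_one hp.out.pos (pow_eq_one_of_mem_socle hR hS (hKS hbp))
    omega
  obtain ⟨W, -, hWK, hPW, hW⟩ := exists_between_normalized P.isPGroup'
    le_normalizer_of_normal le_normalizer_of_normal (bot_le (a := K))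
    (hKL.le.trans (hLR.trans hRP)) (k := l + 1)
    (by rw [card_bot]; exact Nat.one_le_pow _ _ hp.out.pos)
    ((Nat.pow_le_pow_right hp.out.pos (l + 1).le_succ).trans (hk ▸ hKd))
  have hWrel := relIndex_zpowers_sup (p := p) (fun h1 => hbK (hWK h1))
    (by rw [hb1]; exact one_mem _) (hPW (hRP (hLR hbL)))
  have hWb := sup_zpowers_inf_eq hWK hbK hWrel
  have hHL : W ⊔ zpowers b ≤ L := sup_le (hWK.trans hKL.le) (zpowers_le.2 hbL)
  obtain ⟨c, n, hc⟩ := h.chain (W ⊔ zpowers b) (hHL.trans (hLR.trans hRP)) (by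
    rw [← card_mul_relIndex (le_sup_left : W ≤ W ⊔ zpowers b), hWrel, hW, hk, ← pow_succ])
  obtain ⟨i, hi1, hi2⟩ := hc.exists_step (L := L) (bot_le.trans_lt hKL).ne'
  have hLi : L ⊓ c i ≤ K := (hmax _ (normal_inf _ _ hLn (hc.normal i)) inf_le_left).resolve_left
    fun h1 => hi2 (inf_eq_left.1 h1)
  -- the step of the chain covering `L` covers exactly `L/K`
  have hKi : K ≤ c i := by
    rcases hc.chief i (K ⊔ c i) (normal_sup _ _ hKn (hc.normal i)) le_sup_right
      (sup_le (hKL.le.trans hi1) (hc.le_succ i)) with h1 | h1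
    · exact sup_eq_right.1 h1
    · have := hc.normal i
      have h2 : L ≤ K := by
        have h3 := sup_inf_eq (B := c i) hKL.le
        rw [h1, inf_eq_right.2 hi1, inf_comm, sup_eq_left.2 hLi] at h3
        exact h3.le
      exact absurd h2 hKL.not_ge
  have hChief : ChiefOrder d (socle G) := fun Y Z hYZ hZ => by
    obtain ⟨N', hN', h1⟩ := exists_generator_of_isChiefFactor (fun _ h => h) hYZ hZ
    rw [h1, hall N' hN']
  obtain ⟨e, he⟩ := card_inf_eq_pow hc hChief (hWK.trans hKS) i fun j hj => by
    have h1 : (W ⊔ zpowers b) ⊓ c (j + 1) = W ⊓ c (j + 1) := by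
      refine le_antisymm (le_inf ?_ inf_le_right) (inf_le_inf_right _ le_sup_left)
      exact (le_inf inf_le_left ((inf_le_inf hHL (hc.mono (Nat.succ_le_of_lt hj))).trans
        hLi)).trans hWb.le
    have := hc.normal (j + 1)
    rw [← h1]
    exact hc.eq_or_eq P j (h1 ▸ le_normalizer_inf hPW le_normalizer_of_normal)
  rw [inf_eq_left.2 (hWK.trans hKi), hW, hk, ← pow_mul] at he
  have h1 := Nat.pow_right_injective hp.out.two_le he
  rcases e with _ | e
  · omega
  · rw [mul_add] at h1; omega

/-- If some minimal normal subgroup has order `d > p`, then the Sylow subgroup is normal. -/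
theorem pLengthLeOne_of_card_eq [Finite G] {p d : ℕ} [hp : Fact p.Prime] {P : Sylow p G}
    (h : PiHyp p d G P) (h0 : NoPrimeCore p G) (hpd : p < d) {N : Subgroup G}
    (hN : IsChiefFactor ⊥ N) (hNd : Nat.card N = d) : PLengthLeOne p G := by
  have hall := fun N' hN' => (card_and_centralizer_eq h h0 hpd hN hNd (N' := N') hN').2
  have := hN.normal_right
  obtain ⟨l, hk⟩ := h.exists_eq_pow_succ
  obtain ⟨R, hRn, hR, hRmax⟩ := exists_largest_normal_pGroup (G := G) p
  have hSR : socle G ≤ R := sSup_le fun N' hN' => hRmax _ hN'.normal_right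
    (isPGroup_of_isChiefFactor_bot h.psoluble h0 hN')
  have hRS : R = socle G := le_antisymm (le_socle_of_card_eq h h0 hpd hN hNd hR hSR) hSR
  subst hRS
  have hSP := hR.le_sylow_of_normal P
  by_cases hPS : (P : Subgroup G) ≤ socle G
  · exact pLengthLeOne_of_normal_sylow P (normal_sylow_of_isPGroup_normal P socle_normal hR hPS)
  exfalso
  have hSC := socle_le_centralizer hR le_rfl
  have hCS := centralizer_le_of_noPrimeCore h.psoluble h0 hR hRmax
  have hCN : centralizer (N : Set G) ≤ socle G := by
    refine le_trans (le_centralizer_iff.1 (sSup_le fun N' hN' => ?_)) hCS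
    rw [← hall N' hN']
    exact le_centralizer_iff.1 le_rfl
  obtain ⟨L, hL, -⟩ := exists_isChiefFactor_le (K := socle G) (L := ⊤)
    (lt_top_iff_ne_top.2 fun h1 => hPS (h1 ▸ le_top))
  have hLn := hL.normal_right
  have hcop := (isPGroup_or_coprime_of_isChiefFactor h.psoluble hL hR).resolve_left
    fun h1 => hL.lt.not_ge (hRmax L hLn h1)
  obtain ⟨M, hSM, hSM'⟩ := exists_complement_top (S := socle G) (K := L)
    (fun a ha b hb => mem_centralizer_iff.1 (hSC hb) a ha) hL.lt.le
    (coprime_of_isPGroup hR hcop) fun s hs hsL => by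
      by_contra hs1
      have hne : socle G ⊓ centralizer (L : Set G) ≠ ⊥ := fun h1 => hs1 (by
        rw [← mem_bot, ← h1]; exact ⟨hs, mem_centralizer_iff.2 hsL⟩)
      obtain ⟨N', hN', hNL⟩ := exists_isChiefFactor_le (bot_lt_iff_ne_bot.2 hne)
      refine hL.lt.not_ge ((le_centralizer_iff.1 (hNL.trans inf_le_right)).trans ?_)
      rw [hall N' hN']
      exact hCN
  have hPM : socle G ⊔ (M ⊓ P) = P := by rw [← sup_inf_eq' hSP, hSM', top_inf_eq]
  obtain ⟨t, htM, ht1, htp, -⟩ := exists_relIndex_eq_prime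
    (isPGroup_le P.isPGroup' (inf_le_right : M ⊓ P ≤ P))
    (le_normalizer_of_normal (H := (⊥ : Subgroup G))) le_normalizer
    (bot_lt_iff_ne_bot.2 fun h1 => hPS (by rw [← hPM, h1, sup_bot_eq])) le_rfl
  rw [mem_bot] at ht1 htp
  have htS : t ∉ socle G := fun h1 => ht1 (by rw [← mem_bot, ← hSM]; exact ⟨h1, htM.1⟩)
  obtain ⟨N₁, -, hN₁N, hPN₁, hN₁⟩ := exists_between_normalized P.isPGroup'
    le_normalizer_of_normal le_normalizer_of_normal (bot_le (a := N))
    ((le_socle hN).trans hSP) (k := l)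
    (by rw [card_bot]; exact Nat.one_le_pow _ _ hp.out.pos)
    (by rw [hNd, hk]; exact Nat.pow_le_pow_right hp.out.pos l.le_succ)
  have hN₁S := hN₁N.trans (le_socle hN)
  have hrel := relIndex_zpowers_sup (p := p) (fun h1 => htS (hN₁S h1))
    (by rw [htp]; exact one_mem _) (hPN₁ htM.2)
  have hHS := sup_zpowers_inf_eq hN₁S htS hrel
  obtain ⟨c, n, hc⟩ := h.chain (N₁ ⊔ zpowers t) (sup_le (hN₁S.trans hSP) (zpowers_le.2 htM.2)) (by
    rw [← card_mul_relIndex (le_sup_left : N₁ ≤ N₁ ⊔ zpowers t), hrel, hN₁, hk, pow_succ])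
  obtain ⟨i, hi1, hi2, hi3⟩ := hc.exists_step_isChiefFactor hN
  -- a normal subgroup that does not contain the socle centralizes a minimal normal subgroup
  have hcS : c i ≤ socle G := by
    by_contra hcS
    have h1 : socle G ≤ c i := sSup_le fun N' hN' => by
      refine (le_or_inf_eq_bot hN' _ (hc.normal i)).resolve_right fun h1 => hcS ?_
      refine le_trans ?_ ((hall N' hN').le.trans hCN)
      have := hN'.normal_right
      have := hc.normal i
      intro x hx
      refine mem_centralizer_iff.2 fun y hy => ?_
      exact commute_of_normal_of_disjoint N' (c i) ‹_› ‹_› (disjoint_iff.2 h1) y x hy hx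
    have h2 : N ≤ N ⊓ c i := le_inf le_rfl ((le_socle hN).trans h1)
    rw [hi2] at h2
    exact hN.lt.not_ge h2
  have hcS' : c (i + 1) ≤ socle G := hi3 ▸ sup_le (le_socle hN) hcS
  have h1 : (N₁ ⊔ zpowers t) ⊓ c (i + 1) = N₁ :=
    le_antisymm ((inf_le_inf_left _ hcS').trans hHS.le) (le_inf le_sup_left (hN₁N.trans hi1))
  have h2 := hc.eq_or_eq P i (h1.symm ▸ hPN₁)
  rw [h1] at h2
  rcases h2 with h2 | h2
  · have h3 : N₁ ≤ N ⊓ c i := le_inf hN₁N (sup_eq_right.1 h2)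
    rw [hi2, le_bot_iff] at h3
    rw [h3, card_bot] at hN₁
    rw [hk, pow_succ, ← hN₁, one_mul] at hpd
    exact hpd.false
  · have := hc.normal i
    have h3 := sup_inf_eq (B := c i) hN₁N
    rw [h2, inf_eq_right.2 hi1, inf_comm, hi2, sup_bot_eq] at h3
    rw [← h3, hNd, hk] at hN₁
    exact absurd (Nat.pow_right_injective hp.out.two_le hN₁) (by omega)

/-! ### Minimal normal subgroups of order less than `d` -/

/-- Dedekind's modular law when `AB` is a subgroup. -/
theorem sup_inf_eq_of_le_normalizer {A B C : Subgroup G} (h : A ≤ C)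
    (hn : B ≤ normalizer (A : Set G)) : (A ⊔ B) ⊓ C = A ⊔ (B ⊓ C) := by
  refine le_antisymm (fun x hx => ?_)
    (sup_le (le_inf le_sup_left h) (inf_le_inf_right C le_sup_right))
  have hx1 : x ∈ ((A ⊔ B : Subgroup G) : Set G) := hx.1
  rw [coe_mul_of_right_le_normalizer_left A B hn] at hx1
  obtain ⟨a, ha, b, hb, rfl⟩ := Set.mem_mul.1 hx1
  exact mul_mem (mem_sup_left ha) (mem_sup_right ⟨hb, (mul_mem_cancel_left (h ha)).1 hx.2⟩)

theorem card_sup_of_le_normalizer {N W B : Subgroup G} [N.Normal] (hWN : W ≤ N)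
    (hn : B ≤ normalizer (W : Set G)) (hB : B ⊓ N ≤ W) :
    (W ⊔ B) ⊓ N = W ∧ Nat.card (W ⊔ B : Subgroup G) = Nat.card W * N.relIndex B := by
  have h1 : (W ⊔ B) ⊓ N = W := by
    rw [sup_inf_eq_of_le_normalizer hWN hn, sup_eq_left.2 hB]
  refine ⟨h1, ?_⟩
  rw [← card_mul_relIndex (inf_le_left : (W ⊔ B) ⊓ N ≤ W ⊔ B), inf_relIndex_left, h1,
    ← relIndex_sup_right (W ⊔ B) N, sup_right_comm, sup_eq_right.2 hWN, sup_comm N B,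
    relIndex_sup_right]

theorem relIndex_of_inf_eq_bot {N B : Subgroup G} (h : B ⊓ N = ⊥) :
    N.relIndex B = Nat.card B := by
  rw [← inf_relIndex_left, h, relIndex_bot_left]

theorem commute_of_isChiefFactor_bot [Finite G] {p : ℕ} [Fact p.Prime] {N : Subgroup G}
    (hN : IsChiefFactor ⊥ N) (hNp : IsPGroup p N) : ∀ a ∈ N, ∀ b ∈ N, a * b = b * a := by
  have := hN.normal_right
  intro a ha b hb
  have := commutator_mem_of_isChiefFactor hNp hN le_rfl b hb a ha
  rwa [mem_bot, mul_inv_eq_one, mul_inv_eq_iff_eq_mul] at this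

theorem commute_of_card_eq_two {N : Subgroup G} (hN : N.Normal) (h : Nat.card N = 2) :
    ∀ n ∈ N, ∀ g : G, g * n = n * g := by
  intro n hn g
  rcases eq_or_ne n 1 with rfl | hn1
  · rw [mul_one, one_mul]
  obtain ⟨y, -, hy⟩ := (Nat.card_eq_two_iff' (1 : N)).1 h
  have h1 := hy ⟨n, hn⟩ fun h => hn1 (congrArg Subtype.val h)
  have h2 := hy ⟨g * n * g⁻¹, hN.conj_mem n hn g⟩ fun h => hn1 (by
    have h3 : g * n * g⁻¹ = 1 := congrArg Subtype.val h
    rwa [mul_inv_eq_one, mul_eq_left] at h3)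
  have h3 : g * n * g⁻¹ = n := congrArg Subtype.val (h2.trans h1.symm)
  exact mul_inv_eq_iff_eq_mul.1 h3

theorem exists_normalized_card [Finite G] {p : ℕ} [hp : Fact p.Prime] {R N : Subgroup G}
    (hR : IsPGroup p R) (hN : R ≤ normalizer (N : Set G)) (hNR : N ≤ R) {k : ℕ}
    (h : p ^ k ≤ Nat.card N) :
    ∃ X ≤ N, R ≤ normalizer (X : Set G) ∧ Nat.card X = p ^ k := by
  obtain ⟨X, -, h1⟩ := exists_between_normalized hR
    (le_normalizer_of_normal (H := (⊥ : Subgroup G))) hN bot_le hNR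
    (by rw [card_bot]; exact Nat.one_le_pow _ _ hp.out.pos) h
  exact ⟨X, h1⟩

/-- Otherwise a subgroup of `N` of order `d` normalized by `P` has order a power of `|N|`. -/
theorem card_le_of_isChiefFactor_bot [Finite G] {p d : ℕ} [Fact p.Prime] {P : Sylow p G}
    (h : PiHyp p d G P) (h0 : NoPrimeCore p G) {N : Subgroup G} (hN : IsChiefFactor ⊥ N) :
    Nat.card N ≤ d := by
  by_contra! hlt
  have := hN.normal_right
  have hNP := (isPGroup_of_isChiefFactor_bot h.psoluble h0 hN).le_sylow_of_normal P
  obtain ⟨l, hl⟩ := h.exists_eq_pow_succ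
  obtain ⟨H, hHN, hPH, hH⟩ := exists_normalized_card P.isPGroup' le_normalizer_of_normal hNP
    (hl ▸ hlt.le)
  rw [← hl] at hH
  obtain ⟨e, he⟩ := card_eq_pow_of_chiefOrder P (chiefOrder_of_isChiefFactor hN) hHN
    (h.chain H (hHN.trans hNP) hH) hPH
  rw [hH] at he
  have hd := h.one_lt
  rcases e with _ | e
  · rw [pow_zero] at he; omega
  · have := Nat.le_self_pow (Nat.add_one_ne_zero e) (Nat.card N)
    omega

/-- In a chain adapted to `H`, a unique minimal normal subgroup is the first proper term. -/
theorem HasPiChain.index_normalizer_inf [Finite G] {p : ℕ} {H N : Subgroup G}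
    (hH : HasPiChain p H) (hN : IsChiefFactor ⊥ N)
    (hu : ∀ N', IsChiefFactor ⊥ N' → N' = N) :
    ∃ k, (normalizer ((H ⊓ N : Subgroup G) : Set G)).index = p ^ k := by
  obtain ⟨c, n, hc⟩ := hH
  obtain ⟨i, -, hi2, hi3⟩ := hc.exists_step_isChiefFactor hN
  have hi : c i = ⊥ := by
    by_contra hne
    have := hc.normal i
    obtain ⟨N', hN', hle⟩ := exists_isChiefFactor_le (bot_lt_iff_ne_bot.2 hne)
    rw [hu N' hN'] at hle
    exact hN.lt.ne' (inf_eq_left.2 hle ▸ hi2)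
  have h1 := hc.index i
  rwa [← hi3, hi, sup_bot_eq, sup_bot_eq] at h1

/-- A minimal normal `2`-subgroup of order `d/2 ≥ 4` admits no second minimal normal subgroup of
order at least `4`: it would have the same order `d/2`, but then `d` would be a power of `d/2`. -/
theorem false_of_two_large [Finite G] [Fact (Nat.Prime 2)] {d : ℕ} {P : Sylow 2 G}
    (h : PiHyp 2 d G P) (h0 : NoPrimeCore 2 G) {N N' : Subgroup G} (hN : IsChiefFactor ⊥ N)
    (hd : d = 2 * Nat.card N) (hN4 : 4 ≤ Nat.card N) (hN' : IsChiefFactor ⊥ N') (hne : N ≠ N')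
    (hN'4 : 4 ≤ Nat.card N') : False := by
  have hNn := hN.normal_right
  have hNn' := hN'.normal_right
  have hNp := isPGroup_of_isChiefFactor_bot h.psoluble h0 hN
  have hNp' := isPGroup_of_isChiefFactor_bot h.psoluble h0 hN'
  have hNP := hNp.le_sylow_of_normal P
  have hNP' := hNp'.le_sylow_of_normal P
  have hNN' := inf_eq_bot_of_ne hN hN' hne
  obtain ⟨a, ha⟩ := hNp.exists_card_eq
  obtain ⟨a, rfl⟩ : ∃ b, a = b + 2 := ⟨a - 2, by
    rcases a with _ | _ | a
    · omega
    · omega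
    · rfl⟩
  obtain ⟨N₁, hN₁N, hPN₁, hN₁⟩ := exists_normalized_card (k := a + 1) P.isPGroup'
    le_normalizer_of_normal hNP (by rw [ha]; exact Nat.pow_le_pow_right two_pos (Nat.le_succ _))
  obtain ⟨B, hBN', hPB, hB⟩ := exists_normalized_card (k := 2) P.isPGroup'
    le_normalizer_of_normal hNP' hN'4
  have hBN : B ⊓ N = ⊥ := by
    rw [← le_bot_iff, ← hNN', inf_comm]; exact inf_le_inf_left N hBN'
  have hBP := hBN'.trans hNP'
  obtain ⟨hHN, hHc⟩ := card_sup_of_le_normalizer hN₁N (hBP.trans hPN₁) (hBN.trans_le bot_le)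
  rw [relIndex_of_inf_eq_bot hBN, hN₁, hB] at hHc
  have hHd : Nat.card (N₁ ⊔ B : Subgroup G) = d := by rw [hHc, hd, ha]; ring
  have hch := h.chain _ (sup_le (hN₁N.trans hNP) hBP) hHd
  have hPH := le_normalizer_sup hPN₁ hPB
  set H := N₁ ⊔ B with hH
  have hN₁1 : N₁ ≠ ⊥ := fun h1 => by
    rw [h1, card_bot, pow_succ] at hN₁; omega
  obtain ⟨C, D, hC, hD, hNC, hNCD, hcov, hchief⟩ := hch.exists_cover P hPH hN (hHN ▸ hN₁1)
  have hCD : C.relIndex D = Nat.card N := by rw [← hNCD, relIndex_sup_of_inf_eq_bot hNC]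
  have h3 : C.relIndex (H ⊓ D) = Nat.card N := by rw [← hCD, ← relIndex_sup_right, hcov]
  -- `|H| = 2|D : C|`, so the part of `H` in `C` and its index outside `D` are at most `2`
  have h4 := card_mul_relIndex (inf_le_left : (H ⊓ D) ⊓ C ≤ _)
  rw [inf_relIndex_left, h3] at h4
  have h5 := card_mul_relIndex (inf_le_left : H ⊓ D ≤ H)
  have h6 : Nat.card ((H ⊓ D) ⊓ C : Subgroup G) * (H ⊓ D).relIndex H = 2 := by
    refine Nat.eq_of_mul_eq_mul_left (show 0 < Nat.card N by omega) ?_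
    rw [← mul_assoc, mul_comm (Nat.card N), h4, h5, hHd, hd, mul_comm]
  have hBH : B ≤ H := le_sup_right
  have h7 : B ⊓ D ≠ ⊥ := fun h1 => by
    have h8 : Nat.card B ∣ (H ⊓ D).relIndex H := by
      have h9 := card_mul_relIndex (inf_le_left : H ⊓ D ≤ H)
      have : D.relIndex B ∣ D.relIndex H := by
        rw [← relIndex_sup_right B D, ← relIndex_sup_right H D]
        exact Dvd.intro _ (relIndex_mul_relIndex D _ _ le_sup_right (sup_le_sup_right hBH D))
      rwa [relIndex_of_inf_eq_bot h1, ← inf_relIndex_left] at this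
    have := Nat.le_of_dvd two_pos (h8.trans (Dvd.intro_left _ h6))
    omega
  have h8 : N' ≤ D := (le_or_inf_eq_bot hN' D hD).resolve_right fun h1 => h7 (by
    rw [← le_bot_iff, ← h1]; exact inf_le_inf_right D hBN')
  have h9 : ¬ N' ≤ C := fun h1 => by
    have h10 : B ≤ (H ⊓ D) ⊓ C := le_inf (le_inf hBH (hBN'.trans h8)) (hBN'.trans h1)
    have := card_le_of_le h10
    have := Nat.le_of_dvd two_pos (Dvd.intro _ h6)
    omega
  have h10 : N' ⊔ C = D := (hchief _ (normal_sup _ _ hNn' hC) le_sup_right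
    (sup_le h8 (hNCD ▸ le_sup_right))).resolve_left fun h1 => h9 (sup_eq_right.1 h1)
  have h11 : Nat.card N' = Nat.card N := by
    rw [← hCD, ← h10, relIndex_sup_of_inf_eq_bot ((le_or_inf_eq_bot hN' C hC).resolve_left h9)]
  have hK : ChiefOrder (Nat.card N) (sSup {N, N'}) := fun Y Z hYZ hZ => by
    obtain ⟨X, hX, h12⟩ := exists_generator_of_isChiefFactor (𝒩 := {N, N'})
      (by rintro X (rfl | rfl); exacts [hN, hN']) hYZ hZ
    rcases hX with rfl | rfl
    exacts [h12, h12.trans h11]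
  have hKn : (sSup {N, N'} : Subgroup G).Normal :=
    sSup_normal _ (by rintro X (rfl | rfl); exacts [hNn, hNn'])
  obtain ⟨e, he⟩ := card_eq_pow_of_chiefOrder P hK
    (sup_le (hN₁N.trans (le_sSup (Or.inl rfl))) (hBN'.trans (le_sSup (Or.inr rfl)))) hch hPH
  rw [hHd, hd] at he
  rcases e with _ | _ | e
  · rw [pow_zero] at he; omega
  · rw [zero_add, pow_one] at he; omega
  · have h12 : Nat.card N * Nat.card N ≤ Nat.card N ^ (e + 2) := by
      rw [← sq]; exact Nat.pow_le_pow_right (by omega) (by omega)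
    nlinarith

/-- If `N` is the unique minimal normal subgroup of a `2`-soluble group, of order `d/2 ≥ 4`, then
`P/N` has exponent at most `2`: if `x² ∉ N` and `x⁴ ∈ N`, then for a suitable subgroup `W` of index
`2` in `N` the hypothesis applies to `W⟨x⟩`, which meets `N` in `W`. -/
theorem sq_mem_of_unique [Finite G] [Fact (Nat.Prime 2)] {d : ℕ} {P : Sylow 2 G}
    (h : PiHyp 2 d G P) (h0 : NoPrimeCore 2 G) {N : Subgroup G} (hN : IsChiefFactor ⊥ N)
    (hu : ∀ N', IsChiefFactor ⊥ N' → N' = N)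
    (hd : d = 2 * Nat.card N) (hN4 : 4 ≤ Nat.card N) : ∀ x ∈ (P : Subgroup G), x ^ 2 ∈ N := by
  have hNn := hN.normal_right
  have hNp := isPGroup_of_isChiefFactor_bot h.psoluble h0 hN
  have hNP := hNp.le_sylow_of_normal P
  obtain ⟨a, ha⟩ := hNp.exists_card_eq
  obtain ⟨a, rfl⟩ : ∃ b, a = b + 2 := ⟨a - 2, by
    rcases a with _ | _ | a
    · omega
    · omega
    · rfl⟩
  -- it suffices to exclude elements of order `4` modulo `N`
  suffices key : ∀ x ∈ (P : Subgroup G), x ^ 4 ∈ N → x ^ 2 ∈ N by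
    intro x hx
    obtain ⟨m, hm⟩ := P.isPGroup' ⟨x, hx⟩
    have hm' : x ^ 2 ^ m = 1 := congrArg Subtype.val hm
    have hall : ∀ m, x ^ 2 ^ (m + 1) ∈ N → x ^ 2 ∈ N := by
      intro m
      induction m with
      | zero => intro h1; simpa using h1
      | succ m ih =>
        intro h1
        refine ih ?_
        have h2 := key (x ^ 2 ^ m) (pow_mem hx _) (by
          rw [← pow_mul]; convert h1 using 2; ring)
        rwa [← pow_mul, ← pow_succ] at h2
    exact hall m (by rw [pow_succ, pow_mul, hm', one_pow]; exact one_mem N)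
  intro x hx h4
  by_contra h2
  have hcomm := commute_of_isChiefFactor_bot hN hNp
  have hTP : N ⊔ zpowers x ≤ P := sup_le hNP (zpowers_le.2 hx)
  have hT : IsPGroup 2 (N ⊔ zpowers x : Subgroup G) := isPGroup_le P.isPGroup' hTP
  have hcard4 : Nat.card (zpowers (x ^ 4)) ≤ 2 ^ (a + 1) := by
    have h5 : (x ^ 4) ^ 2 = 1 := mem_bot.1 (pow_mem_of_isChiefFactor hNp hN _ h4)
    rw [Nat.card_zpowers]
    exact (orderOf_le_of_pow_eq_one two_pos h5).trans (Nat.le_self_pow a.succ_ne_zero 2)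
  obtain ⟨W, h4W, hWN, hTW, hW⟩ := exists_between_normalized hT
    (A := zpowers (x ^ 4)) (B := N) (le_normalizer_iff.2 fun y hy z hz => by
      have h5 : N ⊔ zpowers x ≤ centralizer {x ^ 4} :=
        sup_le (fun n hn => mem_centralizer_singleton_iff.2 (hcomm _ hn _ h4))
          (zpowers_le.2 (mem_centralizer_singleton_iff.2 ((Commute.refl x).pow_right 4)))
      obtain ⟨j, rfl⟩ := mem_zpowers_iff.1 hz
      have h6 : Commute y (x ^ 4) := mem_centralizer_singleton_iff.1 (h5 hy)
      rw [(h6.zpow_right j).eq, mul_inv_cancel_right]; exact hz)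
    le_normalizer_of_normal (zpowers_le.2 h4) le_sup_left hcard4
    (by rw [ha]; exact Nat.pow_le_pow_right two_pos (Nat.le_succ _))
  have hord : orderOf (QuotientGroup.mk' N x) = 2 ^ (1 + 1) := by
    refine orderOf_eq_prime_pow (fun h5 => h2 ?_) ?_
    · rw [← map_pow] at h5
      simpa using (QuotientGroup.eq_one_iff _).1 h5
    · rw [← map_pow]
      exact (QuotientGroup.eq_one_iff _).2 h4
  have hxN : zpowers x ⊓ N ≤ W := by
    rintro _ ⟨hy, hyN⟩
    obtain ⟨j, rfl⟩ := mem_zpowers_iff.1 hy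
    have h5 : (QuotientGroup.mk' N x) ^ j = 1 := by
      rw [← map_zpow]; exact (QuotientGroup.eq_one_iff _).2 hyN
    obtain ⟨i, rfl⟩ := orderOf_dvd_iff_zpow_eq_one.2 h5
    rw [hord, zpow_mul, zpow_natCast]
    exact h4W (zpow_mem (mem_zpowers _) i)
  obtain ⟨hHN, hHc⟩ := card_sup_of_le_normalizer hWN
    ((le_sup_right : zpowers x ≤ N ⊔ zpowers x).trans hTW) hxN
  have hrel : N.relIndex (zpowers x) = 4 := by
    have h5 : Nat.card ((zpowers x).map (QuotientGroup.mk' N)) = 4 := by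
      rw [MonoidHom.map_zpowers, Nat.card_zpowers, hord]; rfl
    rwa [← relIndex_ker, QuotientGroup.ker_mk'] at h5
  obtain ⟨k, hk⟩ := (h.chain (W ⊔ zpowers x)
    (sup_le (hWN.trans hNP) (zpowers_le.2 hx)) (by rw [hHc, hrel, hW, hd, ha]; ring)
    ).index_normalizer_inf hN hu
  rw [hHN] at hk
  have hWrel : W.relIndex N = 2 := by
    refine Nat.eq_of_mul_eq_mul_left (Nat.card_pos (α := W)) ?_
    rw [card_mul_relIndex hWN, ha, hW, ← pow_succ]
  have := card_eq_two_of_index_two h.psoluble hN hNp hWN hWrel ⟨k, hk⟩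
  omega

/-- A unique minimal normal subgroup of order less than `d` has no complement: with `N₁` of index
`p` in `N` and `B` in a complement, the hypothesis applied to `N₁B` shows that `N₁` is normal, so
`N` has order `p` and is centralized by `P`, whereas a complement acts faithfully on `N`. -/
theorem false_of_unique_of_complement [Finite G] {p d : ℕ} [hp : Fact p.Prime] {P : Sylow p G}
    (h : PiHyp p d G P) (h0 : NoPrimeCore p G) {N M : Subgroup G} (hN : IsChiefFactor ⊥ N)
    (hu : ∀ N', IsChiefFactor ⊥ N' → N' = N) (hNd : Nat.card N < d)
    (hNM : N ⊓ M = ⊥) (hNM' : N ⊔ M = ⊤) : False := by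
  have hNn := hN.normal_right
  have hNp := isPGroup_of_isChiefFactor_bot h.psoluble h0 hN
  have hNP := hNp.le_sylow_of_normal P
  obtain ⟨k, hk⟩ := h.pow
  obtain ⟨a, ha⟩ := hNp.exists_card_eq
  obtain ⟨a, rfl⟩ : ∃ b, a = b + 1 := ⟨a - 1, by
    rcases a with _ | a
    · rw [pow_zero, card_eq_one] at ha; exact absurd ha hN.lt.ne'
    · rfl⟩
  have hak : a + 1 < k := (Nat.pow_lt_pow_iff_right hp.out.one_lt).1 (by rwa [← ha, ← hk])
  have hPM : N ⊔ (M ⊓ P) = P := by rw [← sup_inf_eq' hNP, hNM', top_inf_eq]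
  have hdisj : (M ⊓ P) ⊓ N = ⊥ := by
    rw [← le_bot_iff, ← hNM, inf_comm]; exact inf_le_inf_left N inf_le_left
  have hMP : IsPGroup p (M ⊓ P : Subgroup G) := isPGroup_le P.isPGroup' inf_le_right
  have hPcard : Nat.card P = Nat.card N * Nat.card (M ⊓ P : Subgroup G) := by
    have h1 := (card_sup_of_le_normalizer (N := N) le_rfl (le_normalizer_of_normal (K := M ⊓ P))
      (hdisj.trans_le bot_le)).2
    rwa [hPM, relIndex_of_inf_eq_bot hdisj] at h1
  obtain ⟨b, hb⟩ := hMP.exists_card_eq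
  have hkb : k < a + 1 + b := by
    refine (Nat.pow_lt_pow_iff_right hp.out.one_lt).1 ?_
    rw [← hk, pow_add, ← ha, ← hb, ← hPcard]
    exact h.lt_card
  obtain ⟨B, hBM, -, hB⟩ := exists_normalized_card (k := k - a) hMP le_normalizer le_rfl
    (by rw [hb]; exact Nat.pow_le_pow_right hp.out.pos (by omega))
  obtain ⟨N₁, hN₁N, hPN₁, hN₁⟩ := exists_normalized_card (k := a) P.isPGroup'
    le_normalizer_of_normal hNP (by rw [ha]; exact Nat.pow_le_pow_right hp.out.pos a.le_succ)
  have hBP := hBM.trans inf_le_right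
  have hBN : B ⊓ N = ⊥ := le_bot_iff.1 (hdisj ▸ inf_le_inf_right N hBM)
  obtain ⟨hHN, hHc⟩ := card_sup_of_le_normalizer hN₁N (hBP.trans hPN₁) (hBN.trans_le bot_le)
  obtain ⟨e, he⟩ := (h.chain (N₁ ⊔ B) (sup_le (hN₁N.trans hNP) hBP) (by
    rw [hHc, relIndex_of_inf_eq_bot hBN, hN₁, hB, hk, ← pow_add]
    congr 1; omega)).index_normalizer_inf hN hu
  rw [hHN] at he
  have hN₁n : N₁.Normal := normal_of_index_pow P hPN₁ ⟨e, he⟩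
  have ha0 : a = 0 := by
    rcases hN.eq_or_eq N₁ hN₁n bot_le hN₁N with h1 | h1
    · rw [h1, card_bot, eq_comm, Nat.pow_eq_one] at hN₁
      exact hN₁.resolve_left hp.out.one_lt.ne'
    · rw [h1, ha] at hN₁
      exact absurd (Nat.pow_right_injective hp.out.two_le hN₁) (by omega)
  rw [ha0, zero_add, pow_one] at ha
  obtain ⟨z, hzN, hz1, -, hz⟩ := exists_central_mod P.isPGroup'
    (le_normalizer_of_normal (H := (⊥ : Subgroup G))) le_normalizer_of_normal hN.lt hNP
  have hPN : (P : Subgroup G) ≤ centralizer (N : Set G) := by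
    have hzN' : zpowers z = N := by
      have : Fact (Nat.card N).Prime := ⟨ha ▸ hp.out⟩
      refine eq_of_le_of_card_ge (zpowers_le.2 hzN) ?_
      rw [ha, Nat.card_zpowers, orderOf_eq_prime (p := p) ?_ (fun h1 => hz1 (mem_bot.2 h1))]
      exact mem_bot.1 (pow_mem_of_isChiefFactor hNp hN z hzN)
    rw [← hzN']
    refine fun r hr => mem_centralizer_iff.2 fun y hy => ?_
    obtain ⟨j, rfl⟩ := mem_zpowers_iff.1 hy
    have h1 := hz r hr
    rw [mem_bot, mul_inv_eq_one, mul_inv_eq_iff_eq_mul] at h1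
    have h2 : Commute r z := h1
    exact (h2.zpow_right j).symm
  have hMn : (M ⊓ centralizer (N : Set G)).Normal := by
    rw [← normalizer_eq_top_iff, ← top_le_iff, ← hNM']
    refine sup_le ?_ (le_normalizer_inf le_normalizer le_normalizer_of_normal)
    refine le_normalizer_iff.2 fun n hn y hy => ?_
    rw [mem_centralizer_iff.1 hy.2 n hn, mul_inv_cancel_right]
    exact hy
  have hM1 : M ⊓ centralizer (N : Set G) = ⊥ := by
    by_contra hne
    obtain ⟨N', hN', hle⟩ := exists_isChiefFactor_le (bot_lt_iff_ne_bot.2 hne)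
    rw [hu N' hN'] at hle
    exact hN.lt.ne (hNM.symm.trans (inf_eq_left.2 (hle.trans inf_le_left)))
  have hMP1 : M ⊓ (P : Subgroup G) = ⊥ := le_bot_iff.1 (hM1 ▸ inf_le_inf_left M hPN)
  rw [hMP1, card_bot, mul_one] at hPcard
  exact absurd h.lt_card (by rw [hPcard]; omega)

/-! ### The induction -/

theorem card_quotient_lt [Finite G] {N : Subgroup G} [N.Normal] (hN : N ≠ ⊥) :
    Nat.card (G ⧸ N) < Nat.card G := by
  have h1 := card_eq_card_quotient_mul_card_subgroup N
  have h2 := (one_lt_card_iff_ne_bot N).2 hN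
  have h3 : 0 < Nat.card (G ⧸ N) := Nat.card_pos
  rw [h1]
  exact lt_mul_of_one_lt_right h3 h2

/-- A Sylow `2`-subgroup whose image modulo `N` is not quaternion-free has an element whose square
is not in `N`. -/
theorem exists_sq_notMem [Finite G] [Fact (Nat.Prime 2)] (P : Sylow 2 G) (N : Subgroup G)
    [N.Normal]
    (h : ¬ IsQuaternionFree (P.mapSurjective (QuotientGroup.mk'_surjective N))) :
    ∃ x ∈ (P : Subgroup G), x ^ 2 ∉ N := by
  by_contra! hc
  refine h (isQuaternionFree_of_sq fun y => ?_)
  obtain ⟨φ, hφ, hφ'⟩ := sylow_map_surjective P N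
  obtain ⟨x, rfl⟩ := hφ y
  refine Subtype.ext ?_
  rw [SubmonoidClass.coe_pow, hφ', ← map_pow]
  exact (QuotientGroup.eq_one_iff _).2 (hc x x.2)

theorem PiHyp.eq_two_of_dvd [Finite G] {p d : ℕ} [hp : Fact p.Prime] {P : Sylow p G}
    (h : PiHyp p d G P) (h2 : 2 ∣ d) : p = 2 := by
  obtain ⟨k, hk⟩ := h.pow
  rw [hk] at h2
  exact ((Nat.prime_dvd_prime_iff_eq Nat.prime_two hp.out).1
    (Nat.prime_two.dvd_of_dvd_pow h2)).symm

/-- The case in which the hypothesis may fail in `G/N`: `|N| = d/2` and `G/N` has a Sylow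
`2`-subgroup that is not quaternion-free. -/
theorem pLengthLeOne_of_not_quaternionFree [Finite G] [Fact (Nat.Prime 2)] {d : ℕ} {P : Sylow 2 G}
    (h : PiHyp 2 d G P) (h0 : NoPrimeCore 2 G)
    (hlt : ∀ N : Subgroup G, IsChiefFactor ⊥ N → Nat.card N < d)
    (ih : ∀ (N : Subgroup G) [N.Normal], IsChiefFactor ⊥ N → d ≠ 2 * Nat.card N →
      PLengthLeOne 2 (G ⧸ N))
    {N : Subgroup G} [N.Normal] (hN : IsChiefFactor ⊥ N) (hd : d = 2 * Nat.card N)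
    (hQ : ¬ IsQuaternionFree (P.mapSurjective (QuotientGroup.mk'_surjective N))) :
    PLengthLeOne 2 G := by
  have hcard : ∀ N' : Subgroup G, IsChiefFactor ⊥ N' → Nat.card N' = 2 ∨ 4 ≤ Nat.card N' := by
    intro N' hN'
    obtain ⟨a, ha⟩ := (isPGroup_of_isChiefFactor_bot h.psoluble h0 hN').exists_card_eq
    rcases a with _ | _ | a
    · rw [pow_zero, card_eq_one] at ha; exact absurd ha hN'.lt.ne'
    · exact Or.inl ha
    · exact Or.inr (ha ▸ Nat.pow_le_pow_right two_pos (Nat.le_add_left 2 a))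
  rcases hcard N hN with hN2 | hN4
  · have hd4 : d = 4 := by rw [hd, hN2]
    subst hd4
    exact pLengthLeOne_of_eq_four h h0 fun N' hN' =>
      (hcard N' hN').resolve_right (hlt N' hN').not_ge
  by_cases hu : ∀ N', IsChiefFactor ⊥ N' → N' = N
  · obtain ⟨x, hx, hx2⟩ := exists_sq_notMem P N hQ
    exact absurd (sq_mem_of_unique h h0 hN hu hd hN4 x hx) hx2
  push Not at hu
  obtain ⟨N', hN', hne⟩ := hu
  rcases hcard N' hN' with hN2 | hN4'
  · have := hN'.normal_right
    have hNp' := isPGroup_of_isChiefFactor_bot h.psoluble h0 hN'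
    refine (PLengthLeOne.complement_of_quotient h0 hN' hNp' (commute_of_isChiefFactor_bot hN' hNp')
      (ih N' hN' (by omega))).resolve_right fun h1 => h1.2 (commute_of_card_eq_two this hN2)
  · exact (false_of_two_large h h0 hN hd hN4 hN' hne.symm hN4').elim

/-- The induction step when `O_{p'}(G) = 1`. -/
theorem pLengthLeOne_of_noPrimeCore [Finite G] {p d : ℕ} [hp : Fact p.Prime] {P : Sylow p G}
    (h : PiHyp p d G P) (h0 : NoPrimeCore p G)
    (ih : ∀ (N : Subgroup G) [N.Normal] (e : ℕ), N ≠ ⊥ →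
      PiHyp p e (G ⧸ N) (P.mapSurjective (QuotientGroup.mk'_surjective N)) →
      PLengthLeOne p (G ⧸ N)) : PLengthLeOne p G := by
  obtain ⟨l, hl⟩ := h.exists_eq_pow_succ
  rcases eq_or_ne d p with rfl | hdp
  · exact pLengthLeOne_of_eq_prime h h0
  have hpd : p < d := lt_of_le_of_ne (hl ▸ Nat.le_self_pow l.succ_ne_zero p) hdp.symm
  by_cases hlt : ∀ N : Subgroup G, IsChiefFactor ⊥ N → Nat.card N < d
  swap
  · push Not at hlt
    obtain ⟨N, hN, hle⟩ := hlt
    exact pLengthLeOne_of_card_eq h h0 hpd hN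
      (le_antisymm (card_le_of_isChiefFactor_bot h h0 hN) hle)
  have hq : ∀ (N : Subgroup G) [N.Normal], IsChiefFactor ⊥ N →
      (d = 2 * Nat.card N → IsQuaternionFree (P.mapSurjective (QuotientGroup.mk'_surjective N))) →
      PLengthLeOne p (G ⧸ N) := fun N _ hN hQ =>
    ih N _ hN.lt.ne' (h.quotient_pGroup N (isPGroup_of_isChiefFactor_bot h.psoluble h0 hN)
      (hlt N hN) hQ)
  by_cases hall : ∀ (N : Subgroup G) [N.Normal], IsChiefFactor ⊥ N →
      (d = 2 * Nat.card N → IsQuaternionFree (P.mapSurjective (QuotientGroup.mk'_surjective N)))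
  swap
  · push Not at hall
    obtain ⟨N, hNn, hN, hd, hQ⟩ := hall
    obtain rfl := h.eq_two_of_dvd (Dvd.intro _ hd.symm)
    exact pLengthLeOne_of_not_quaternionFree h h0 hlt
      (fun N' _ hN' hne => hq N' hN' fun h1 => absurd h1 hne) hN hd hQ
  have hG : (⊥ : Subgroup G) < ⊤ := bot_lt_iff_ne_bot.2 fun h1 => by
    have h2 := card_le_of_le (le_top : (P : Subgroup G) ≤ ⊤)
    rw [h1, card_bot] at h2
    have := h.one_lt.trans h.lt_card
    omega
  obtain ⟨N, hN, -⟩ := exists_isChiefFactor_le hG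
  have hNn := hN.normal_right
  by_cases hu : ∀ N', IsChiefFactor ⊥ N' → N' = N
  · have hNp := isPGroup_of_isChiefFactor_bot h.psoluble h0 hN
    refine (PLengthLeOne.complement_of_quotient h0 hN hNp (commute_of_isChiefFactor_bot hN hNp)
      (hq N hN (hall N hN))).resolve_right fun ⟨⟨M, hM, hM'⟩, _⟩ =>
        false_of_unique_of_complement h h0 hN hu (hlt N hN) hM hM'
  · push Not at hu
    obtain ⟨N', hN', hne⟩ := hu
    have := hN'.normal_right
    exact pLengthLeOne_of_two_quotients P h0 (inf_eq_bot_of_ne hN hN' hne.symm)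
      (hq N hN (hall N hN)) (hq N' hN' (hall N' hN'))

theorem PiHyp.pLengthLeOne {p : ℕ} [Fact p.Prime] (n : ℕ) :
    ∀ (G : Type*) [Group G] [Finite G] (P : Sylow p G) (d : ℕ), Nat.card G = n →
      PiHyp p d G P → PLengthLeOne p G := by
  induction n using Nat.strong_induction_on with
  | _ n ih =>
    rintro G _ _ P d rfl h
    by_cases h0 : NoPrimeCore p G
    · exact pLengthLeOne_of_noPrimeCore h h0 fun N _ e hN he =>
        ih _ (card_quotient_lt hN) _ _ e rfl he
    · simp only [NoPrimeCore, not_forall] at h0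
      obtain ⟨N, hNn, hNp, hN⟩ := h0
      exact PLengthLeOne.of_quotient_coprime hNp
        (ih _ (card_quotient_lt hN) _ _ d rfl (h.quotient_coprime N hNp))

end PiLength

theorem theorem1p4 {G : Type*} [Group G] [Finite G] (p : ℕ) [Fact p.Prime]
    (hG : IsPSoluble p G) (P : Sylow p G) (d : ℕ) (hd : ∃ k : ℕ, d = p ^ k)
    (hd1 : 1 < d) (hdP : d < Nat.card P)
    (hsub : ∀ H : Subgroup G, H ≤ (P : Subgroup G) → Nat.card H = d → PartialPiProperty H)
    (hcyc : d = 2 → ¬ IsQuaternionFree P →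
      ∀ H : Subgroup G, H ≤ (P : Subgroup G) → IsCyclic H → Nat.card H = 4 →
        PartialPiProperty H) :
    pLength p G ≤ 1 :=
  (PiLength.PiHyp.pLengthLeOne (Nat.card G) G P d rfl
    { psoluble := hG
      pow := hd
      one_lt := hd1
      lt_card := hdP
      chain := fun H hH h =>
        PiLength.hasPiChain_of_partialPiProperty (PiLength.isPGroup_le P.isPGroup' hH)
          (hsub H hH h)
      cyclic := fun h2 hQ H hH hc h =>
        PiLength.hasPiChain_of_partialPiProperty (PiLength.isPGroup_le P.isPGroup' hH)
          (hcyc h2 hQ H hH hc h) }).pLength_le_one
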